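/- Let $N\ge 1$ and let $\omega_1,\dots,\omega_N>0$ be pairwise distinct (for instance non-resonant). Let $A$ be the block diagonal $2N\times 2N$ matrix with blocks $\begin{pmatrix}0&1\\-\omega_i^2&0\end{pmatrix}$ and $B=(0,1,\dots,0,1)^*\in\mathbb{R}^{2N}$. For $p=(\xi_1,\eta_1,\dots,\xi_N,\eta_N)\in\mathbb{R}^{2N}$ put $z_i=(\eta_i^2+\omega_i^{-2}\xi_i^2)^{1/2}$ and $$H(p)=\frac1{(2\pi)^N}\int_0^{2\pi}\!\!\cdots\int_0^{2\pi}\Bigl|\sum_{i=1}^N z_i\cos\varphi_i\Bigr|\,d\varphi_1\dots d\varphi_N .$$ Let $\Omega=\{x:(p,x)\le H(p)\text{ for all }p\}$ be the convex body with support function $H$, and let $\rho$ be its gauge, $\rho(x)=\inf\{T>0: x\in T\Omega\}$. For $p$ with $H(p)=1$ let $$\widetilde B=\widetilde B(p)=\frac{\partial^2\rho}{\partial x^2}(\phi)\,B,\quad \phi=\frac{\partial H}{\partial p}(p)\in\partial\Omega,\qquad f(p)=\frac{(p,AB)}{(\widetilde B,B)},$$ where $f(p):=0$ at points where $(\widetilde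 B,B)=0$ (at these exceptional points of the sphere $\widetilde\sigma$ below also $\widetilde B=0$, so this choice does not affect the equation). Consider the dynamical system $$\dot p=-A^*p+\widetilde B f(p)\quad\text{on the topological sphere}\quad \widetilde\sigma=\{p: H(p)=1,\ (p,B)=0\}.$$ A trajectory is a differentiable curve $p:\mathbb{R}\to\widetilde\sigma$ that satisfies this equation at every $t\in\mathbb{R}$. Then the minimum over all trajectories $$\mu=\min_{p(\cdot)}\ \sup_{t\in\mathbb{R}}|f(p(t))|$$ (the supremum being taken in $[0,+\infty]$) is attained, finite and strictly positive. -/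

import Mathlib

open scoped ENNReal

noncomputable section

namespace OscillatorDamping

/-- The space `ℝ^{2N}` with its Euclidean inner product. The coordinates of a phase vector are
`x_i = x (0, i)`, `y_i = x (1, i)`; those of a momentum are `ξ_i = p (0, i)` (dual to `x_i`) and
`η_i = p (1, i)` (dual to `y_i`). -/
abbrev Space (N : ℕ) : Type := EuclideanSpace ℝ (Fin 2 × Fin N)

/-- The block diagonal matrix with blocks `(0, 1; -ω_i ^ 2, 0)`. -/
def oscMatrix {N : ℕ} (ω : Fin N → ℝ) : Matrix (Fin 2 × Fin N) (Fin 2 × Fin N) ℝ :=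
  Matrix.blockDiagonal fun i => !![0, 1; -(ω i) ^ 2, 0]

/-- The vector `B = (0, 1, …, 0, 1)`: every `x_i` is `0` and every `y_i` is `1`. -/
def inputVec (N : ℕ) : Space N :=
  WithLp.toLp 2 fun k => if k.1 = 1 then 1 else 0

/-- The amplitudes `z_i = (η_i ^ 2 + ω_i ^ (-2) ξ_i ^ 2) ^ (1 / 2)` of a momentum. -/
def amplitude {N : ℕ} (ω : Fin N → ℝ) (p : Space N) (i : Fin N) : ℝ :=
  Real.sqrt ((p (1, i)) ^ 2 + ((ω i) ^ 2)⁻¹ * (p (0, i)) ^ 2)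

/-- `(2π)^{-N} ∫_{[0,2π]^N} |∑ z_i cos φ_i| dφ`. -/
def meanAbs {N : ℕ} (z : Fin N → ℝ) : ℝ :=
  ((2 * Real.pi) ^ N)⁻¹ *
    ∫ φ in Set.pi Set.univ (fun _ : Fin N => Set.Icc (0 : ℝ) (2 * Real.pi)),
      |∑ i, z i * Real.cos (φ i)|

/-- The function `H` on momenta, `H(p) = (2π)^{-N} ∫ |∑ z_i cos φ_i| dφ`. -/
def supportFn {N : ℕ} (ω : Fin N → ℝ) (p : Space N) : ℝ :=
  meanAbs (amplitude ω p)

/-- The convex body `Ω` with support function `H`. -/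
def limitBody {N : ℕ} (ω : Fin N → ℝ) : Set (Space N) :=
  {x | ∀ p : Space N, inner ℝ p x ≤ supportFn ω p}

/-- The function `ρ`, with `ρ(x) = T` exactly for `x` on the boundary of `T Ω`. -/
def rho {N : ℕ} (ω : Fin N → ℝ) : Space N → ℝ :=
  gauge (limitBody ω)

/-- The boundary point `φ` of `Ω` whose momentum `∂ρ/∂x (φ)` is `p`, namely `φ = ∂H/∂p (p)`. -/
def bodyPoint {N : ℕ} (ω : Fin N → ℝ) (p : Space N) : Space N :=
  gradient (supportFn ω) p

/-- `B̃ = ∂²ρ/∂x² (φ) B`, the Hessian of `ρ` at the boundary point `φ` with momentum `p`,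
applied to `B`. -/
def bTilde {N : ℕ} (ω : Fin N → ℝ) (p : Space N) : Space N :=
  fderiv ℝ (gradient (rho ω)) (bodyPoint ω p) (inputVec N)

/-- The singular control `f(p) = (p, AB) / (B̃, B)`. The quotient is read as `0` at the exceptional
points of the sphere where `(B̃, B) = 0`; there `B̃ = 0` too, so that the value does not
affect the equation of motion. -/
def singularControl {N : ℕ} (ω : Fin N → ℝ) (p : Space N) : ℝ :=
  inner ℝ p ((oscMatrix ω).toEuclideanLin (inputVec N)) / inner ℝ (bTilde ω p) (inputVec N)

/-- The topological sphere `{H(p) = 1, (p, B) = 0}`. -/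
def singularSphere {N : ℕ} (ω : Fin N → ℝ) : Set (Space N) :=
  {p | supportFn ω p = 1 ∧ inner ℝ p (inputVec N) = 0}

/-- A complete trajectory of `ṗ = -A^* p + B̃ f(p)` on the sphere `{H(p) = 1, (p, B) = 0}`. -/
structure IsTrajectory {N : ℕ} (ω : Fin N → ℝ) (p : ℝ → Space N) : Prop where
  mem_sphere : ∀ t, p t ∈ singularSphere ω
  hasDerivAt : ∀ t, HasDerivAt p
    (-((oscMatrix ω).transpose.toEuclideanLin (p t)) + singularControl ω (p t) • bTilde ω (p t)) t

/-- The supremum of `|f|` along a curve, a value in `[0, ∞]`. -/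
def maxControl {N : ℕ} (ω : Fin N → ℝ) (p : ℝ → Space N) : ℝ≥0∞ :=
  ⨆ t : ℝ, ENNReal.ofReal |singularControl ω (p t)|

end OscillatorDamping

end

noncomputable section

namespace OscillatorDamping

open MeasureTheory Set Filter Topology

/-! ### Elementary inequalities for the sine and the arcsine -/

/-! `H` sees `p` only through its amplitudes: if the coordinates of `c` are independent with the law
of the cosine of a uniform phase (the arcsine law), then `H(p) = E|z · c|`. Thus `meanAbs` is a norm
on `ℝ^N`, and `ρ` is its dual norm `dualNorm` evaluated at the radii of `x`. Everything rests on one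
regularity statement: `ρ` is twice continuously differentiable away from the origin, so that `B̃`
depends continuously on `p`.

The norm `meanAbs` is C¹ with strictly convex unit ball, so `dualNorm` is C¹ and its gradient
`dualGrad w` is the unique maximizer of `z · w` on the unit sphere of `meanAbs`. To differentiate
`dualGrad`, normalize its largest coordinate to `±1` and integrate out the corresponding phase: the
gradient of `meanAbs` becomes `chartGrad ζ = (2/π) E[arcsin(ζ · c) c]` with `ζ` in the unit cube.
The arcsine has infinite slope at `±1`. If `ζ · c` stays away from `±1`, or if two coordinates of
`ζ` are nonzero, so that two independent phases smooth the singularity, then `chartGrad` is strictly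
differentiable with injective derivative, and the inverse function theorem applies. The only other
case is `ζ = ±e_j` (two equal amplitudes, all others zero). There the mean slope is infinite,
`chartGrad` expands distances by arbitrarily large factors, and its inverse has derivative zero.
This is `exists_hasStrictFDerivAt_dualGrad`; sign symmetry then carries differentiability to phase
space across vanishing radii.

The Hessian of `ρ` is symmetric and nonnegative, so `(B̃, B) = 0` forces `B̃ = 0`. Hence
`controlBound ω M`, the part of the sphere where `|(p, AB)| ≤ M (B̃, B)`, is compact, the vector
field is continuous on it, and it contains every trajectory with `|f| ≤ M`. Ultrafilter limits of
minimizing sequences of trajectories are again trajectories, so a finite infimum is attained. It is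
finite because `ρ` is invariant under the free oscillation, which produces an equilibrium
(`exists_equilibrium`). It is positive because `f = 0` along a whole trajectory would make every
derivative of `(p, B) = 0` a linear relation, and the Vandermonde determinant in the distinct `ω_i ^
2` would give `p = 0`. -/

theorem abs_sin_sub_sin_ge {θ τ : ℝ} (hθ : |θ| ≤ Real.pi / 2) (hτ : |τ| ≤ Real.pi / 2) :
    2 / Real.pi ^ 2 * (|θ - τ| * (Real.pi - |θ + τ|)) ≤ |Real.sin θ - Real.sin τ| := by
  have hpi := Real.pi_pos
  have h1 := abs_le.1 hθ
  have h2 := abs_le.1 hτ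
  rw [Real.sin_sub_sin, abs_mul, abs_mul, abs_of_pos (by norm_num : (0 : ℝ) < 2)]
  have hs : 2 / Real.pi * |(θ - τ) / 2| ≤ |Real.sin ((θ - τ) / 2)| :=
    Real.mul_abs_le_abs_sin (abs_le.2 ⟨by linarith, by linarith⟩)
  have hc : 1 - 2 / Real.pi * |(θ + τ) / 2| ≤ Real.cos ((θ + τ) / 2) := by
    rw [← Real.cos_abs]
    exact Real.one_sub_mul_le_cos (abs_nonneg _) (abs_le.2 ⟨by linarith, by linarith⟩)
  have hc' := hc.trans (le_abs_self _)
  have h3 : |θ + τ| ≤ Real.pi := abs_le.2 ⟨by linarith, by linarith⟩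
  rw [abs_div, abs_of_pos (by norm_num : (0 : ℝ) < 2)] at hs hc'
  have h4 : 1 - 2 / Real.pi * (|θ + τ| / 2) = (Real.pi - |θ + τ|) / Real.pi := by field_simp
  rw [h4] at hc'
  have h5 : 2 / Real.pi * (|θ - τ| / 2) = |θ - τ| / Real.pi := by field_simp
  rw [h5] at hs
  have := mul_le_mul hs hc' (div_nonneg (by linarith) hpi.le) (abs_nonneg _)
  calc 2 / Real.pi ^ 2 * (|θ - τ| * (Real.pi - |θ + τ|))
      = 2 * (|θ - τ| / Real.pi * ((Real.pi - |θ + τ|) / Real.pi)) := by field_simp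
    _ ≤ 2 * (|Real.sin ((θ - τ) / 2)| * |Real.cos ((θ + τ) / 2)|) := by gcongr
    _ = _ := by ring

theorem abs_arcsin_le (t : ℝ) : |Real.arcsin t| ≤ Real.pi / 2 :=
  abs_le.2 ⟨Real.neg_pi_div_two_le_arcsin t, Real.arcsin_le_pi_div_two t⟩

theorem sq_sub_le_abs_sin_sub_sin {θ τ : ℝ} (hθ : |θ| ≤ Real.pi / 2) (hτ : |τ| ≤ Real.pi / 2) :
    |θ - τ| ^ 2 ≤ Real.pi ^ 2 / 2 * |Real.sin θ - Real.sin τ| := by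
  have hpi := Real.pi_pos
  have h := abs_sin_sub_sin_ge hθ hτ
  have h1 := abs_le.1 hθ
  have h2 := abs_le.1 hτ
  -- Indeed `|θ - τ| + |θ + τ| = 2 max(|θ|, |τ|) ≤ π`.
  have h3 : |θ - τ| ≤ Real.pi - |θ + τ| := by
    rcases abs_cases (θ - τ) with ⟨a, _⟩ | ⟨a, _⟩ <;>
    rcases abs_cases (θ + τ) with ⟨b, _⟩ | ⟨b, _⟩ <;> rw [a, b] <;> linarith
  calc |θ - τ| ^ 2 = Real.pi ^ 2 / 2 * (2 / Real.pi ^ 2 * (|θ - τ| * |θ - τ|)) := by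
        field_simp
    _ ≤ Real.pi ^ 2 / 2 * (2 / Real.pi ^ 2 * (|θ - τ| * (Real.pi - |θ + τ|))) := by gcongr
    _ ≤ _ := by gcongr

/-- The arcsine is Hölder of exponent 1/2. Values of `t` outside `[-1, 1]` are harmless, since
`Real.arcsin` clamps them and clamping only brings `t` closer to `sin θ`. -/
theorem sq_sub_arcsin_le {θ : ℝ} (hθ : |θ| ≤ Real.pi / 2) (t : ℝ) :
    |θ - Real.arcsin t| ^ 2 ≤ Real.pi ^ 2 / 2 * |Real.sin θ - t| := by
  refine (sq_sub_le_abs_sin_sub_sin hθ (abs_arcsin_le t)).trans ?_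
  gcongr ?_ * ?_
  have h1 := Real.neg_one_le_sin θ
  have h2 := Real.sin_le_one θ
  rcases le_total t (-1) with h | h
  · rw [Real.arcsin_of_le_neg_one h, Real.sin_neg, Real.sin_pi_div_two,
      abs_of_nonneg (by linarith), abs_of_nonneg (by linarith)]
    linarith
  rcases le_total t 1 with h' | h'
  · rw [Real.sin_arcsin h h']
  · rw [Real.arcsin_of_one_le h', Real.sin_pi_div_two, abs_of_nonpos (by linarith),
      abs_of_nonpos (by linarith)]
    linarith

/-- Inside `[-1, 1]`, the minimum is at most `√(1 - t ^ 2) = cos τ`, which is at most the factor `π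
- |θ + τ|` of `abs_sin_sub_sin_ge`. Outside, the inequality of arithmetic and geometric means
combines the Hölder bound at `±1` with the distance of `t` to `±1`. -/
theorem min_sqrt_mul_sub_arcsin_le {θ : ℝ} (hθ : |θ| ≤ Real.pi / 2) (t : ℝ) :
    min √|t - 1| √|t + 1| * |θ - Real.arcsin t| ≤ Real.pi ^ 2 / 2 * |Real.sin θ - t| := by
  have hpi := Real.pi_gt_three
  have key : ∀ t : ℝ, 1 < t → ∀ θ : ℝ, |θ| ≤ Real.pi / 2 →
      √|t - 1| * |θ - Real.arcsin t| ≤ Real.pi ^ 2 / 2 * |Real.sin θ - t| := by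
    intro t ht θ hθ
    have h := sq_sub_arcsin_le hθ 1
    rw [Real.arcsin_one] at h
    rw [Real.arcsin_of_one_le ht.le]
    have h2 := Real.sin_le_one θ
    rw [abs_of_nonpos (by linarith : Real.sin θ - 1 ≤ 0)] at h
    rw [abs_of_nonpos (by linarith : Real.sin θ - t ≤ 0), abs_of_nonneg (by linarith : 0 ≤ t - 1)]
    have h3 := Real.sq_sqrt (by linarith : 0 ≤ t - 1)
    have h4 : 0 ≤ (Real.pi ^ 2 / 2 - 1) * (t - 1) :=
      mul_nonneg (by nlinarith) (by linarith)
    nlinarith [sq_nonneg (√(t - 1) - |θ - Real.pi / 2|), sq_nonneg |θ - Real.pi / 2|]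
  rcases lt_or_ge 1 t with h | h
  · exact (mul_le_mul_of_nonneg_right (min_le_left _ _) (abs_nonneg _)).trans (key t h θ hθ)
  rcases lt_or_ge t (-1) with h' | h'
  · have := key (-t) (by linarith) (-θ) (by rwa [abs_neg])
    rw [Real.arcsin_neg, Real.sin_neg, show -t - 1 = -(t + 1) by ring,
      show -θ - -Real.arcsin t = -(θ - Real.arcsin t) by ring,
      show -Real.sin θ - -t = -(Real.sin θ - t) by ring, abs_neg, abs_neg, abs_neg] at this
    exact (mul_le_mul_of_nonneg_right (min_le_right _ _) (abs_nonneg _)).trans this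
  · set τ := Real.arcsin t with hτ
    have hτb := abs_arcsin_le t
    have hst : Real.sin τ = t := Real.sin_arcsin h' h
    have hcore := abs_sin_sub_sin_ge hθ hτb
    rw [hst] at hcore
    have h3 : Real.cos τ ≤ Real.pi - |θ + τ| := by
      have e1 : Real.cos τ = Real.sin (Real.pi / 2 - |τ|) := by
        rw [Real.sin_pi_div_two_sub, Real.cos_abs]
      have e2 : Real.sin (Real.pi / 2 - |τ|) ≤ Real.pi / 2 - |τ| :=
        Real.sin_le (by linarith)
      have e3 := abs_add_le θ τ
      linarith
    have h4 : min √|t - 1| √|t + 1| ≤ Real.cos τ := by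
      rw [hτ, Real.cos_arcsin, show 1 - t ^ 2 = (1 - t) * (1 + t) by ring,
        Real.sqrt_mul (by linarith), abs_of_nonpos (by linarith), abs_of_nonneg (by linarith),
        show -(t - 1) = 1 - t by ring, add_comm t 1]
      rcases le_total t 0 with h0 | h0
      · refine (min_le_right _ _).trans (le_mul_of_one_le_left (Real.sqrt_nonneg _) ?_)
        exact Real.one_le_sqrt.2 (by linarith)
      · refine (min_le_left _ _).trans (le_mul_of_one_le_right (Real.sqrt_nonneg _) ?_)
        exact Real.one_le_sqrt.2 (by linarith)
    calc min √|t - 1| √|t + 1| * |θ - τ| ≤ (Real.pi - |θ + τ|) * |θ - τ| := by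
          gcongr; exact h4.trans h3
      _ = Real.pi ^ 2 / 2 * (2 / Real.pi ^ 2 * (|θ - τ| * (Real.pi - |θ + τ|))) := by
          field_simp
      _ ≤ _ := by gcongr

/-- The slopes of the arcsine through `a` are controlled by the distance of `a` to `±1`. -/
theorem min_sqrt_mul_arcsin_sub_le (a b : ℝ) :
    min √|a - 1| √|a + 1| * |Real.arcsin b - Real.arcsin a| ≤ Real.pi ^ 2 / 2 * |b - a| := by
  rcases le_total b (-1) with h | h
  · rcases le_total a (-1) with h' | h'
    · rw [Real.arcsin_of_le_neg_one h, Real.arcsin_of_le_neg_one h']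
      simp; positivity
    · have := min_sqrt_mul_sub_arcsin_le (abs_arcsin_le (-1)) a
      rw [Real.sin_arcsin le_rfl (by norm_num)] at this
      rw [Real.arcsin_of_le_neg_one h, ← Real.arcsin_neg_one]
      refine this.trans ?_
      gcongr ?_ * ?_
      rw [abs_of_nonpos (by linarith), abs_of_nonpos (by linarith)]
      linarith
  rcases le_total b 1 with h1 | h1
  · have := min_sqrt_mul_sub_arcsin_le (abs_arcsin_le b) a
    rwa [Real.sin_arcsin h h1] at this
  · rcases le_total a 1 with h' | h'
    · have := min_sqrt_mul_sub_arcsin_le (abs_arcsin_le 1) a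
      rw [Real.sin_arcsin (by norm_num) le_rfl] at this
      rw [Real.arcsin_of_one_le h1, ← Real.arcsin_one]
      refine this.trans ?_
      gcongr ?_ * ?_
      rw [abs_of_nonneg (by linarith), abs_of_nonneg (by linarith)]
      linarith
    · rw [Real.arcsin_of_one_le h1, Real.arcsin_of_one_le h']
      simp; positivity

/-- Turns lower bounds on distances into upper bounds on singular kernels. The convention `0 ^ (-p)
= ⊤` spares all case distinctions at the singularity. -/
theorem rpow_neg_le_of_le_mul {a b K : ℝ≥0∞} {p : ℝ} (hp : 0 < p) (hK0 : K ≠ 0) (hK : K ≠ ⊤)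
    (h : a ≤ K * b) : b ^ (-p) ≤ K ^ p * a ^ (-p) := by
  have h1 : a ^ p ≤ K ^ p * b ^ p := by
    rw [← ENNReal.mul_rpow_of_nonneg _ _ hp.le]
    exact ENNReal.rpow_le_rpow h hp.le
  have k0 : K ^ p ≠ 0 := by simp [hK0, hK]
  have k1 : K ^ p ≠ ⊤ := ENNReal.rpow_ne_top_of_nonneg hp.le hK
  rw [ENNReal.rpow_neg, ENNReal.rpow_neg]
  calc (b ^ p)⁻¹ = K ^ p * (K ^ p * b ^ p)⁻¹ := by
        rw [ENNReal.mul_inv (Or.inl k0) (Or.inl k1), ← mul_assoc, ENNReal.mul_inv_cancel k0 k1,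
          one_mul]
    _ ≤ _ := by gcongr

/-! ### The arcsine law -/

/-- The law of `sin θ` for `θ` uniform in `[-π/2, π/2]`. -/
def arcsineLaw : Measure ℝ :=
  (ENNReal.ofReal Real.pi)⁻¹ •
    (volume.restrict (Icc (-(Real.pi / 2)) (Real.pi / 2))).map Real.sin

theorem lintegral_arcsineLaw {F : ℝ → ℝ≥0∞} (hF : Measurable F) :
    ∫⁻ c, F c ∂arcsineLaw = (ENNReal.ofReal Real.pi)⁻¹ *
      ∫⁻ θ in Icc (-(Real.pi / 2)) (Real.pi / 2), F (Real.sin θ) := by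
  rw [arcsineLaw, lintegral_smul_measure, lintegral_map hF Real.measurable_sin, smul_eq_mul]

instance : IsProbabilityMeasure arcsineLaw := by
  constructor
  rw [arcsineLaw, Measure.smul_apply, Measure.map_apply Real.measurable_sin MeasurableSet.univ]
  simp only [preimage_univ, Measure.restrict_apply_univ, Real.volume_Icc, smul_eq_mul]
  rw [show Real.pi / 2 - -(Real.pi / 2) = Real.pi by ring]
  exact ENNReal.inv_mul_cancel (by simp [Real.pi_pos]) ENNReal.ofReal_ne_top

theorem arcsineLaw_apply {s : Set ℝ} (hs : MeasurableSet s) :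
    arcsineLaw s = (ENNReal.ofReal Real.pi)⁻¹ *
      volume (Real.sin ⁻¹' s ∩ Icc (-(Real.pi / 2)) (Real.pi / 2)) := by
  rw [arcsineLaw, Measure.smul_apply, Measure.map_apply Real.measurable_sin hs,
    Measure.restrict_apply (Real.measurable_sin hs), smul_eq_mul]

theorem ae_arcsineLaw_abs_le : ∀ᵐ c ∂arcsineLaw, |c| ≤ 1 := by
  have : MeasurableSet {c : ℝ | |c| ≤ 1}ᶜ :=
    (measurableSet_le (by fun_prop) measurable_const).compl
  rw [ae_iff]
  change arcsineLaw {c : ℝ | |c| ≤ 1}ᶜ = 0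
  rw [arcsineLaw_apply this]
  have e : Real.sin ⁻¹' {c : ℝ | |c| ≤ 1}ᶜ = ∅ := by
    ext x; simp [Real.abs_sin_le_one]
  simp [e]

instance : NullSingletonClass arcsineLaw := by
  constructor
  intro t
  rw [arcsineLaw_apply (measurableSet_singleton t)]
  have : (Real.sin ⁻¹' {t} ∩ Icc (-(Real.pi / 2)) (Real.pi / 2)).Subsingleton := by
    rintro a ⟨ha, ha'⟩ b ⟨hb, hb'⟩
    exact Real.injOn_sin ha' hb' (by rw [mem_preimage, mem_singleton_iff] at ha hb; rw [ha, hb])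
  rw [this.measure_zero, mul_zero]

theorem map_neg_arcsineLaw : arcsineLaw.map (fun c => -c) = arcsineLaw := by
  ext s hs
  rw [Measure.map_apply measurable_neg hs, arcsineLaw_apply (measurable_neg hs),
    arcsineLaw_apply hs]
  congr 1
  have : Real.sin ⁻¹' ((fun c : ℝ => -c) ⁻¹' s) ∩ Icc (-(Real.pi / 2)) (Real.pi / 2) =
      (fun x : ℝ => -x) ⁻¹' (Real.sin ⁻¹' s ∩ Icc (-(Real.pi / 2)) (Real.pi / 2)) := by
    ext x
    simp only [mem_inter_iff, mem_preimage, mem_Icc, Real.sin_neg]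
    constructor <;> rintro ⟨h, h1, h2⟩ <;> exact ⟨h, by linarith, by linarith⟩
  rw [this]
  exact Measure.measure_preimage_neg volume _

/-- The two half periods of the cosine are, after a reflection and a translation respectively, the
sine on `[-π/2, π/2]`. -/
theorem map_cos_restrict :
    (volume.restrict (Icc (0 : ℝ) (2 * Real.pi))).map Real.cos =
      ENNReal.ofReal (2 * Real.pi) • arcsineLaw := by
  have hpi := Real.pi_pos
  have e1 : volume.restrict (Icc (0 : ℝ) (2 * Real.pi)) =
      volume.restrict (Ico (0 : ℝ) Real.pi) + volume.restrict (Icc Real.pi (2 * Real.pi)) := by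
    rw [← Measure.restrict_union _ measurableSet_Icc, Ico_union_Icc_eq_Icc hpi.le (by linarith)]
    rw [Set.disjoint_left]; rintro x ⟨_, h⟩ ⟨h', _⟩; linarith
  have e2 : (volume.restrict (Ico (0 : ℝ) Real.pi)).map Real.cos =
      (volume.restrict (Icc (-(Real.pi / 2)) (Real.pi / 2))).map Real.sin := by
    rw [Measure.restrict_congr_set Ico_ae_eq_Icc]
    have mp := (Measure.measurePreserving_sub_left (volume : Measure ℝ) (Real.pi / 2)).restrict_preimage
      (measurableSet_Icc (a := -(Real.pi / 2)) (b := Real.pi / 2))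
    have : (fun x : ℝ => Real.pi / 2 - x) ⁻¹' Icc (-(Real.pi / 2)) (Real.pi / 2) =
        Icc 0 Real.pi := by
      ext x; simp only [mem_preimage, mem_Icc]
      constructor <;> rintro ⟨h1, h2⟩ <;> constructor <;> linarith
    rw [this] at mp
    rw [← mp.map_eq, Measure.map_map Real.measurable_sin (by fun_prop)]
    congr 1; ext x; simp [Real.sin_pi_div_two_sub]
  have e3 : (volume.restrict (Icc Real.pi (2 * Real.pi))).map Real.cos =
      (volume.restrict (Icc (-(Real.pi / 2)) (Real.pi / 2))).map Real.sin := by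
    have mp := (measurePreserving_sub_right (volume : Measure ℝ) (3 * Real.pi / 2)).restrict_preimage
      (measurableSet_Icc (a := -(Real.pi / 2)) (b := Real.pi / 2))
    have : (fun x : ℝ => x - 3 * Real.pi / 2) ⁻¹' Icc (-(Real.pi / 2)) (Real.pi / 2) =
        Icc Real.pi (2 * Real.pi) := by
      ext x; simp only [mem_preimage, mem_Icc]
      constructor <;> rintro ⟨h1, h2⟩ <;> constructor <;> linarith
    rw [this] at mp
    rw [← mp.map_eq, Measure.map_map Real.measurable_sin (by fun_prop)]
    congr 1; ext x
    simp only [Function.comp]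
    rw [show x - 3 * Real.pi / 2 = x - Real.pi / 2 - Real.pi by ring, Real.sin_sub_pi,
      Real.sin_sub_pi_div_two, neg_neg]
  rw [e1, Measure.map_add _ _ Real.measurable_cos, e2, e3, arcsineLaw, smul_smul,
    ENNReal.ofReal_mul (by norm_num), mul_assoc, ENNReal.mul_inv_cancel (by simp [hpi])
    ENNReal.ofReal_ne_top, mul_one, ← two_smul ℝ≥0∞]
  norm_num

theorem arcsineLaw_real_Ioi (t : ℝ) :
    arcsineLaw.real (Ioi t) = (Real.pi / 2 - Real.arcsin t) / Real.pi := by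
  have hpi := Real.pi_pos
  have h : volume (Real.sin ⁻¹' Ioi t ∩ Icc (-(Real.pi / 2)) (Real.pi / 2)) =
      ENNReal.ofReal (Real.pi / 2 - Real.arcsin t) := by
    rw [← Real.volume_Ioc]
    apply measure_congr
    -- Only the left endpoint can distinguish the two sets, namely when `t < -1` and the clamped
    -- `arcsin t` equals `-π/2`.
    have : ∀ᵐ x : ℝ, x ≠ -(Real.pi / 2) := by simp [ae_iff]
    filter_upwards [this] with x hx
    apply propext
    change (t < Real.sin x ∧ -(Real.pi / 2) ≤ x ∧ x ≤ Real.pi / 2) ↔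
      (Real.arcsin t < x ∧ x ≤ Real.pi / 2)
    constructor
    · rintro ⟨h1, h2, h3⟩
      exact ⟨(Real.arcsin_lt_iff_lt_sin' ⟨lt_of_le_of_ne h2 hx.symm, h3⟩).2 h1, h3⟩
    · rintro ⟨h1, h3⟩
      have h2 : -(Real.pi / 2) < x := (Real.neg_pi_div_two_le_arcsin t).trans_lt h1
      exact ⟨(Real.arcsin_lt_iff_lt_sin' ⟨h2, h3⟩).1 h1, h2.le, h3⟩
  rw [Measure.real, arcsineLaw_apply measurableSet_Ioi, h, ENNReal.toReal_mul,
    ENNReal.toReal_inv, ENNReal.toReal_ofReal hpi.le,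
    ENNReal.toReal_ofReal (by linarith [Real.arcsin_le_pi_div_two t])]
  field_simp

theorem measurable_sign : Measurable Real.sign := by
  unfold Real.sign
  exact Measurable.ite measurableSet_Iio measurable_const
    (Measurable.ite measurableSet_Ioi measurable_const measurable_const)

theorem abs_sign_le (x : ℝ) : |Real.sign x| ≤ 1 := by
  rcases lt_trichotomy x 0 with h | h | h
  · simp [Real.sign_of_neg h]
  · simp [h]
  · simp [Real.sign_of_pos h]

/-- The mean sign is the difference of the two tail probabilities. This is where the arcsine enters:
integrating out one phase smooths the sign into an arcsine. -/
theorem integral_sign_add (s : ℝ) :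
    ∫ c, Real.sign (c + s) ∂arcsineLaw = 2 / Real.pi * Real.arcsin s := by
  have hpi := Real.pi_pos
  have h0 : ∀ᵐ c ∂arcsineLaw, c ≠ -s := by simp [ae_iff, measure_singleton]
  have h1 : (fun c => Real.sign (c + s)) =ᵐ[arcsineLaw]
      fun c => 2 * (Ioi (-s)).indicator 1 c - 1 := by
    filter_upwards [h0] with c hc
    rcases lt_or_gt_of_ne hc with h | h
    · rw [Real.sign_of_neg (by linarith), indicator_of_notMem (by simp [h.le])]; norm_num
    · rw [Real.sign_of_pos (by linarith), indicator_of_mem (by simpa using h)]; norm_num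
  rw [integral_congr_ae h1, integral_sub, integral_const_mul, integral_indicator_one
    measurableSet_Ioi, arcsineLaw_real_Ioi, Real.arcsin_neg]
  · simp; field_simp; ring
  · exact ((integrable_indicator_iff measurableSet_Ioi).2 (integrable_const _).integrableOn).const_mul _
  · exact integrable_const _

theorem sign_mul (a b : ℝ) : Real.sign (a * b) = Real.sign a * Real.sign b := by
  rcases lt_trichotomy a 0 with h | h | h <;> rcases lt_trichotomy b 0 with h' | h' | h'
  · rw [Real.sign_of_pos (mul_pos_of_neg_of_neg h h'), Real.sign_of_neg h, Real.sign_of_neg h']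
    norm_num
  · simp [h']
  · rw [Real.sign_of_neg (mul_neg_of_neg_of_pos h h'), Real.sign_of_neg h, Real.sign_of_pos h']
    norm_num
  · simp [h]
  · simp [h]
  · simp [h]
  · rw [Real.sign_of_neg (mul_neg_of_pos_of_neg h h'), Real.sign_of_pos h, Real.sign_of_neg h']
    norm_num
  · simp [h']
  · rw [Real.sign_of_pos (mul_pos h h'), Real.sign_of_pos h, Real.sign_of_pos h']
    norm_num

theorem integral_sign_mul_add {a : ℝ} (ha : a ≠ 0) (s : ℝ) :
    ∫ c, Real.sign (a * c + s) ∂arcsineLaw = 2 / Real.pi * Real.arcsin (s / |a|) := by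
  have key : ∀ a : ℝ, 0 < a → ∀ s : ℝ,
      ∫ c, Real.sign (a * c + s) ∂arcsineLaw = 2 / Real.pi * Real.arcsin (s / a) := by
    intro a ha s
    rw [← integral_sign_add]
    congr 1; ext c
    rw [show a * c + s = a * (c + s / a) by field_simp, sign_mul, Real.sign_of_pos ha, one_mul]
  rcases lt_or_gt_of_ne ha with h | h
  · rw [abs_of_neg h, ← key (-a) (by linarith)]
    conv_lhs => rw [← map_neg_arcsineLaw]
    rw [integral_map measurable_neg.aemeasurable]
    · simp
    · exact (measurable_sign.comp (by fun_prop)).aestronglyMeasurable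
  · rw [abs_of_pos h, key a h]

/-! ### Singular integrals against the arcsine law -/

theorem lintegral_enorm_rpow_lt_top :
    ∫⁻ x in Icc (-Real.pi) Real.pi, ‖x‖ₑ ^ (-(3 / 4) : ℝ) < ⊤ := by
  have hpi := Real.pi_pos
  have h1 : ∫⁻ x in Ioc 0 Real.pi, ‖x‖ₑ ^ (-(3 / 4) : ℝ) < ⊤ := by
    have h := (intervalIntegral.intervalIntegrable_rpow' (a := 0) (b := Real.pi)
      (by norm_num : (-1 : ℝ) < -(3 / 4))).1
    have := h.lintegral_lt_top
    refine lt_of_le_of_lt (setLIntegral_mono' measurableSet_Ioc fun x hx => ?_) this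
    rw [Real.enorm_of_nonneg hx.1.le, ENNReal.ofReal_rpow_of_pos hx.1]
  have h2 : ∫⁻ x in Ico (-Real.pi) 0, ‖x‖ₑ ^ (-(3 / 4) : ℝ) < ⊤ := by
    have mp := (Measure.measurePreserving_neg (volume : Measure ℝ)).restrict_preimage
      (measurableSet_Ioc (a := (0 : ℝ)) (b := Real.pi))
    have e : (Neg.neg : ℝ → ℝ) ⁻¹' Ioc 0 Real.pi = Ico (-Real.pi) 0 := by
      ext x; simp only [mem_preimage, mem_Ioc, mem_Ico]
      constructor <;> rintro ⟨h1, h2⟩ <;> constructor <;> linarith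
    rw [e] at mp
    rw [← mp.lintegral_comp (by fun_prop)] at h1
    simpa using h1
  have h3 : Icc (-Real.pi) Real.pi ⊆ Ico (-Real.pi) 0 ∪ ({0} ∪ Ioc 0 Real.pi) := by
    intro x hx
    rcases lt_trichotomy x 0 with h | h | h
    · exact Or.inl ⟨hx.1, h⟩
    · exact Or.inr (Or.inl h)
    · exact Or.inr (Or.inr ⟨h, hx.2⟩)
  calc _ ≤ ∫⁻ x in Ico (-Real.pi) 0 ∪ ({0} ∪ Ioc 0 Real.pi), ‖x‖ₑ ^ (-(3 / 4) : ℝ) :=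
        lintegral_mono_set h3
    _ ≤ (∫⁻ x in Ico (-Real.pi) 0, ‖x‖ₑ ^ (-(3 / 4) : ℝ)) +
        ((∫⁻ x in ({0} : Set ℝ), ‖x‖ₑ ^ (-(3 / 4) : ℝ)) + ∫⁻ x in Ioc 0 Real.pi, ‖x‖ₑ ^ (-(3 / 4) : ℝ)) :=
        (lintegral_union_le _ _ _).trans (add_le_add le_rfl (lintegral_union_le _ _ _))
    _ < ⊤ := by
        rw [Measure.restrict_eq_zero.2 (measure_singleton _), lintegral_zero_measure, zero_add]
        exact ENNReal.add_lt_top.2 ⟨h2, h1⟩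

theorem lintegral_sub_rpow_le {τ : ℝ} (hτ : |τ| ≤ Real.pi / 2) :
    ∫⁻ θ in Icc (-(Real.pi / 2)) (Real.pi / 2), ‖θ - τ‖ₑ ^ (-(3 / 4) : ℝ) ≤
      ∫⁻ x in Icc (-Real.pi) Real.pi, ‖x‖ₑ ^ (-(3 / 4) : ℝ) := by
  have h := abs_le.1 hτ
  have mp := (measurePreserving_sub_right (volume : Measure ℝ) τ).restrict_preimage
      (measurableSet_Icc (a := -Real.pi) (b := Real.pi))
  rw [← mp.lintegral_comp (by fun_prop)]
  apply lintegral_mono_set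
  intro x hx
  simp only [mem_preimage, mem_Icc] at hx ⊢
  constructor <;> linarith

/-- The density of the arcsine law has inverse square root singularities, so exponents below 1/2 are
integrable uniformly in `t`. With `c = sin θ` the Hölder bound doubles 3/8 to 3/4, which is still
below 1. -/
theorem exists_lintegral_rpow_three_eighths_le :
    ∃ C : ℝ≥0∞, C ≠ ⊤ ∧ ∀ t : ℝ, ∫⁻ c, ‖c - t‖ₑ ^ (-(3 / 8) : ℝ) ∂arcsineLaw ≤ C := by
  set C₀ := ∫⁻ x in Icc (-Real.pi) Real.pi, ‖x‖ₑ ^ (-(3 / 4) : ℝ) with hC₀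
  set K : ℝ≥0∞ := ENNReal.ofReal (Real.pi ^ 2 / 2)
  have hK0 : K ≠ 0 := by simp only [K, ne_eq, ENNReal.ofReal_eq_zero, not_le]; positivity
  have hK : K ≠ ⊤ := ENNReal.ofReal_ne_top
  refine ⟨(ENNReal.ofReal Real.pi)⁻¹ * (K ^ (3 / 8 : ℝ) * C₀), ?_, fun t => ?_⟩
  · refine ENNReal.mul_ne_top (by simp [Real.pi_pos]) (ENNReal.mul_ne_top ?_ ?_)
    · exact ENNReal.rpow_ne_top_of_nonneg (by norm_num) hK
    · exact lintegral_enorm_rpow_lt_top.ne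
  rw [lintegral_arcsineLaw (by fun_prop)]
  gcongr
  calc ∫⁻ θ in Icc (-(Real.pi / 2)) (Real.pi / 2), ‖Real.sin θ - t‖ₑ ^ (-(3 / 8) : ℝ)
      ≤ ∫⁻ θ in Icc (-(Real.pi / 2)) (Real.pi / 2),
          K ^ (3 / 8 : ℝ) * ‖θ - Real.arcsin t‖ₑ ^ (-(3 / 4) : ℝ) := by
        refine setLIntegral_mono' measurableSet_Icc fun θ hθ => ?_
        have h1 := sq_sub_arcsin_le (abs_le.2 hθ) t
        have h2 : ‖θ - Real.arcsin t‖ₑ ^ (2 : ℝ) ≤ K * ‖Real.sin θ - t‖ₑ := by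
          rw [Real.enorm_eq_ofReal_abs, Real.enorm_eq_ofReal_abs, ENNReal.rpow_two,
            ← ENNReal.ofReal_pow (abs_nonneg _), ← ENNReal.ofReal_mul (by positivity)]
          exact ENNReal.ofReal_le_ofReal h1
        refine (rpow_neg_le_of_le_mul (by norm_num) hK0 hK h2).trans (le_of_eq ?_)
        rw [← ENNReal.rpow_mul]; norm_num
    _ = K ^ (3 / 8 : ℝ) * ∫⁻ θ in Icc (-(Real.pi / 2)) (Real.pi / 2),
          ‖θ - Real.arcsin t‖ₑ ^ (-(3 / 4) : ℝ) := lintegral_const_mul _ (by fun_prop)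
    _ ≤ _ := by gcongr; exact lintegral_sub_rpow_le (abs_arcsin_le t)

theorem min_sqrt_rpow_le (t p : ℝ) :
    ‖min √|t - 1| √|t + 1|‖ₑ ^ (-(2 * p)) ≤ ‖t - 1‖ₑ ^ (-p) + ‖t + 1‖ₑ ^ (-p) := by
  have key : ∀ x : ℝ, ‖√|x|‖ₑ ^ (-(2 * p)) = ‖x‖ₑ ^ (-p) := by
    intro x
    have : ‖x‖ₑ = ‖√|x|‖ₑ ^ (2 : ℝ) := by
      rw [Real.enorm_of_nonneg (Real.sqrt_nonneg _), ENNReal.rpow_two,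
        ← ENNReal.ofReal_pow (Real.sqrt_nonneg _), Real.sq_sqrt (abs_nonneg _),
        Real.enorm_eq_ofReal_abs]
    rw [this, ← ENNReal.rpow_mul]; ring_nf
  rcases min_choice √|t - 1| √|t + 1| with h | h <;> rw [h, key]
  · exact le_self_add
  · exact le_add_self

/-- For an exponent above 1/2 no bound is uniform near `t = ±1`. The loss is a kernel of exponent
3/8 in `t`, mild enough to be integrated against a second arcsine variable. -/
theorem exists_lintegral_rpow_three_quarters_le :
    ∃ C : ℝ≥0∞, C ≠ ⊤ ∧ ∀ t : ℝ, ∫⁻ c, ‖c - t‖ₑ ^ (-(3 / 4) : ℝ) ∂arcsineLaw ≤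
      C * (‖t - 1‖ₑ ^ (-(3 / 8) : ℝ) + ‖t + 1‖ₑ ^ (-(3 / 8) : ℝ)) := by
  set C₀ := ∫⁻ x in Icc (-Real.pi) Real.pi, ‖x‖ₑ ^ (-(3 / 4) : ℝ) with hC₀
  set K : ℝ≥0∞ := ENNReal.ofReal (Real.pi ^ 2 / 2)
  have hK0 : K ≠ 0 := by simp only [K, ne_eq, ENNReal.ofReal_eq_zero, not_le]; positivity
  have hK : K ≠ ⊤ := ENNReal.ofReal_ne_top
  refine ⟨(ENNReal.ofReal Real.pi)⁻¹ * (K ^ (3 / 4 : ℝ) * C₀), ?_, fun t => ?_⟩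
  · refine ENNReal.mul_ne_top (by simp [Real.pi_pos]) (ENNReal.mul_ne_top ?_ ?_)
    · exact ENNReal.rpow_ne_top_of_nonneg (by norm_num) hK
    · exact lintegral_enorm_rpow_lt_top.ne
  set m := min √|t - 1| √|t + 1| with hm
  have hm0 : 0 ≤ m := le_min (Real.sqrt_nonneg _) (Real.sqrt_nonneg _)
  have hmle : ‖m‖ₑ ^ (-(3 / 4) : ℝ) ≤ ‖t - 1‖ₑ ^ (-(3 / 8) : ℝ) + ‖t + 1‖ₑ ^ (-(3 / 8) : ℝ) := by
    have := min_sqrt_rpow_le t (3 / 8)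
    norm_num at this ⊢
    exact this
  rw [lintegral_arcsineLaw (by fun_prop), mul_assoc]
  gcongr
  calc ∫⁻ θ in Icc (-(Real.pi / 2)) (Real.pi / 2), ‖Real.sin θ - t‖ₑ ^ (-(3 / 4) : ℝ)
      ≤ ∫⁻ θ in Icc (-(Real.pi / 2)) (Real.pi / 2),
          K ^ (3 / 4 : ℝ) * ‖m‖ₑ ^ (-(3 / 4) : ℝ) * ‖θ - Real.arcsin t‖ₑ ^ (-(3 / 4) : ℝ) := by
        refine setLIntegral_mono' measurableSet_Icc fun θ hθ => ?_
        have h1 := min_sqrt_mul_sub_arcsin_le (abs_le.2 hθ) t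
        have h2 : ‖m‖ₑ * ‖θ - Real.arcsin t‖ₑ ≤ K * ‖Real.sin θ - t‖ₑ := by
          rw [Real.enorm_of_nonneg hm0, Real.enorm_eq_ofReal_abs, Real.enorm_eq_ofReal_abs,
            ← ENNReal.ofReal_mul hm0, ← ENNReal.ofReal_mul (by positivity)]
          exact ENNReal.ofReal_le_ofReal h1
        refine (rpow_neg_le_of_le_mul (by norm_num) hK0 hK h2).trans (le_of_eq ?_)
        rw [ENNReal.mul_rpow_of_ne_top (by simp) (by simp), mul_assoc]
    _ = K ^ (3 / 4 : ℝ) * ‖m‖ₑ ^ (-(3 / 4) : ℝ) *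
          ∫⁻ θ in Icc (-(Real.pi / 2)) (Real.pi / 2),
          ‖θ - Real.arcsin t‖ₑ ^ (-(3 / 4) : ℝ) := lintegral_const_mul _ (by fun_prop)
    _ ≤ K ^ (3 / 4 : ℝ) * (‖t - 1‖ₑ ^ (-(3 / 8) : ℝ) + ‖t + 1‖ₑ ^ (-(3 / 8) : ℝ)) * C₀ := by
        gcongr; exact lintegral_sub_rpow_le (abs_arcsin_le t)
    _ = _ := by ring

/-- The derivative of the arcsine. -/
def arcsinSlope (x : ℝ) : ℝ := 1 / √(1 - x ^ 2)

theorem arcsinSlope_nonneg (x : ℝ) : 0 ≤ arcsinSlope x := by unfold arcsinSlope; positivity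

theorem measurable_arcsinSlope : Measurable arcsinSlope := by unfold arcsinSlope; fun_prop

/-- With `c = sin θ` the integrand is `sin² θ / cos θ`, comparable near `π/2` to the nonintegrable
`1 / (π/2 - θ)`. This divergence is the source of the infinite expansion of `chartGrad` at the
signed unit vectors. -/
theorem lintegral_arcsinSlope_mul_sq :
    ∫⁻ c, ENNReal.ofReal (arcsinSlope c * c ^ 2) ∂arcsineLaw = ⊤ := by
  have hpi := Real.pi_pos
  have hmeas : Measurable fun c => ENNReal.ofReal (arcsinSlope c * c ^ 2) :=
    (measurable_arcsinSlope.mul (by fun_prop)).ennreal_ofReal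
  rw [lintegral_arcsineLaw hmeas]
  have h0 : ∫⁻ θ in Ioc (Real.pi / 4) (Real.pi / 2), ‖(θ - Real.pi / 2)⁻¹‖ₑ = ⊤ := by
    by_contra hne
    have : IntervalIntegrable (fun θ => (θ - Real.pi / 2)⁻¹) volume (Real.pi / 4) (Real.pi / 2) := by
      rw [intervalIntegrable_iff_integrableOn_Ioc_of_le (by linarith)]
      exact ⟨(by fun_prop : Measurable fun θ : ℝ => (θ - Real.pi / 2)⁻¹).aestronglyMeasurable,
        lt_top_iff_ne_top.2 hne⟩
    rw [intervalIntegrable_sub_inv_iff] at this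
    rcases this with h | h
    · linarith
    · exact h right_mem_uIcc
  have h1 : ∫⁻ θ in Ioc (Real.pi / 4) (Real.pi / 2), ‖(θ - Real.pi / 2)⁻¹‖ₑ ≤
      2 * ∫⁻ θ in Icc (-(Real.pi / 2)) (Real.pi / 2),
        ENNReal.ofReal (arcsinSlope (Real.sin θ) * Real.sin θ ^ 2) := by
    rw [← lintegral_const_mul _ (show Measurable fun θ =>
      ENNReal.ofReal (arcsinSlope (Real.sin θ) * Real.sin θ ^ 2) from
      hmeas.comp Real.measurable_sin)]
    refine (setLIntegral_mono' measurableSet_Ioc fun θ hθ => ?_).trans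
      (lintegral_mono_set (fun x hx => ⟨by linarith [hx.1], hx.2⟩))
    rw [show (2 : ℝ≥0∞) = ENNReal.ofReal 2 by norm_num, ← ENNReal.ofReal_mul (by norm_num),
      Real.enorm_eq_ofReal_abs]
    apply ENNReal.ofReal_le_ofReal
    rcases eq_or_lt_of_le hθ.2 with h | h
    · rw [h]; simp only [sub_self, inv_zero, abs_zero]
      have := arcsinSlope_nonneg (Real.sin (Real.pi / 2)); positivity
    have hcos : 0 < Real.cos θ := Real.cos_pos_of_mem_Ioo ⟨by linarith [hθ.1], h⟩
    have e : arcsinSlope (Real.sin θ) = 1 / Real.cos θ := by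
      rw [arcsinSlope, ← Real.cos_sq', Real.sqrt_sq hcos.le]
    have hc : Real.cos θ ≤ Real.pi / 2 - θ := by
      rw [← Real.sin_pi_div_two_sub]; exact Real.sin_le (by linarith)
    have hs : 1 / 2 ≤ Real.sin θ ^ 2 := by
      have : Real.sin (Real.pi / 4) ≤ Real.sin θ :=
        Real.sin_le_sin_of_le_of_le_pi_div_two (by linarith) hθ.2 hθ.1.le
      rw [Real.sin_pi_div_four] at this
      have h2 := Real.sq_sqrt (by norm_num : (0 : ℝ) ≤ 2)
      nlinarith [Real.sqrt_nonneg 2]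
    rw [e, abs_inv, abs_of_neg (by linarith), neg_sub, inv_eq_one_div,
      show 2 * (1 / Real.cos θ * Real.sin θ ^ 2) = (2 * Real.sin θ ^ 2) / Real.cos θ by ring]
    gcongr
    linarith
  rw [h0, top_le_iff] at h1
  have h2 : ∫⁻ θ in Icc (-(Real.pi / 2)) (Real.pi / 2),
      ENNReal.ofReal (arcsinSlope (Real.sin θ) * Real.sin θ ^ 2) = ⊤ := by
    by_contra hne
    exact ENNReal.mul_ne_top (by norm_num) hne h1
  rw [h2]
  exact ENNReal.mul_top (by simp)

/-! ### Product laws -/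

/-- The law of `(cos φ_i)_i` for independent uniform phases. -/
def arcsinePi (n : ℕ) : Measure (Fin n → ℝ) := Measure.pi fun _ => arcsineLaw

instance (n : ℕ) : IsProbabilityMeasure (arcsinePi n) := by unfold arcsinePi; infer_instance

theorem ae_arcsinePi_abs_le (n : ℕ) : ∀ᵐ c ∂arcsinePi n, ∀ i, |c i| ≤ 1 := by
  rw [ae_all_iff]
  exact fun i => (Measure.quasiMeasurePreserving_eval (fun _ => arcsineLaw) i).ae
    ae_arcsineLaw_abs_le

/-- Resampling one coordinate independently does not change the product law. It gives Fubini in a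
chosen coordinate while the index type stays the same. -/
theorem measurePreserving_update {n : ℕ} (j : Fin n) :
    MeasurePreserving (fun q : (Fin n → ℝ) × ℝ => Function.update q.1 j q.2)
      ((arcsinePi n).prod arcsineLaw) (arcsinePi n) := by
  have hm : Measurable fun q : (Fin n → ℝ) × ℝ => Function.update q.1 j q.2 := by
    rw [measurable_pi_iff]
    intro i
    by_cases h : i = j
    · subst h; simpa using measurable_snd
    · simp only [Function.update_of_ne h]; fun_prop
  refine ⟨hm, (Measure.pi_eq fun s hs => ?_).symm⟩
  rw [Measure.map_apply hm (MeasurableSet.univ_pi hs)]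
  have : (fun q : (Fin n → ℝ) × ℝ => Function.update q.1 j q.2) ⁻¹' univ.pi s =
      (univ.pi (Function.update s j univ)) ×ˢ (s j) := by
    ext ⟨c, x⟩
    simp only [mem_preimage, mem_univ_pi, mem_prod]
    constructor
    · intro h
      refine ⟨fun i => ?_, by simpa using h j⟩
      by_cases hi : i = j
      · subst hi; simp
      · simpa [Function.update_of_ne hi] using h i
    · rintro ⟨h1, h2⟩ i
      by_cases hi : i = j
      · subst hi; simpa using h2
      · simpa [Function.update_of_ne hi] using h1 i
  rw [this, Measure.prod_prod, arcsinePi, Measure.pi_pi, ← Finset.prod_erase_mul _ _ (Finset.mem_univ j),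
    ← Finset.prod_erase_mul (f := fun i => arcsineLaw (s i)) _ (Finset.mem_univ j)]
  simp only [Function.update_self, measure_univ, mul_one]
  congr 1
  refine Finset.prod_congr rfl fun i hi => ?_
  rw [Function.update_of_ne (Finset.ne_of_mem_erase hi)]

theorem lintegral_resample {n : ℕ} (j : Fin n) {F : (Fin n → ℝ) → ℝ≥0∞} (hF : Measurable F) :
    ∫⁻ c, F c ∂arcsinePi n =
      ∫⁻ c, ∫⁻ x, F (Function.update c j x) ∂arcsineLaw ∂arcsinePi n := by
  rw [← (measurePreserving_update j).lintegral_comp hF, lintegral_prod]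
  exact (hF.comp (measurePreserving_update j).measurable).aemeasurable

theorem dotProduct_update {n : ℕ} (z c : Fin n → ℝ) (j : Fin n) (x : ℝ) :
    z ⬝ᵥ Function.update c j x = z j * x + (z ⬝ᵥ Function.update c j 0) := by
  simp only [dotProduct]
  rw [← Finset.add_sum_erase _ _ (Finset.mem_univ j),
    ← Finset.add_sum_erase (f := fun i => z i * Function.update c j 0 i) _ (Finset.mem_univ j)]
  simp only [Function.update_self, mul_zero, zero_add]
  congr 1
  refine Finset.sum_congr rfl fun i hi => ?_
  rw [Function.update_of_ne (Finset.ne_of_mem_erase hi), Function.update_of_ne (Finset.ne_of_mem_erase hi)]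

theorem continuous_dotProduct_left {n : ℕ} (z : Fin n → ℝ) : Continuous fun c => z ⬝ᵥ c := by
  unfold dotProduct; fun_prop

theorem continuous_dotProduct_right {n : ℕ} (c : Fin n → ℝ) : Continuous fun z => z ⬝ᵥ c := by
  unfold dotProduct; fun_prop

/-- Along a coordinate with `z j ≠ 0` the hyperplane has at most one point, and the arcsine law has
no atoms. -/
theorem ae_dotProduct_ne {n : ℕ} {z : Fin n → ℝ} (hz : z ≠ 0) (t : ℝ) :
    ∀ᵐ c ∂arcsinePi n, z ⬝ᵥ c ≠ t := by
  obtain ⟨j, hj⟩ := Function.ne_iff.1 hz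
  have hs : MeasurableSet {c : Fin n → ℝ | z ⬝ᵥ c = t} :=
    (measurableSet_eq_fun (continuous_dotProduct_left z).measurable measurable_const)
  have mp := measurePreserving_update (n := n) j
  rw [ae_iff]
  simp only [ne_eq, not_not]
  rw [← mp.measure_preimage hs.nullMeasurableSet, Measure.measure_prod_null (mp.measurable hs)]
  refine Eventually.of_forall fun c => ?_
  have : (Prod.mk c ⁻¹' ((fun q : (Fin n → ℝ) × ℝ => Function.update q.1 j q.2) ⁻¹'
      {c : Fin n → ℝ | z ⬝ᵥ c = t})) ⊆ {(t - z ⬝ᵥ Function.update c j 0) / z j} := by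
    intro x hx
    simp only [mem_preimage, mem_ofPred_eq] at hx
    rw [dotProduct_update] at hx
    have hj' : z j ≠ 0 := hj
    rw [mem_singleton_iff, eq_div_iff hj']; linarith
  exact measure_mono_null this (measure_singleton _)

theorem meanAbs_eq_integral {n : ℕ} (z : Fin n → ℝ) :
    meanAbs z = ∫ c, |z ⬝ᵥ c| ∂arcsinePi n := by
  have hpi := Real.pi_pos
  have hsf : SigmaFinite ((volume.restrict (Icc (0 : ℝ) (2 * Real.pi))).map Real.cos) := by
    infer_instance
  have h1 : (volume.restrict (Set.pi univ fun _ : Fin n => Icc (0 : ℝ) (2 * Real.pi))).map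
      (fun φ i => Real.cos (φ i)) = ENNReal.ofReal (2 * Real.pi) ^ n • arcsinePi n := by
    rw [volume_pi, Measure.restrict_pi_pi,
      Measure.pi_map_pi (μ := fun _ : Fin n => volume.restrict (Icc (0 : ℝ) (2 * Real.pi)))
        (f := fun _ => Real.cos) (hμ := fun _ => hsf) (fun _ => Real.measurable_cos.aemeasurable)]
    refine Measure.pi_eq fun s hs => ?_
    rw [Measure.smul_apply, arcsinePi, Measure.pi_pi]
    simp [map_cos_restrict, Finset.prod_mul_distrib]
  have h2 : ∫ φ in Set.pi univ (fun _ : Fin n => Icc (0 : ℝ) (2 * Real.pi)),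
      |∑ i, z i * Real.cos (φ i)| =
      ∫ c, |z ⬝ᵥ c| ∂(volume.restrict (Set.pi univ fun _ : Fin n =>
        Icc (0 : ℝ) (2 * Real.pi))).map (fun φ i => Real.cos (φ i)) := by
    rw [integral_map]
    · rfl
    · exact (by fun_prop : Measurable fun (φ : Fin n → ℝ) i => Real.cos (φ i)).aemeasurable
    · exact (continuous_dotProduct_left z).abs.aestronglyMeasurable
  rw [meanAbs, h2, h1, integral_smul_measure, ENNReal.toReal_pow,
    ENNReal.toReal_ofReal (by positivity), smul_eq_mul, ← mul_assoc, inv_mul_cancel₀ (by positivity),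
    one_mul]

/-! ### The norm `meanAbs` -/

theorem integrable_of_ae_abs_le {n : ℕ} {F : (Fin n → ℝ) → ℝ} (hF : Measurable F) (C : ℝ)
    (h : ∀ c : Fin n → ℝ, (∀ i, |c i| ≤ 1) → |F c| ≤ C) : Integrable F (arcsinePi n) := by
  refine Integrable.of_bound hF.aestronglyMeasurable C ?_
  filter_upwards [ae_arcsinePi_abs_le n] with c hc
  rw [Real.norm_eq_abs]; exact h c hc

theorem abs_dotProduct_le {n : ℕ} (z : Fin n → ℝ) {c : Fin n → ℝ} (hc : ∀ i, |c i| ≤ 1) :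
    |z ⬝ᵥ c| ≤ ∑ i, |z i| := by
  refine (Finset.abs_sum_le_sum_abs _ _).trans (Finset.sum_le_sum fun i _ => ?_)
  rw [abs_mul]
  exact mul_le_of_le_one_right (abs_nonneg _) (hc i)

theorem integrable_abs_dotProduct {n : ℕ} (z : Fin n → ℝ) :
    Integrable (fun c => |z ⬝ᵥ c|) (arcsinePi n) :=
  integrable_of_ae_abs_le (continuous_dotProduct_left z).abs.measurable (∑ i, |z i|) fun c hc => by
    rw [abs_abs]; exact abs_dotProduct_le z hc

theorem meanAbs_smul {n : ℕ} (t : ℝ) (z : Fin n → ℝ) : meanAbs (t • z) = |t| * meanAbs z := by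
  rw [meanAbs_eq_integral, meanAbs_eq_integral, ← integral_const_mul]
  congr 1; ext c
  rw [smul_dotProduct, smul_eq_mul, abs_mul]

theorem meanAbs_zero {n : ℕ} : meanAbs (0 : Fin n → ℝ) = 0 := by
  simpa using meanAbs_smul 0 (0 : Fin n → ℝ)

theorem meanAbs_add_le {n : ℕ} (z w : Fin n → ℝ) : meanAbs (z + w) ≤ meanAbs z + meanAbs w := by
  rw [meanAbs_eq_integral, meanAbs_eq_integral, meanAbs_eq_integral,
    ← integral_add (integrable_abs_dotProduct z) (integrable_abs_dotProduct w)]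
  refine integral_mono (integrable_abs_dotProduct _)
    ((integrable_abs_dotProduct z).add (integrable_abs_dotProduct w)) fun c => ?_
  simp only [add_dotProduct]
  exact abs_add_le _ _

theorem meanAbs_nonneg {n : ℕ} (z : Fin n → ℝ) : 0 ≤ meanAbs z := by
  rw [meanAbs_eq_integral]; exact integral_nonneg fun _ => abs_nonneg _

theorem meanAbs_pos {n : ℕ} {z : Fin n → ℝ} (hz : z ≠ 0) : 0 < meanAbs z := by
  refine (meanAbs_nonneg z).lt_of_ne' fun h => ?_
  rw [meanAbs_eq_integral, integral_eq_zero_iff_of_nonneg (fun _ => abs_nonneg _)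
    (integrable_abs_dotProduct z)] at h
  have : ∀ᵐ c ∂arcsinePi n, False := by
    filter_upwards [h, ae_dotProduct_ne hz 0] with c h1 h2
    exact h2 (by simpa using h1)
  exact (NeZero.ne (arcsinePi n)) (by simpa using this)

theorem measurePreserving_signs {n : ℕ} (σ : Fin n → ℝ) (hσ : ∀ i, |σ i| = 1) :
    MeasurePreserving (fun c i => σ i * c i) (arcsinePi n) (arcsinePi n) := by
  refine measurePreserving_pi (fun _ => arcsineLaw) (fun _ => arcsineLaw) fun i => ?_
  rcases eq_or_eq_neg_of_abs_eq (hσ i) with h | h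
  · rw [show HMul.hMul (σ i) = (id : ℝ → ℝ) from funext fun x => by simp [h]]
    exact MeasurePreserving.id arcsineLaw
  · rw [show HMul.hMul (σ i) = fun x : ℝ => -x from funext fun x => by simp [h]]
    exact ⟨measurable_neg, map_neg_arcsineLaw⟩

theorem meanAbs_signs {n : ℕ} (σ : Fin n → ℝ) (hσ : ∀ i, |σ i| = 1) (z : Fin n → ℝ) :
    meanAbs (fun i => σ i * z i) = meanAbs z := by
  have mp := measurePreserving_signs σ hσ
  rw [meanAbs_eq_integral, meanAbs_eq_integral]
  conv_rhs => rw [← mp.map_eq]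
  rw [integral_map mp.measurable.aemeasurable
    (continuous_dotProduct_left z).abs.aestronglyMeasurable]
  congr 1; ext c
  simp only [dotProduct]
  congr 2; ext i; ring

theorem meanAbs_abs {n : ℕ} (z : Fin n → ℝ) : meanAbs (fun i => |z i|) = meanAbs z := by
  rw [← meanAbs_signs (fun i => if 0 ≤ z i then 1 else -1) (fun i => by split_ifs <;> simp) z]
  congr 1; ext i
  split_ifs with h
  · rw [abs_of_nonneg h, one_mul]
  · rw [abs_of_neg (not_le.1 h), neg_one_mul]

/-- The gradient of `meanAbs`. -/
def meanSign {n : ℕ} (z : Fin n → ℝ) (i : Fin n) : ℝ :=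
  ∫ c, Real.sign (z ⬝ᵥ c) * c i ∂arcsinePi n

theorem measurable_sign_dotProduct {n : ℕ} (z : Fin n → ℝ) :
    Measurable fun c : Fin n → ℝ => Real.sign (z ⬝ᵥ c) :=
  measurable_sign.comp (continuous_dotProduct_left z).measurable

theorem abs_sign_mul_le (a : ℝ) {x : ℝ} (hx : |x| ≤ 1) : |Real.sign a * x| ≤ 1 := by
  rw [abs_mul]; exact mul_le_one₀ (abs_sign_le a) (abs_nonneg _) hx

theorem integrable_sign_mul {n : ℕ} (z : Fin n → ℝ) (i : Fin n) :
    Integrable (fun c => Real.sign (z ⬝ᵥ c) * c i) (arcsinePi n) :=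
  integrable_of_ae_abs_le ((measurable_sign_dotProduct z).mul (measurable_pi_apply i)) 1
    fun _ hc => abs_sign_mul_le _ (hc i)

theorem meanSign_dotProduct {n : ℕ} (z w : Fin n → ℝ) :
    meanSign z ⬝ᵥ w = ∫ c, Real.sign (z ⬝ᵥ c) * (w ⬝ᵥ c) ∂arcsinePi n := by
  have : ∀ c : Fin n → ℝ, Real.sign (z ⬝ᵥ c) * (w ⬝ᵥ c) =
      ∑ i, w i * (Real.sign (z ⬝ᵥ c) * c i) := fun c => by
    simp only [dotProduct, Finset.mul_sum]
    refine Finset.sum_congr rfl fun i _ => by ring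
  simp_rw [this]
  rw [integral_finsetSum _ fun i _ => (integrable_sign_mul z i).const_mul _]
  simp_rw [integral_const_mul]
  simp only [dotProduct, meanSign]
  exact Finset.sum_congr rfl fun i _ => mul_comm _ _

theorem sign_mul_self_eq_abs (a : ℝ) : Real.sign a * a = |a| := by
  rcases lt_trichotomy a 0 with h | h | h
  · rw [Real.sign_of_neg h, abs_of_neg h]; ring
  · simp [h]
  · rw [Real.sign_of_pos h, abs_of_pos h]; ring

theorem meanSign_dotProduct_self {n : ℕ} (z : Fin n → ℝ) : meanSign z ⬝ᵥ z = meanAbs z := by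
  rw [meanSign_dotProduct, meanAbs_eq_integral]
  simp_rw [sign_mul_self_eq_abs]

theorem meanSign_dotProduct_le {n : ℕ} (z w : Fin n → ℝ) : meanSign z ⬝ᵥ w ≤ meanAbs w := by
  rw [meanSign_dotProduct, meanAbs_eq_integral]
  refine integral_mono ?_ (integrable_abs_dotProduct w) fun c => ?_
  · refine integrable_of_ae_abs_le ((measurable_sign_dotProduct z).mul
      (continuous_dotProduct_left w).measurable) (∑ i, |w i|) fun c hc => ?_
    rw [abs_mul]
    exact (mul_le_of_le_one_left (abs_nonneg _) (abs_sign_le _)).trans (abs_dotProduct_le w hc)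
  · refine (le_abs_self _).trans ?_
    rw [abs_mul]
    exact mul_le_of_le_one_left (abs_nonneg _) (abs_sign_le _)

theorem continuousAt_sign {x : ℝ} (hx : x ≠ 0) : ContinuousAt Real.sign x := by
  rcases lt_or_gt_of_ne hx with h | h
  · refine (continuousAt_const (y := (-1 : ℝ))).congr ?_
    filter_upwards [Iio_mem_nhds h] with y hy
    rw [Real.sign_of_neg hy]
  · refine (continuousAt_const (y := (1 : ℝ))).congr ?_
    filter_upwards [Ioi_mem_nhds h] with y hy
    rw [Real.sign_of_pos hy]

/-- Dominated convergence: the sign jumps only on the hyperplane `z · c = 0`, which is null. -/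
theorem continuousAt_meanSign {n : ℕ} {z : Fin n → ℝ} (hz : z ≠ 0) :
    ContinuousAt meanSign z := by
  rw [continuousAt_pi]
  intro i
  refine tendsto_integral_filter_of_dominated_convergence (fun _ => 1) ?_ ?_
    (integrable_const _) ?_
  · exact Eventually.of_forall fun z => (integrable_sign_mul z i).1
  · refine Eventually.of_forall fun z => ?_
    filter_upwards [ae_arcsinePi_abs_le n] with c hc
    exact abs_sign_mul_le _ (hc i)
  · filter_upwards [ae_dotProduct_ne hz 0] with c hc
    refine Tendsto.mul ?_ tendsto_const_nhds
    exact (continuousAt_sign hc).tendsto.comp (continuous_dotProduct_right c).continuousAt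

/-- The linear functional `w ↦ g ⬝ᵥ w`. -/
def dotCLM {n : ℕ} (g : Fin n → ℝ) : (Fin n → ℝ) →L[ℝ] ℝ :=
  ∑ i, g i • ContinuousLinearMap.proj i

theorem dotCLM_apply {n : ℕ} (g w : Fin n → ℝ) : dotCLM g w = g ⬝ᵥ w := by
  simp [dotCLM, dotProduct]

theorem continuous_dotCLM {n : ℕ} : Continuous (dotCLM (n := n)) := by
  unfold dotCLM; fun_prop

/-- A function with a continuous selection of subgradients is strictly differentiable. -/
theorem hasStrictFDerivAt_of_subgradient {E : Type*} [NormedAddCommGroup E] [NormedSpace ℝ E]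
    {h : E → ℝ} {γ : E → E →L[ℝ] ℝ} {z₀ : E}
    (hsub : ∀ᶠ z in 𝓝 z₀, ∀ z', γ z (z' - z) ≤ h z' - h z) (hc : ContinuousAt γ z₀) :
    HasStrictFDerivAt h (γ z₀) z₀ := by
  rw [hasStrictFDerivAt_iff_isLittleO, Asymptotics.isLittleO_iff]
  intro ε hε
  have h1 : ∀ᶠ z in 𝓝 z₀, ‖γ z - γ z₀‖ < ε := by
    have := Metric.tendsto_nhds.1 hc ε hε
    simpa [dist_eq_norm] using this
  have h2 := h1.and hsub
  have h3 : ∀ᶠ p : E × E in 𝓝 (z₀, z₀), (‖γ p.1 - γ z₀‖ < ε ∧ ∀ z', γ p.1 (z' - p.1) ≤ h z' - h p.1) ∧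
      (‖γ p.2 - γ z₀‖ < ε ∧ ∀ z', γ p.2 (z' - p.2) ≤ h z' - h p.2) := by
    rw [nhds_prod_eq]
    exact h2.prod_mk h2
  filter_upwards [h3] with p hp
  obtain ⟨⟨a1, b1⟩, a2, b2⟩ := hp
  -- The subgradient inequalities at both points sandwich the increment of `h` between two linear
  -- functionals that are close to `γ z₀`.
  have c1 := b1 p.2
  have c2 := b2 p.1
  have d1 : |(γ p.1 - γ z₀) (p.1 - p.2)| ≤ ε * ‖p.1 - p.2‖ :=
    ((γ p.1 - γ z₀).le_opNorm _).trans (by gcongr)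
  have d2 : |(γ p.2 - γ z₀) (p.1 - p.2)| ≤ ε * ‖p.1 - p.2‖ :=
    ((γ p.2 - γ z₀).le_opNorm _).trans (by gcongr)
  have e1 : γ p.1 (p.2 - p.1) = - γ p.1 (p.1 - p.2) := by rw [← map_neg, neg_sub]
  rw [_root_.sub_apply] at d1 d2
  rw [Real.norm_eq_abs, abs_le]
  have := abs_le.1 d1
  have := abs_le.1 d2
  constructor <;> linarith

theorem hasStrictFDerivAt_meanAbs {n : ℕ} {z : Fin n → ℝ} (hz : z ≠ 0) :
    HasStrictFDerivAt meanAbs (dotCLM (meanSign z)) z := by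
  refine hasStrictFDerivAt_of_subgradient (γ := fun z => dotCLM (meanSign z))
    (Eventually.of_forall fun z z' => ?_)
    (continuous_dotCLM.continuousAt.comp (continuousAt_meanSign hz))
  rw [dotCLM_apply, dotProduct_sub, meanSign_dotProduct_self]
  linarith [meanSign_dotProduct_le z z']

theorem continuousAt_meanAbs {n : ℕ} {z : Fin n → ℝ} (hz : z ≠ 0) : ContinuousAt meanAbs z :=
  (hasStrictFDerivAt_meanAbs hz).continuousAt

/-! ### Support of the product law and strict convexity -/

theorem arcsineLaw_pos_of_isOpen {s : Set ℝ} (hs : IsOpen s) {t : ℝ} (ht : t ∈ s)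
    (ht1 : |t| < 1) : arcsineLaw s ≠ 0 := by
  have h := abs_lt.1 ht1
  rw [arcsineLaw_apply hs.measurableSet]
  refine mul_ne_zero (by simp) ?_
  have ho : IsOpen (Real.sin ⁻¹' s ∩ Ioo (-(Real.pi / 2)) (Real.pi / 2)) :=
    (hs.preimage Real.continuous_sin).inter isOpen_Ioo
  have hne : (Real.sin ⁻¹' s ∩ Ioo (-(Real.pi / 2)) (Real.pi / 2)).Nonempty := by
    refine ⟨Real.arcsin t, ?_, Real.neg_pi_div_two_lt_arcsin.2 h.1,
      Real.arcsin_lt_pi_div_two.2 h.2⟩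
    rw [mem_preimage, Real.sin_arcsin h.1.le h.2.le]; exact ht
  have := ho.measure_pos volume hne
  exact (this.trans_le (measure_mono (inter_subset_inter_right _ Ioo_subset_Icc_self))).ne'

theorem arcsinePi_pos_of_isOpen {n : ℕ} {s : Set (Fin n → ℝ)} (hs : IsOpen s) {c : Fin n → ℝ}
    (hc : c ∈ s) (hc1 : ∀ i, |c i| < 1) : arcsinePi n s ≠ 0 := by
  obtain ⟨u, hu, hus⟩ := isOpen_pi_iff'.1 hs c hc
  intro h
  have h1 : arcsinePi n (univ.pi u) = 0 := measure_mono_null hus h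
  rw [arcsinePi, Measure.pi_pi, Finset.prod_eq_zero_iff] at h1
  obtain ⟨i, -, hi⟩ := h1
  exact arcsineLaw_pos_of_isOpen (hu i).1 (hu i).2 (hc1 i) hi

theorem eq_of_forall_mul_dotProduct_nonneg {n : ℕ} {p q : Fin n → ℝ} (hp : p ≠ 0) (hq : q ≠ 0)
    (hpq : meanAbs p = meanAbs q) (h : ∀ c, 0 ≤ (p ⬝ᵥ c) * (q ⬝ᵥ c)) : p = q := by
  have pos : ∀ v : Fin n → ℝ, v ≠ 0 → 0 < v ⬝ᵥ v := fun v hv =>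
    lt_of_le_of_ne (Finset.sum_nonneg fun i _ => mul_self_nonneg (v i))
      (fun h => hv (dotProduct_self_eq_zero.1 h.symm))
  set a := √(p ⬝ᵥ p)
  set b := √(q ⬝ᵥ q)
  have ha : 0 < a := Real.sqrt_pos.2 (pos p hp)
  have hb : 0 < b := Real.sqrt_pos.2 (pos q hq)
  have ha2 : p ⬝ᵥ p = a ^ 2 := (Real.sq_sqrt (pos p hp).le).symm
  have hb2 : q ⬝ᵥ q = b ^ 2 := (Real.sq_sqrt (pos q hq).le).symm
  -- At this vector the product of the two forms is `-(ab) (ab - p · q) ^ 2`, so nonnegativity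
  -- forces equality in the Cauchy–Schwarz inequality.
  have h1 := h (b • p - a • q)
  have e1 : p ⬝ᵥ (b • p - a • q) = a * (a * b - p ⬝ᵥ q) := by
    rw [dotProduct_sub, dotProduct_smul, dotProduct_smul, ha2]; simp only [smul_eq_mul]; ring
  have e2 : q ⬝ᵥ (b • p - a • q) = - (b * (a * b - p ⬝ᵥ q)) := by
    rw [dotProduct_sub, dotProduct_smul, dotProduct_smul, hb2, dotProduct_comm q p]
    simp only [smul_eq_mul]; ring
  rw [e1, e2] at h1
  have h2 : a * b - p ⬝ᵥ q = 0 := by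
    by_contra hne
    have h3 : 0 < (a * b) * (a * b - p ⬝ᵥ q) ^ 2 := by positivity
    nlinarith
  have h3 : b • p - a • q = 0 := by
    rw [← dotProduct_self_eq_zero, sub_dotProduct, smul_dotProduct, smul_dotProduct, e1, e2, h2]
    simp
  have h4 : b • p = a • q := sub_eq_zero.1 h3
  have h5 : meanAbs (b • p) = meanAbs (a • q) := by rw [h4]
  rw [meanAbs_smul, meanAbs_smul, hpq, abs_of_pos ha, abs_of_pos hb] at h5
  have h6 : b = a := mul_right_cancel₀ (meanAbs_pos hq).ne' h5
  rw [h6] at h4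
  exact smul_right_injective _ ha.ne' h4

/-- Strict convexity. Equality in the integrated triangle inequality means that the forms `p · c`
and `q · c` almost surely do not have opposite signs; by openness and full support of the law they
never do. -/
theorem eq_of_meanAbs_add_eq {n : ℕ} {p q : Fin n → ℝ} (hp : p ≠ 0) (hq : q ≠ 0)
    (hpq : meanAbs p = meanAbs q) (h : meanAbs p + meanAbs q ≤ meanAbs (p + q)) : p = q := by
  refine eq_of_forall_mul_dotProduct_nonneg hp hq hpq fun c => ?_
  have hint : ∫ c, (|p ⬝ᵥ c| + |q ⬝ᵥ c| - |(p + q) ⬝ᵥ c|) ∂arcsinePi n = 0 := by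
    rw [integral_sub (f := fun c => |p ⬝ᵥ c| + |q ⬝ᵥ c|)
      ((integrable_abs_dotProduct p).add (integrable_abs_dotProduct q))
      (integrable_abs_dotProduct _), integral_add (integrable_abs_dotProduct p)
      (integrable_abs_dotProduct q), ← meanAbs_eq_integral, ← meanAbs_eq_integral,
      ← meanAbs_eq_integral]
    linarith [meanAbs_add_le p q]
  rw [integral_eq_zero_iff_of_nonneg] at hint
  · by_contra hneg
    push Not at hneg
    set s : Set (Fin n → ℝ) := {c | (p ⬝ᵥ c) * (q ⬝ᵥ c) < 0}
    have hs : IsOpen s := isOpen_lt ((continuous_dotProduct_left p).mul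
      (continuous_dotProduct_left q)) continuous_const
    -- The set of opposite signs is stable under positive scaling, so a point of it can be shrunk
    -- into the open cube, which the law charges everywhere.
    set ε : ℝ := (1 + ‖c‖)⁻¹ with hε
    have hε0 : 0 < ε := by positivity
    have hcs : ε • c ∈ s := by
      change (p ⬝ᵥ (ε • c)) * (q ⬝ᵥ (ε • c)) < 0
      rw [dotProduct_smul, dotProduct_smul, smul_eq_mul, smul_eq_mul,
        show ε * (p ⬝ᵥ c) * (ε * (q ⬝ᵥ c)) = ε ^ 2 * ((p ⬝ᵥ c) * (q ⬝ᵥ c)) by ring]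
      exact mul_neg_of_pos_of_neg (by positivity) hneg
    have hc1 : ∀ i, |(ε • c) i| < 1 := fun i => by
      rw [Pi.smul_apply, smul_eq_mul, abs_mul, abs_of_pos hε0, hε, inv_mul_lt_iff₀ (by positivity)]
      have := norm_le_pi_norm c i
      rw [Real.norm_eq_abs] at this
      linarith
    apply arcsinePi_pos_of_isOpen hs hcs hc1
    refine measure_mono_null ?_ (ae_iff.1 hint)
    intro d hd hd'
    have hd1 : (p ⬝ᵥ d) * (q ⬝ᵥ d) < 0 := hd
    simp only [Pi.zero_apply, add_dotProduct] at hd'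
    rcases abs_cases (p ⬝ᵥ d) with ⟨a, _⟩ | ⟨a, _⟩ <;>
    rcases abs_cases (q ⬝ᵥ d) with ⟨b, _⟩ | ⟨b, _⟩ <;>
    rcases abs_cases (p ⬝ᵥ d + q ⬝ᵥ d) with ⟨e, _⟩ | ⟨e, _⟩ <;>
    rw [a, b, e] at hd' <;> nlinarith
  · intro c
    simp only [add_dotProduct, Pi.zero_apply]
    linarith [abs_add_le (p ⬝ᵥ c) (q ⬝ᵥ c)]
  · exact ((integrable_abs_dotProduct p).add (integrable_abs_dotProduct q)).sub
      (integrable_abs_dotProduct _)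

/-! ### The gradient of `meanAbs` in projective charts -/

/-- The gradient of `meanAbs` in the chart where one of the coordinates is normalized to `±1`. -/
def chartGrad {n : ℕ} (ζ : Fin n → ℝ) (j : Fin n) : ℝ :=
  2 / Real.pi * ∫ c, Real.arcsin (ζ ⬝ᵥ c) * c j ∂arcsinePi n

/-- Fubini with the phase of the `i`-th coordinate integrated first, by `integral_sign_mul_add`. -/
theorem meanSign_succAbove {n : ℕ} (i : Fin (n + 1)) {z : Fin (n + 1) → ℝ} (hz : z i ≠ 0)
    (j : Fin n) :
    meanSign z (i.succAbove j) = chartGrad (fun k => z (i.succAbove k) / |z i|) j := by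
  have mp := measurePreserving_piFinSuccAbove (fun _ : Fin (n + 1) => arcsineLaw) i
  have hdot : ∀ c : Fin (n + 1) → ℝ, z ⬝ᵥ c = z i * c i +
      (fun k => z (i.succAbove k)) ⬝ᵥ (fun k => c (i.succAbove k)) := fun c => by
    simp only [dotProduct]; rw [Fin.sum_univ_succAbove _ i]
  set z' : Fin n → ℝ := fun k => z (i.succAbove k)
  set F : ℝ × (Fin n → ℝ) → ℝ := fun q => Real.sign (z i * q.1 + z' ⬝ᵥ q.2) * q.2 j with hFdef
  have hF : Measurable F := by
    refine (measurable_sign.comp ?_).mul (by fun_prop)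
    exact (measurable_const.mul measurable_fst).add
      ((continuous_dotProduct_left z').measurable.comp measurable_snd)
  have h1 : meanSign z (i.succAbove j) =
      ∫ q, F q ∂(arcsineLaw.prod (arcsinePi n)) := by
    have := mp.integral_comp' (G := ℝ) F
    unfold arcsinePi
    rw [← this, meanSign]
    congr 1; ext c
    rw [hdot]
    rfl
  have hFi : Integrable F (arcsineLaw.prod (arcsinePi n)) := by
    refine Integrable.of_bound hF.aestronglyMeasurable 1 ?_
    have := (Measure.quasiMeasurePreserving_snd (μ := arcsineLaw) (ν := arcsinePi n)).ae
      (ae_arcsinePi_abs_le n)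
    filter_upwards [this] with q hq
    exact abs_sign_mul_le _ (hq j)
  rw [h1, integral_prod_symm _ hFi, chartGrad, ← integral_const_mul]
  congr 1; ext c
  simp only [hFdef]
  rw [integral_mul_const, integral_sign_mul_add hz, ← mul_assoc]
  congr 3
  simp only [dotProduct, Finset.sum_div]
  refine Finset.sum_congr rfl fun k _ => ?_
  ring

/-! ### The dual norm of `meanAbs` -/

/-- The polar body of `meanAbs`. -/
def polarBody (n : ℕ) : Set (Fin n → ℝ) := {w | ∀ z, z ⬝ᵥ w ≤ meanAbs z}

/-- The dual norm of `meanAbs`. -/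
def dualNorm {n : ℕ} (w : Fin n → ℝ) : ℝ := gauge (polarBody n) w

theorem isCompact_meanAbs_eq_one (n : ℕ) : IsCompact {z : Fin n → ℝ | meanAbs z = 1} := by
  have hne : ∀ z ∈ Metric.sphere (0 : Fin n → ℝ) 1, z ≠ 0 := fun z hz h => by
    rw [h] at hz; simp at hz
  have hc : ContinuousOn (fun z : Fin n → ℝ => (meanAbs z)⁻¹ • z) (Metric.sphere 0 1) :=
    fun z hz => (((continuousAt_meanAbs (hne z hz)).inv₀ (meanAbs_pos (hne z hz)).ne').smul
      continuousAt_id).continuousWithinAt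
  convert (isCompact_sphere (0 : Fin n → ℝ) 1).image_of_continuousOn hc using 1
  ext z
  simp only [mem_ofPred_eq, mem_image, mem_sphere_zero_iff_norm]
  constructor
  · intro hz
    have h0 : z ≠ 0 := fun h => by rw [h, meanAbs_zero] at hz; norm_num at hz
    have hn : 0 < ‖z‖ := norm_pos_iff.2 h0
    refine ⟨‖z‖⁻¹ • z, by rw [norm_smul, norm_inv, norm_norm, inv_mul_cancel₀ hn.ne'], ?_⟩
    rw [meanAbs_smul, hz, smul_smul, abs_of_pos (by positivity)]
    field_simp
    rw [one_smul]
  · rintro ⟨w, hw, rfl⟩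
    have h0 := meanAbs_pos (hne w (by simpa using hw))
    rw [meanAbs_smul, abs_of_pos (by positivity), inv_mul_cancel₀ h0.ne']

theorem exists_maximizer {n : ℕ} {w : Fin n → ℝ} (hw : w ≠ 0) :
    ∃ z : Fin n → ℝ, meanAbs z = 1 ∧ ∀ z', z' ⬝ᵥ w ≤ (z ⬝ᵥ w) * meanAbs z' := by
  have hw0 := meanAbs_pos hw
  have hne : {z : Fin n → ℝ | meanAbs z = 1}.Nonempty :=
    ⟨(meanAbs w)⁻¹ • w, by
      rw [mem_ofPred_eq, meanAbs_smul, abs_of_pos (by positivity), inv_mul_cancel₀ hw0.ne']⟩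
  obtain ⟨z, hz, hmax⟩ := (isCompact_meanAbs_eq_one n).exists_isMaxOn hne
    (continuous_dotProduct_right w).continuousOn
  refine ⟨z, hz, fun z' => ?_⟩
  by_cases h0 : z' = 0
  · rw [h0, meanAbs_zero]; simp
  have h1 := meanAbs_pos h0
  have h2 := hmax (show (meanAbs z')⁻¹ • z' ∈ {z : Fin n → ℝ | meanAbs z = 1} by
    rw [mem_ofPred_eq, meanAbs_smul, abs_of_pos (by positivity), inv_mul_cancel₀ h1.ne'])
  simp only [mem_ofPred_eq, smul_dotProduct, smul_eq_mul] at h2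
  rwa [inv_mul_le_iff₀ h1, mul_comm] at h2

/-- The gradient of `dualNorm`: the point of the unit sphere of `meanAbs` that maximizes
`z ⬝ᵥ w`. -/
def dualGrad {n : ℕ} (w : Fin n → ℝ) : Fin n → ℝ :=
  if hw : w ≠ 0 then (exists_maximizer hw).choose else 0

theorem meanAbs_dualGrad {n : ℕ} {w : Fin n → ℝ} (hw : w ≠ 0) : meanAbs (dualGrad w) = 1 := by
  rw [dualGrad, dif_pos hw]; exact (exists_maximizer hw).choose_spec.1

theorem dotProduct_le_dualGrad {n : ℕ} {w : Fin n → ℝ} (hw : w ≠ 0) (z : Fin n → ℝ) :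
    z ⬝ᵥ w ≤ (dualGrad w ⬝ᵥ w) * meanAbs z := by
  rw [dualGrad, dif_pos hw]; exact (exists_maximizer hw).choose_spec.2 z

theorem dotProduct_self_pos {n : ℕ} {w : Fin n → ℝ} (hw : w ≠ 0) : 0 < w ⬝ᵥ w :=
  lt_of_le_of_ne (Finset.sum_nonneg fun i _ => mul_self_nonneg (w i))
      (fun h => hw (dotProduct_self_eq_zero.1 h.symm))

theorem dualGrad_dotProduct_pos {n : ℕ} {w : Fin n → ℝ} (hw : w ≠ 0) : 0 < dualGrad w ⬝ᵥ w := by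
  have h1 := dotProduct_le_dualGrad hw w
  have h2 := dotProduct_self_pos hw
  have h3 := meanAbs_pos hw
  by_contra h
  push Not at h
  nlinarith

open scoped Pointwise in
theorem dualNorm_eq {n : ℕ} {w : Fin n → ℝ} (hw : w ≠ 0) : dualNorm w = dualGrad w ⬝ᵥ w := by
  have hpos := dualGrad_dotProduct_pos hw
  have hmem : ∀ T : ℝ, 0 < T → (w ∈ T • polarBody n ↔ dualGrad w ⬝ᵥ w ≤ T) := by
    intro T hT
    rw [mem_smul_set_iff_inv_smul_mem₀ hT.ne']
    simp only [polarBody, mem_ofPred_eq, dotProduct_smul, smul_eq_mul]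
    constructor
    · intro h
      have := h (dualGrad w)
      rwa [meanAbs_dualGrad hw, inv_mul_le_iff₀ hT, mul_one] at this
    · intro h z
      rw [inv_mul_le_iff₀ hT]
      exact (dotProduct_le_dualGrad hw z).trans (by gcongr; exact meanAbs_nonneg z)
  apply le_antisymm
  · exact gauge_le_of_mem hpos.le ((hmem _ hpos).2 le_rfl)
  · refine le_csInf ⟨_, hpos, (hmem _ hpos).2 le_rfl⟩ ?_
    rintro T ⟨hT, h⟩
    exact (hmem T hT).1 h

theorem dualNorm_pos {n : ℕ} {w : Fin n → ℝ} (hw : w ≠ 0) : 0 < dualNorm w := by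
  rw [dualNorm_eq hw]; exact dualGrad_dotProduct_pos hw

theorem dotProduct_le_dualNorm {n : ℕ} (z w : Fin n → ℝ) :
    z ⬝ᵥ w ≤ dualNorm w * meanAbs z := by
  by_cases hw : w = 0
  · subst hw; simp [dualNorm]
  · rw [dualNorm_eq hw]; exact dotProduct_le_dualGrad hw z

theorem dualGrad_ne_zero {n : ℕ} {w : Fin n → ℝ} (hw : w ≠ 0) : dualGrad w ≠ 0 := fun h => by
  have := meanAbs_dualGrad hw; rw [h, meanAbs_zero] at this; norm_num at this

theorem dualGrad_unique {n : ℕ} {w : Fin n → ℝ} (hw : w ≠ 0) {z : Fin n → ℝ}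
    (hz : meanAbs z = 1) (h : dualNorm w ≤ z ⬝ᵥ w) : z = dualGrad w := by
  have h0 : z ≠ 0 := fun h => by rw [h, meanAbs_zero] at hz; norm_num at hz
  have hr := dualNorm_pos hw
  refine eq_of_meanAbs_add_eq h0 (dualGrad_ne_zero hw) (by rw [hz, meanAbs_dualGrad hw]) ?_
  have h1 := dotProduct_le_dualNorm (z + dualGrad w) w
  rw [add_dotProduct, ← dualNorm_eq hw] at h1
  rw [hz, meanAbs_dualGrad hw]
  by_contra hlt
  push Not at hlt
  nlinarith

/-- The maximizers stay in a compact sphere, every cluster point is a maximizer for `w`, and that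
maximizer is unique. -/
theorem continuousAt_dualGrad {n : ℕ} {w : Fin n → ℝ} (hw : w ≠ 0) :
    ContinuousAt dualGrad w := by
  refine (isCompact_meanAbs_eq_one n).tendsto_nhds_of_unique_mapClusterPt ?_ fun z hz hcl => ?_
  · filter_upwards [isOpen_ne.mem_nhds hw] with w' hw'
    exact meanAbs_dualGrad hw'
  · refine dualGrad_unique hw hz ?_
    rw [dualNorm_eq hw]
    refine le_of_forall_pos_le_add fun ε hε => ?_
    have hz' : ContinuousAt (fun q : (Fin n → ℝ) × (Fin n → ℝ) => q.1 ⬝ᵥ q.2) (z, w) := by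
      unfold dotProduct; fun_prop
    have hd : ContinuousAt (fun w' => dualGrad w ⬝ᵥ w') w :=
      (continuous_dotProduct_left _).continuousAt
    have e1 := Metric.tendsto_nhds.1 hz' (ε / 2) (by positivity)
    have e2 := Metric.tendsto_nhds.1 hd (ε / 2) (by positivity)
    rw [nhds_prod_eq] at e1
    obtain ⟨P, hP, Q, hQ, hPQ⟩ := eventually_prod_iff.1 e1
    have h1 : ∃ᶠ w' in 𝓝 w, P (dualGrad w') := hcl.frequently hP
    obtain ⟨w', hw', ⟨hQw, hdw⟩, hne⟩ :=
      (h1.and_eventually ((hQ.and e2).and (isOpen_ne.mem_nhds hw))).exists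
    have a1 := hPQ hw' hQw
    have a2 := dotProduct_le_dualGrad hne (dualGrad w)
    rw [meanAbs_dualGrad hw, mul_one] at a2
    rw [Real.dist_eq] at a1 hdw
    have b1 := abs_lt.1 a1
    have b2 := abs_lt.1 hdw
    simp only at b1
    linarith

theorem hasStrictFDerivAt_dualNorm {n : ℕ} {w : Fin n → ℝ} (hw : w ≠ 0) :
    HasStrictFDerivAt dualNorm (dotCLM (dualGrad w)) w := by
  refine hasStrictFDerivAt_of_subgradient (γ := fun z => dotCLM (dualGrad z)) ?_
    (continuous_dotCLM.continuousAt.comp (continuousAt_dualGrad hw))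
  filter_upwards [isOpen_ne.mem_nhds hw] with w' hw' w''
  rw [dotCLM_apply, dotProduct_sub, ← dualNorm_eq hw']
  have := dotProduct_le_dualNorm (dualGrad w') w''
  rw [meanAbs_dualGrad hw'] at this
  linarith

theorem dotCLM_injective {n : ℕ} : Function.Injective (dotCLM (n := n)) := fun g g' h =>
  dotProduct_eq _ _ fun w => by rw [← dotCLM_apply, ← dotCLM_apply, h]

theorem dotCLM_smul {n : ℕ} (t : ℝ) (g : Fin n → ℝ) : dotCLM (t • g) = t • dotCLM g := by
  ext w; simp [dotCLM_apply]

/-- Fermat's rule: `dualNorm w * meanAbs z - w · z` is nonnegative and vanishes at `dualGrad w`. The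
resulting equation defines `dualGrad` implicitly and is the one inverted below. -/
theorem dualNorm_smul_meanSign_dualGrad {n : ℕ} {w : Fin n → ℝ} (hw : w ≠ 0) :
    dualNorm w • meanSign (dualGrad w) = w := by
  apply dotCLM_injective
  have h1 : HasFDerivAt (fun z => dualNorm w * meanAbs z - dotCLM w z)
      (dualNorm w • dotCLM (meanSign (dualGrad w)) - dotCLM w) (dualGrad w) :=
    ((hasStrictFDerivAt_meanAbs (dualGrad_ne_zero hw)).hasFDerivAt.const_mul _).sub
      (dotCLM w).hasFDerivAt
  have h2 : IsLocalMin (fun z => dualNorm w * meanAbs z - dotCLM w z) (dualGrad w) := by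
    refine Eventually.of_forall fun z => ?_
    simp only [dotCLM_apply]
    rw [meanAbs_dualGrad hw, dotProduct_comm w (dualGrad w), ← dualNorm_eq hw]
    have := dotProduct_le_dualNorm z w
    rw [dotProduct_comm] at this
    linarith
  rw [dotCLM_smul]
  exact sub_eq_zero.1 (h2.hasFDerivAt_eq_zero h1)

theorem dualGrad_signs {n : ℕ} (σ : Fin n → ℝ) (hσ : ∀ i, |σ i| = 1) (w : Fin n → ℝ) :
    dualGrad (fun i => σ i * w i) = fun i => σ i * dualGrad w i := by
  have hσ2 : ∀ i, σ i * σ i = 1 := fun i => by rw [← abs_mul_abs_self, hσ, one_mul]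
  by_cases hw : w = 0
  · subst hw
    have : (fun i => σ i * (0 : Fin n → ℝ) i) = 0 := by ext i; simp
    rw [this]; ext i; simp [dualGrad]
  have hσw : (fun i => σ i * w i) ≠ 0 := fun h => hw (by
    ext i
    have := congrFun h i
    simp only [Pi.zero_apply] at this
    calc w i = σ i * σ i * w i := by rw [hσ2, one_mul]
      _ = 0 := by rw [mul_assoc, this, mul_zero])
  symm
  refine dualGrad_unique hσw (by rw [meanAbs_signs σ hσ, meanAbs_dualGrad hw]) ?_
  have e1 : (fun i => σ i * dualGrad w i) ⬝ᵥ (fun i => σ i * w i) = dualNorm w := by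
    rw [dualNorm_eq hw]
    simp only [dotProduct]
    refine Finset.sum_congr rfl fun i _ => ?_
    rw [mul_mul_mul_comm, hσ2, one_mul]
  rw [e1, dualNorm_eq hσw]
  have h2 := dotProduct_le_dualNorm (fun i => σ i * dualGrad (fun i => σ i * w i) i) w
  rw [meanAbs_signs σ hσ, meanAbs_dualGrad hσw, mul_one] at h2
  refine le_trans (le_of_eq ?_) h2
  simp only [dotProduct]
  exact Finset.sum_congr rfl fun i _ => by ring

/-! ### Difference quotients of the arcsine -/

/-- The difference quotient of the arcsine, extended to the diagonal by the derivative. -/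
def arcsinQuot (a b : ℝ) : ℝ :=
  if b = a then arcsinSlope a else (Real.arcsin b - Real.arcsin a) / (b - a)

theorem arcsinQuot_mul (a b : ℝ) : arcsinQuot a b * (b - a) = Real.arcsin b - Real.arcsin a := by
  unfold arcsinQuot
  split_ifs with h
  · rw [h]; simp
  · rw [div_mul_cancel₀ _ (sub_ne_zero.2 h)]

theorem arcsinQuot_self (a : ℝ) : arcsinQuot a a = arcsinSlope a := if_pos rfl

theorem arcsinQuot_nonneg (a b : ℝ) : 0 ≤ arcsinQuot a b := by
  unfold arcsinQuot
  split_ifs with h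
  · exact arcsinSlope_nonneg a
  · rcases le_total a b with h' | h'
    · exact div_nonneg (sub_nonneg.2 (Real.monotone_arcsin h')) (sub_nonneg.2 h')
    · exact div_nonneg_of_nonpos (sub_nonpos.2 (Real.monotone_arcsin h')) (sub_nonpos.2 h')

/-- The bound involves only the first argument, so one singular moment, taken at the base point,
controls all the difference quotients from it. -/
theorem min_sqrt_mul_arcsinQuot_le (a b : ℝ) :
    min √|a - 1| √|a + 1| * arcsinQuot a b ≤ Real.pi ^ 2 / 2 := by
  have hpi := Real.pi_gt_three
  unfold arcsinQuot
  split_ifs with h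
  · have h1 : 1 ≤ Real.pi ^ 2 / 2 := by nlinarith
    refine le_trans ?_ h1
    unfold arcsinSlope
    rcases lt_or_ge |a| 1 with ha | ha
    · have ha' := abs_lt.1 ha
      rw [mul_one_div, div_le_one (Real.sqrt_pos.2 (by nlinarith)),
        show 1 - a ^ 2 = (1 - a) * (1 + a) by ring,
        Real.sqrt_mul (by linarith), abs_of_nonpos (by linarith), abs_of_nonneg (by linarith),
        show -(a - 1) = 1 - a by ring, add_comm a 1]
      rcases le_total a 0 with h0 | h0
      · refine (min_le_right _ _).trans (le_mul_of_one_le_left (Real.sqrt_nonneg _) ?_)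
        exact Real.one_le_sqrt.2 (by linarith)
      · refine (min_le_left _ _).trans (le_mul_of_one_le_right (Real.sqrt_nonneg _) ?_)
        exact Real.one_le_sqrt.2 (by linarith)
    · rw [Real.sqrt_eq_zero_of_nonpos (x := 1 - a ^ 2)]
      · simp
      · have := sq_abs a; nlinarith
  · have h1 := min_sqrt_mul_arcsin_sub_le a b
    have h2 : 0 < |b - a| := abs_pos.2 (sub_ne_zero.2 h)
    have h3 : (Real.arcsin b - Real.arcsin a) / (b - a) =
        |Real.arcsin b - Real.arcsin a| / |b - a| := by
      rw [← abs_div, abs_of_nonneg]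
      have := arcsinQuot_nonneg a b
      rwa [arcsinQuot, if_neg h] at this
    rw [h3, ← mul_div_assoc, div_le_iff₀ h2]
    exact h1

theorem enorm_arcsinQuot_rpow_le (a b : ℝ) :
    ‖arcsinQuot a b‖ₑ ^ (3 / 2 : ℝ) ≤ ENNReal.ofReal (Real.pi ^ 2 / 2) ^ (3 / 2 : ℝ) *
      (‖a - 1‖ₑ ^ (-(3 / 4) : ℝ) + ‖a + 1‖ₑ ^ (-(3 / 4) : ℝ)) := by
  set m := min √|a - 1| √|a + 1| with hm
  have hm0 : 0 ≤ m := le_min (Real.sqrt_nonneg _) (Real.sqrt_nonneg _)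
  have h1 : ‖arcsinQuot a b‖ₑ ≤ ENNReal.ofReal (Real.pi ^ 2 / 2) * ‖m‖ₑ⁻¹ := by
    rw [← div_eq_mul_inv, ENNReal.le_div_iff_mul_le (Or.inr (by
      simp only [ne_eq, ENNReal.ofReal_eq_zero, not_le]; positivity))
      (Or.inl enorm_ne_top), Real.enorm_of_nonneg hm0,
      Real.enorm_of_nonneg (arcsinQuot_nonneg _ _), ← ENNReal.ofReal_mul (arcsinQuot_nonneg _ _),
      mul_comm]
    exact ENNReal.ofReal_le_ofReal (min_sqrt_mul_arcsinQuot_le a b)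
  refine (ENNReal.rpow_le_rpow h1 (by norm_num)).trans ?_
  rw [ENNReal.mul_rpow_of_nonneg _ _ (by norm_num), ENNReal.inv_rpow, ← ENNReal.rpow_neg]
  gcongr
  have := min_sqrt_rpow_le a (3 / 4)
  rwa [show -(2 * (3 / 4) : ℝ) = -(3 / 2) by norm_num] at this

theorem continuousAt_arcsinSlope {x : ℝ} (h1 : x ≠ 1) (h2 : x ≠ -1) :
    ContinuousAt arcsinSlope x := by
  have hne : 1 - x ^ 2 ≠ 0 := fun h => by
    have : (x - 1) * (x + 1) = 0 := by linarith
    rcases mul_eq_zero.1 this with h | h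
    · exact h1 (by linarith)
    · exact h2 (by linarith)
  rcases lt_or_gt_of_ne hne with h | h
  -- Outside `[-1, 1]` the square root of a negative number is `0` and so is its inverse, which
  -- agrees with the derivative of the clamped arcsine.
  · refine (continuousAt_const (y := (0 : ℝ))).congr ?_
    have : ∀ᶠ y in 𝓝 x, 1 - y ^ 2 < 0 :=
      (by fun_prop : ContinuousAt (fun y : ℝ => 1 - y ^ 2) x).eventually_lt continuousAt_const h
    filter_upwards [this] with y hy
    rw [arcsinSlope, Real.sqrt_eq_zero_of_nonpos hy.le, div_zero]
  · unfold arcsinSlope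
    exact continuousAt_const.div (by fun_prop) (Real.sqrt_pos.2 h).ne'

theorem tendsto_arcsinQuot {x : ℝ} (h1 : x ≠ 1) (h2 : x ≠ -1) :
    Tendsto (fun q : ℝ × ℝ => arcsinQuot q.1 q.2) (𝓝 (x, x)) (𝓝 (arcsinSlope x)) := by
  rw [Metric.tendsto_nhds]
  intro ε hε
  have hs := (hasStrictFDerivAt_iff_isLittleO.1
    (Real.hasStrictDerivAt_arcsin h2 h1).hasStrictFDerivAt).def (half_pos hε)
  have hc : ∀ᶠ q : ℝ × ℝ in 𝓝 (x, x), dist (arcsinSlope q.1) (arcsinSlope x) < ε :=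
    (Metric.tendsto_nhds.1 (continuousAt_arcsinSlope h1 h2) ε hε).filter_mono
      (continuousAt_fst (p := (x, x)))
  filter_upwards [hs, hc] with q hq hq'
  unfold arcsinQuot
  split_ifs with h
  · exact hq'
  · have h3 : 0 < |q.1 - q.2| := abs_pos.2 (sub_ne_zero.2 (Ne.symm h))
    have h4 : (Real.arcsin q.2 - Real.arcsin q.1) / (q.2 - q.1) - arcsinSlope x =
        (Real.arcsin q.1 - Real.arcsin q.2 - (q.1 - q.2) * arcsinSlope x) / (q.1 - q.2) := by
      have : q.1 - q.2 ≠ 0 := sub_ne_zero.2 (Ne.symm h)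
      have : q.2 - q.1 ≠ 0 := sub_ne_zero.2 h
      field_simp
      ring
    rw [Real.dist_eq, h4, abs_div, div_lt_iff₀ h3]
    simp only [Real.norm_eq_abs, ContinuousLinearMap.toSpanSingleton_apply, smul_eq_mul] at hq
    unfold arcsinSlope
    have : ε / 2 * |q.1 - q.2| < ε * |q.1 - q.2| := by gcongr; linarith
    exact hq.trans_lt this

theorem measurable_arcsinQuot {n : ℕ} (ζ ζ' : Fin n → ℝ) :
    Measurable fun c => arcsinQuot (ζ ⬝ᵥ c) (ζ' ⬝ᵥ c) := by
  have m1 := (continuous_dotProduct_left ζ).measurable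
  have m2 := (continuous_dotProduct_left ζ').measurable
  unfold arcsinQuot
  refine Measurable.ite (measurableSet_eq_fun m2 m1) (measurable_arcsinSlope.comp m1) ?_
  exact ((Real.continuous_arcsin.measurable.comp m2).sub
    (Real.continuous_arcsin.measurable.comp m1)).div (m2.sub m1)

theorem chartGrad_sub {n : ℕ} (ζ ζ' : Fin n → ℝ) (j : Fin n) :
    chartGrad ζ' j - chartGrad ζ j = 2 / Real.pi *
      ∫ c, arcsinQuot (ζ ⬝ᵥ c) (ζ' ⬝ᵥ c) * ((ζ' - ζ) ⬝ᵥ c) * c j ∂arcsinePi n := by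
  have hi : ∀ ζ : Fin n → ℝ, Integrable (fun c => Real.arcsin (ζ ⬝ᵥ c) * c j) (arcsinePi n) :=
    fun ζ => integrable_of_ae_abs_le ((Real.continuous_arcsin.measurable.comp
      (continuous_dotProduct_left ζ).measurable).mul (measurable_pi_apply j)) (Real.pi / 2)
      fun c hc => by
        rw [abs_mul]
        exact (mul_le_of_le_one_right (abs_nonneg _) (hc j)).trans (abs_arcsin_le _)
  rw [chartGrad, chartGrad, ← mul_sub, ← integral_sub (hi ζ') (hi ζ)]
  congr 2; ext c
  rw [sub_dotProduct, arcsinQuot_mul, sub_mul]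

theorem ae_dotProduct_ne_of_ne_zero {n : ℕ} (ζ : Fin n → ℝ) {t : ℝ} (ht : t ≠ 0) :
    ∀ᵐ c ∂arcsinePi n, ζ ⬝ᵥ c ≠ t := by
  by_cases h : ζ = 0
  · subst h; exact Eventually.of_forall fun c => by simpa using ht.symm
  · exact ae_dotProduct_ne h t

theorem ae_tendsto_arcsinQuot {n : ℕ} (ζ₀ : Fin n → ℝ) : ∀ᵐ c ∂arcsinePi n,
    Tendsto (fun q : (Fin n → ℝ) × (Fin n → ℝ) => arcsinQuot (q.1 ⬝ᵥ c) (q.2 ⬝ᵥ c))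
      (𝓝 (ζ₀, ζ₀)) (𝓝 (arcsinSlope (ζ₀ ⬝ᵥ c))) := by
  filter_upwards [ae_dotProduct_ne_of_ne_zero ζ₀ one_ne_zero,
    ae_dotProduct_ne_of_ne_zero ζ₀ (neg_ne_zero.2 one_ne_zero)] with c h1 h2
  have hc := continuous_dotProduct_right c
  have ht : Tendsto (fun q : (Fin n → ℝ) × (Fin n → ℝ) => (q.1 ⬝ᵥ c, q.2 ⬝ᵥ c))
      (𝓝 (ζ₀, ζ₀)) (𝓝 (ζ₀ ⬝ᵥ c, ζ₀ ⬝ᵥ c)) :=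
    ((hc.comp continuous_fst).prodMk (hc.comp continuous_snd)).tendsto (ζ₀, ζ₀)
  exact (tendsto_arcsinQuot h1 h2).comp ht

/-- The truncated difference quotients converge in mean. -/
theorem tendsto_integral_min_arcsinQuot {n : ℕ} (ζ₀ : Fin n → ℝ) {K : ℝ} (hK : 0 ≤ K) :
    Tendsto (fun q : (Fin n → ℝ) × (Fin n → ℝ) =>
      ∫ c, |min (arcsinQuot (q.1 ⬝ᵥ c) (q.2 ⬝ᵥ c)) K - min (arcsinSlope (ζ₀ ⬝ᵥ c)) K|
        ∂arcsinePi n) (𝓝 (ζ₀, ζ₀)) (𝓝 0) := by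
  have m0 : Measurable fun c : Fin n → ℝ => arcsinSlope (ζ₀ ⬝ᵥ c) :=
    measurable_arcsinSlope.comp (continuous_dotProduct_left ζ₀).measurable
  have : (0 : ℝ) = ∫ c, (0 : ℝ) ∂arcsinePi n := by simp
  rw [this]
  refine tendsto_integral_filter_of_dominated_convergence (fun _ => K) ?_ ?_
    (integrable_const _) ?_
  · refine Eventually.of_forall fun q => Measurable.aestronglyMeasurable ?_
    exact (((measurable_arcsinQuot q.1 q.2).min measurable_const).sub
      (m0.min measurable_const)).abs
  · refine Eventually.of_forall fun q => Eventually.of_forall fun c => ?_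
    rw [Real.norm_eq_abs, abs_abs, abs_le]
    have h1 := le_min (arcsinQuot_nonneg (q.1 ⬝ᵥ c) (q.2 ⬝ᵥ c)) hK
    have h2 := le_min (arcsinSlope_nonneg (ζ₀ ⬝ᵥ c)) hK
    have h3 := min_le_right (arcsinQuot (q.1 ⬝ᵥ c) (q.2 ⬝ᵥ c)) K
    have h4 := min_le_right (arcsinSlope (ζ₀ ⬝ᵥ c)) K
    constructor <;> linarith
  · filter_upwards [ae_tendsto_arcsinQuot ζ₀] with c hc
    have := ((hc.min (tendsto_const_nhds (x := K))).sub
      (tendsto_const_nhds (x := min (arcsinSlope (ζ₀ ⬝ᵥ c)) K))).abs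
    simpa using this

/-- The tail above `K` is paid for by the moment of order 3/2. An order above 1 gives uniform
integrability, and 3/2 is low enough for the singular kernels, since it produces the exponent 3/4.
-/
theorem sub_min_le {u K : ℝ} (hu : 0 ≤ u) (hK : 0 < K) :
    ‖u - min u K‖ₑ ≤ ENNReal.ofReal K ^ (-(1 / 2) : ℝ) * ‖u‖ₑ ^ (3 / 2 : ℝ) := by
  rcases le_total u K with h | h
  · simp [min_eq_left h]
  · rw [min_eq_right h, Real.enorm_of_nonneg (sub_nonneg.2 h), Real.enorm_of_nonneg hu,
      ENNReal.ofReal_rpow_of_pos hK, ENNReal.ofReal_rpow_of_nonneg hu (by norm_num),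
      ← ENNReal.ofReal_mul (by positivity)]
    apply ENNReal.ofReal_le_ofReal
    have hu' : 0 < u := hK.trans_le h
    have h1 : u ^ (-(1 / 2) : ℝ) ≤ K ^ (-(1 / 2) : ℝ) :=
      Real.rpow_le_rpow_of_nonpos hK h (by norm_num)
    have h2 : u ^ (-(1 / 2) : ℝ) * u ^ (3 / 2 : ℝ) = u := by
      rw [← Real.rpow_add hu']; norm_num
    have h3 : 0 ≤ u ^ (3 / 2 : ℝ) := by positivity
    nlinarith

/-! ### Uniform integrability of the difference quotients -/

/-- The singular moment that controls the difference quotients of the arcsine. -/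
def singularMoment {n : ℕ} (ζ : Fin n → ℝ) : ℝ≥0∞ :=
  ∫⁻ c, (‖ζ ⬝ᵥ c - 1‖ₑ ^ (-(3 / 4) : ℝ) + ‖ζ ⬝ᵥ c + 1‖ₑ ^ (-(3 / 4) : ℝ)) ∂arcsinePi n

theorem exists_lintegral_dotProduct_three_eighths_le :
    ∃ C : ℝ≥0∞, C ≠ ⊤ ∧ ∀ (n : ℕ) (z : Fin n → ℝ) (l : Fin n), z l ≠ 0 → ∀ t : ℝ,
      ∫⁻ c, ‖z ⬝ᵥ c - t‖ₑ ^ (-(3 / 8) : ℝ) ∂arcsinePi n ≤ ‖z l‖ₑ ^ (-(3 / 8) : ℝ) * C := by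
  obtain ⟨C, hC, h⟩ := exists_lintegral_rpow_three_eighths_le
  refine ⟨C, hC, fun n z l hl t => ?_⟩
  have hm : Measurable fun c : Fin n → ℝ => ‖z ⬝ᵥ c - t‖ₑ ^ (-(3 / 8) : ℝ) := by
    have := (continuous_dotProduct_left z).measurable
    fun_prop
  rw [lintegral_resample l hm]
  calc _ ≤ ∫⁻ c, ‖z l‖ₑ ^ (-(3 / 8) : ℝ) * C ∂arcsinePi n := by
        refine lintegral_mono fun c => ?_
        have e : ∀ x : ℝ, ‖z ⬝ᵥ Function.update c l x - t‖ₑ ^ (-(3 / 8) : ℝ) =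
            ‖z l‖ₑ ^ (-(3 / 8) : ℝ) *
            ‖x - (t - z ⬝ᵥ Function.update c l 0) / z l‖ₑ ^ (-(3 / 8) : ℝ) := fun x => by
          rw [dotProduct_update z c l x,
            ← ENNReal.mul_rpow_of_ne_top enorm_ne_top enorm_ne_top, ← enorm_mul]
          congr 2; field_simp; ring
        simp_rw [e]
        rw [lintegral_const_mul _ (by fun_prop)]
        gcongr
        exact h _
    _ = _ := by simp

/-- Integrating in `c j` leaves two kernels of exponent 3/8 in the remaining form, which the second
nonzero coordinate `l` makes integrable. The power of `z j` is `-3/4 + 3/8 = -3/8`. -/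
theorem exists_lintegral_dotProduct_three_quarters_le :
    ∃ C : ℝ≥0∞, C ≠ ⊤ ∧ ∀ (n : ℕ) (z : Fin n → ℝ) (j l : Fin n), j ≠ l → z j ≠ 0 → z l ≠ 0 →
      ∀ t : ℝ, ∫⁻ c, ‖z ⬝ᵥ c - t‖ₑ ^ (-(3 / 4) : ℝ) ∂arcsinePi n ≤
        C * (‖z j‖ₑ ^ (-(3 / 8) : ℝ) * ‖z l‖ₑ ^ (-(3 / 8) : ℝ)) := by
  obtain ⟨C₀, hC₀, h₀⟩ := exists_lintegral_dotProduct_three_eighths_le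
  obtain ⟨C, hC, h⟩ := exists_lintegral_rpow_three_quarters_le
  refine ⟨C * (C₀ + C₀), ENNReal.mul_ne_top hC (ENNReal.add_ne_top.2 ⟨hC₀, hC₀⟩),
    fun n z j l hjl hj hl t => ?_⟩
  have hm : Measurable fun c : Fin n → ℝ => ‖z ⬝ᵥ c - t‖ₑ ^ (-(3 / 4) : ℝ) := by
    have := (continuous_dotProduct_left z).measurable
    fun_prop
  set z' := Function.update z j 0 with hz'
  have hz'l : z' l = z l := Function.update_of_ne hjl.symm _ _
  have hs : ∀ c : Fin n → ℝ, z ⬝ᵥ Function.update c j 0 = z' ⬝ᵥ c := fun c => by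
    simp only [dotProduct, hz']
    refine Finset.sum_congr rfl fun i _ => ?_
    by_cases hi : i = j
    · subst hi; simp
    · rw [Function.update_of_ne hi, Function.update_of_ne hi]
  have hz'm := (continuous_dotProduct_left z').measurable
  have hzj0 : ‖z j‖ₑ ≠ 0 := by simpa using hj
  have hpow : ‖z j‖ₑ ^ (-(3 / 4) : ℝ) * ‖z j‖ₑ ^ (3 / 8 : ℝ) = ‖z j‖ₑ ^ (-(3 / 8) : ℝ) := by
    rw [← ENNReal.rpow_add _ _ hzj0 enorm_ne_top]; norm_num
  have hquot : ∀ u : ℝ, ‖u / z j‖ₑ ^ (-(3 / 8) : ℝ) =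
      ‖u‖ₑ ^ (-(3 / 8) : ℝ) * ‖z j‖ₑ ^ (3 / 8 : ℝ) := fun u => by
    rw [div_eq_mul_inv, enorm_mul, enorm_inv hj,
      ENNReal.mul_rpow_of_ne_top enorm_ne_top (ENNReal.inv_ne_top.2 hzj0), ENNReal.inv_rpow,
      ← ENNReal.rpow_neg, neg_neg]
  rw [lintegral_resample j hm]
  calc _ ≤ ∫⁻ c, C * ‖z j‖ₑ ^ (-(3 / 8) : ℝ) * (‖z' ⬝ᵥ c - (t - z j)‖ₑ ^ (-(3 / 8) : ℝ) +
          ‖z' ⬝ᵥ c - (t + z j)‖ₑ ^ (-(3 / 8) : ℝ)) ∂arcsinePi n := by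
        refine lintegral_mono fun c => ?_
        have e : ∀ x : ℝ, ‖z ⬝ᵥ Function.update c j x - t‖ₑ ^ (-(3 / 4) : ℝ) =
            ‖z j‖ₑ ^ (-(3 / 4) : ℝ) * ‖x - (t - z' ⬝ᵥ c) / z j‖ₑ ^ (-(3 / 4) : ℝ) := fun x => by
          rw [dotProduct_update z c j x, hs,
            ← ENNReal.mul_rpow_of_ne_top enorm_ne_top enorm_ne_top, ← enorm_mul]
          congr 2; field_simp; ring
        simp_rw [e]
        rw [lintegral_const_mul _ (by fun_prop)]
        refine (mul_le_mul_right (h _) _).trans (le_of_eq ?_)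
        have e1 : (t - z' ⬝ᵥ c) / z j - 1 = (-(z' ⬝ᵥ c - (t - z j))) / z j := by
          field_simp; ring
        have e2 : (t - z' ⬝ᵥ c) / z j + 1 = (-(z' ⬝ᵥ c - (t + z j))) / z j := by
          field_simp; ring
        rw [e1, e2, hquot, hquot, enorm_neg, enorm_neg, ← hpow]
        ring
    _ = C * ‖z j‖ₑ ^ (-(3 / 8) : ℝ) *
          (∫⁻ c, ‖z' ⬝ᵥ c - (t - z j)‖ₑ ^ (-(3 / 8) : ℝ) ∂arcsinePi n +
          ∫⁻ c, ‖z' ⬝ᵥ c - (t + z j)‖ₑ ^ (-(3 / 8) : ℝ) ∂arcsinePi n) := by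
        rw [lintegral_const_mul _ (by fun_prop), lintegral_add_left (by fun_prop)]
    _ ≤ C * ‖z j‖ₑ ^ (-(3 / 8) : ℝ) *
          (‖z l‖ₑ ^ (-(3 / 8) : ℝ) * C₀ + ‖z l‖ₑ ^ (-(3 / 8) : ℝ) * C₀) := by
        rw [← hz'l]
        gcongr <;> exact h₀ n z' l (by rwa [hz'l]) _
    _ = _ := by ring

theorem enorm_rpow_neg_le {x δ p : ℝ} (hp : 0 < p) (h : δ ≤ |x|) :
    ‖x‖ₑ ^ (-p) ≤ ENNReal.ofReal δ ^ (-p) := by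
  have : ENNReal.ofReal δ ≤ 1 * ‖x‖ₑ := by
    rw [one_mul, Real.enorm_eq_ofReal_abs]; exact ENNReal.ofReal_le_ofReal h
  simpa using rpow_neg_le_of_le_mul hp one_ne_zero ENNReal.one_ne_top this

theorem ofReal_rpow_ne_top {δ p : ℝ} (hδ : 0 < δ) : ENNReal.ofReal δ ^ p ≠ ⊤ := by
  rw [ENNReal.ofReal_rpow_of_pos hδ]; exact ENNReal.ofReal_ne_top

/-- Away from the signed unit vectors, the singular moment is locally bounded on the unit cube. -/
theorem eventually_singularMoment_le {n : ℕ} {ζ₀ : Fin n → ℝ}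
    (h : ∑ i, |ζ₀ i| < 1 ∨ ∃ j l, j ≠ l ∧ ζ₀ j ≠ 0 ∧ ζ₀ l ≠ 0) :
    ∃ C : ℝ≥0∞, C ≠ ⊤ ∧ ∀ᶠ ζ in 𝓝 ζ₀, singularMoment ζ ≤ C := by
  rcases h with h | ⟨j, l, hjl, hj, hl⟩
  · set δ := (1 - ∑ i, |ζ₀ i|) / 2 with hδ
    have hδ0 : 0 < δ := by rw [hδ]; linarith
    refine ⟨ENNReal.ofReal δ ^ (-(3 / 4) : ℝ) + ENNReal.ofReal δ ^ (-(3 / 4) : ℝ),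
      ENNReal.add_ne_top.2 ⟨ofReal_rpow_ne_top hδ0, ofReal_rpow_ne_top hδ0⟩, ?_⟩
    have hc : ∀ᶠ ζ : Fin n → ℝ in 𝓝 ζ₀, ∑ i, |ζ i| < 1 - δ :=
      (by fun_prop : Continuous fun ζ : Fin n → ℝ => ∑ i, |ζ i|).continuousAt.eventually_lt
        continuousAt_const (by rw [hδ]; linarith)
    filter_upwards [hc] with ζ hζ
    unfold singularMoment
    have : ∀ᵐ c ∂arcsinePi n, ‖ζ ⬝ᵥ c - 1‖ₑ ^ (-(3 / 4) : ℝ) + ‖ζ ⬝ᵥ c + 1‖ₑ ^ (-(3 / 4) : ℝ) ≤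
        ENNReal.ofReal δ ^ (-(3 / 4) : ℝ) + ENNReal.ofReal δ ^ (-(3 / 4) : ℝ) := by
      filter_upwards [ae_arcsinePi_abs_le n] with c hc
      have h1 := abs_le.1 ((abs_dotProduct_le ζ hc).trans hζ.le)
      refine add_le_add ?_ ?_
      · refine enorm_rpow_neg_le (by norm_num) ?_
        rw [abs_of_neg] <;> linarith
      · refine enorm_rpow_neg_le (by norm_num) ?_
        rw [abs_of_pos] <;> linarith
    calc _ ≤ _ := lintegral_mono_ae this
      _ = _ := by simp
  · obtain ⟨C, hC, h⟩ := exists_lintegral_dotProduct_three_quarters_le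
    -- Near `ζ₀` these two coordinates keep at least half their size, which makes the constant
    -- uniform.
    have hj2 : 0 < |ζ₀ j| / 2 := by positivity
    have hl2 : 0 < |ζ₀ l| / 2 := by positivity
    set D := C * (ENNReal.ofReal (|ζ₀ j| / 2) ^ (-(3 / 8) : ℝ) *
      ENNReal.ofReal (|ζ₀ l| / 2) ^ (-(3 / 8) : ℝ)) with hD
    have hDt : D ≠ ⊤ := ENNReal.mul_ne_top hC
      (ENNReal.mul_ne_top (ofReal_rpow_ne_top hj2) (ofReal_rpow_ne_top hl2))
    refine ⟨D + D, ENNReal.add_ne_top.2 ⟨hDt, hDt⟩, ?_⟩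
    have hcj : ∀ᶠ ζ : Fin n → ℝ in 𝓝 ζ₀, |ζ₀ j| / 2 < |ζ j| :=
      continuousAt_const.eventually_lt
        (by fun_prop : Continuous fun ζ : Fin n → ℝ => |ζ j|).continuousAt (by linarith)
    have hcl : ∀ᶠ ζ : Fin n → ℝ in 𝓝 ζ₀, |ζ₀ l| / 2 < |ζ l| :=
      continuousAt_const.eventually_lt
        (by fun_prop : Continuous fun ζ : Fin n → ℝ => |ζ l|).continuousAt (by linarith)
    filter_upwards [hcj, hcl] with ζ h1 h2
    have hb : ∀ t : ℝ, ∫⁻ c, ‖ζ ⬝ᵥ c - t‖ₑ ^ (-(3 / 4) : ℝ) ∂arcsinePi n ≤ D := fun t => by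
      refine (h n ζ j l hjl (abs_pos.1 (hj2.trans h1)) (abs_pos.1 (hl2.trans h2)) t).trans ?_
      exact mul_le_mul' le_rfl (mul_le_mul' (enorm_rpow_neg_le (by norm_num) h1.le)
        (enorm_rpow_neg_le (by norm_num) h2.le))
    have hm := (continuous_dotProduct_left ζ).measurable
    unfold singularMoment
    rw [lintegral_add_left (by fun_prop)]
    gcongr
    · exact hb 1
    · simpa using hb (-1)

theorem lintegral_arcsinQuot_rpow_le {n : ℕ} (ζ ζ' : Fin n → ℝ) :
    ∫⁻ c, ‖arcsinQuot (ζ ⬝ᵥ c) (ζ' ⬝ᵥ c)‖ₑ ^ (3 / 2 : ℝ) ∂arcsinePi n ≤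
      ENNReal.ofReal (Real.pi ^ 2 / 2) ^ (3 / 2 : ℝ) * singularMoment ζ := by
  have hm := (continuous_dotProduct_left ζ).measurable
  unfold singularMoment
  rw [← lintegral_const_mul _ (by fun_prop)]
  exact lintegral_mono fun c => enorm_arcsinQuot_rpow_le _ _

/-- Vitali's argument: the truncations at a height `K` converge in mean, and the tails are small
uniformly because the moments of order 3/2 are bounded near `ζ₀`. -/
theorem tendsto_lintegral_arcsinQuot_sub {n : ℕ} {ζ₀ : Fin n → ℝ} {C : ℝ≥0∞} (hC : C ≠ ⊤)
    (h : ∀ᶠ ζ in 𝓝 ζ₀, singularMoment ζ ≤ C) :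
    Tendsto (fun q : (Fin n → ℝ) × (Fin n → ℝ) =>
      ∫⁻ c, ‖arcsinQuot (q.1 ⬝ᵥ c) (q.2 ⬝ᵥ c) - arcsinSlope (ζ₀ ⬝ᵥ c)‖ₑ ∂arcsinePi n)
      (𝓝 (ζ₀, ζ₀)) (𝓝 0) := by
  set B := ENNReal.ofReal (Real.pi ^ 2 / 2) ^ (3 / 2 : ℝ) * C with hB
  have hBt : B ≠ ⊤ := ENNReal.mul_ne_top
    (ENNReal.rpow_ne_top_of_nonneg (by norm_num) ENNReal.ofReal_ne_top) hC
  have hm0 : Measurable fun c : Fin n → ℝ => arcsinSlope (ζ₀ ⬝ᵥ c) :=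
    measurable_arcsinSlope.comp (continuous_dotProduct_left ζ₀).measurable
  have hquot : ∀ ζ ζ' : Fin n → ℝ, singularMoment ζ ≤ C →
      ∫⁻ c, ‖arcsinQuot (ζ ⬝ᵥ c) (ζ' ⬝ᵥ c)‖ₑ ^ (3 / 2 : ℝ) ∂arcsinePi n ≤ B :=
    fun ζ ζ' h => (lintegral_arcsinQuot_rpow_le ζ ζ').trans (mul_le_mul' le_rfl h)
  have hslope : ∫⁻ c, ‖arcsinSlope (ζ₀ ⬝ᵥ c)‖ₑ ^ (3 / 2 : ℝ) ∂arcsinePi n ≤ B := by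
    simpa [arcsinQuot_self] using hquot ζ₀ ζ₀ h.self_of_nhds
  rw [ENNReal.tendsto_nhds_zero]
  intro ε hε
  by_cases hεt : ε = ⊤
  · simp [hεt]
  obtain ⟨K, hK, hKε⟩ : ∃ K : ℝ, 0 < K ∧
      ENNReal.ofReal K ^ (-(1 / 2) : ℝ) * (B + B) ≤ ε / 2 := by
    have h1 : Tendsto (fun K : ℝ => ENNReal.ofReal K ^ (-(1 / 2) : ℝ) * (B + B)) atTop (𝓝 0) := by
      have h2 : Tendsto (fun K : ℝ => ENNReal.ofReal K ^ (-(1 / 2) : ℝ)) atTop (𝓝 0) := by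
        have h3 : Tendsto (fun K : ℝ => ENNReal.ofReal (K ^ (-(1 / 2) : ℝ))) atTop (𝓝 0) := by
          rw [← ENNReal.ofReal_zero]
          exact ENNReal.tendsto_ofReal (tendsto_rpow_neg_atTop (by norm_num))
        refine h3.congr' ?_
        filter_upwards [eventually_gt_atTop 0] with K hK
        rw [ENNReal.ofReal_rpow_of_pos hK]
      have := ENNReal.Tendsto.mul_const (b := B + B) h2
        (Or.inr (ENNReal.add_ne_top.2 ⟨hBt, hBt⟩))
      simpa using this
    have h2 := (ENNReal.tendsto_nhds_zero.1 h1) (ε / 2) (ENNReal.half_pos hε.ne')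
    obtain ⟨K, hK⟩ := (h2.and (eventually_gt_atTop 0)).exists
    exact ⟨K, hK.2, hK.1⟩
  have htr := Metric.tendsto_nhds.1 (tendsto_integral_min_arcsinQuot ζ₀ hK.le) (ε / 2).toReal
    (ENNReal.toReal_pos (ENNReal.half_pos hε.ne').ne'
      (ENNReal.div_ne_top hεt (by norm_num)))
  have hev : ∀ᶠ q : (Fin n → ℝ) × (Fin n → ℝ) in 𝓝 (ζ₀, ζ₀), singularMoment q.1 ≤ C :=
    h.filter_mono (continuousAt_fst (p := (ζ₀, ζ₀)))
  filter_upwards [htr, hev] with q hq hq1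
  set u : (Fin n → ℝ) → ℝ := fun c => arcsinQuot (q.1 ⬝ᵥ c) (q.2 ⬝ᵥ c) with hu
  set v : (Fin n → ℝ) → ℝ := fun c => arcsinSlope (ζ₀ ⬝ᵥ c) with hv
  have hum : Measurable u := measurable_arcsinQuot q.1 q.2
  have hd : Measurable fun c => min (u c) K - min (v c) K :=
    (hum.min measurable_const).sub (hm0.min measurable_const)
  have hmin : ∫⁻ c, ‖min (u c) K - min (v c) K‖ₑ ∂arcsinePi n ≤ ε / 2 := by
    rw [Real.dist_eq, sub_zero, abs_of_nonneg (integral_nonneg fun _ => abs_nonneg _)] at hq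
    have hi : Integrable (fun c => |min (u c) K - min (v c) K|) (arcsinePi n) := by
      refine integrable_of_ae_abs_le hd.abs K fun c _ => ?_
      rw [abs_abs, abs_le]
      have h1 := le_min (arcsinQuot_nonneg (q.1 ⬝ᵥ c) (q.2 ⬝ᵥ c)) hK.le
      have h2 := le_min (arcsinSlope_nonneg (ζ₀ ⬝ᵥ c)) hK.le
      have h3 := min_le_right (u c) K
      have h4 := min_le_right (v c) K
      constructor <;> linarith
    have h1 := ofReal_integral_eq_lintegral_ofReal hi (Eventually.of_forall fun _ => abs_nonneg _)
    simp_rw [Real.enorm_eq_ofReal_abs]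
    rw [← h1]
    exact ENNReal.ofReal_le_of_le_toReal hq.le
  calc ∫⁻ c, ‖u c - v c‖ₑ ∂arcsinePi n
      ≤ ∫⁻ c, (‖min (u c) K - min (v c) K‖ₑ + ENNReal.ofReal K ^ (-(1 / 2) : ℝ) *
          (‖u c‖ₑ ^ (3 / 2 : ℝ) + ‖v c‖ₑ ^ (3 / 2 : ℝ))) ∂arcsinePi n := by
        refine lintegral_mono fun c => ?_
        have e : u c - v c = (min (u c) K - min (v c) K) +
          ((u c - min (u c) K) - (v c - min (v c) K)) := by ring
        calc ‖u c - v c‖ₑ = _ := by rw [e]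
          _ ≤ ‖min (u c) K - min (v c) K‖ₑ + (‖u c - min (u c) K‖ₑ + ‖v c - min (v c) K‖ₑ) :=
            (enorm_add_le _ _).trans (add_le_add le_rfl enorm_sub_le)
          _ ≤ _ := by
            rw [mul_add]
            gcongr
            · exact sub_min_le (arcsinQuot_nonneg _ _) hK
            · exact sub_min_le (arcsinSlope_nonneg _) hK
    _ = ∫⁻ c, ‖min (u c) K - min (v c) K‖ₑ ∂arcsinePi n + ENNReal.ofReal K ^ (-(1 / 2) : ℝ) *
          (∫⁻ c, ‖u c‖ₑ ^ (3 / 2 : ℝ) ∂arcsinePi n + ∫⁻ c, ‖v c‖ₑ ^ (3 / 2 : ℝ) ∂arcsinePi n) := by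
        rw [lintegral_add_left (by fun_prop), lintegral_const_mul _ (by fun_prop),
          lintegral_add_left (by fun_prop)]
    _ ≤ ε / 2 + ε / 2 := by
        gcongr
        refine le_trans ?_ hKε
        gcongr
        exact hquot q.1 q.2 hq1
    _ = ε := ENNReal.add_halves ε

/-! ### Strict differentiability of `chartGrad` -/

theorem sum_abs_le {n : ℕ} (q : Fin n → ℝ) : ∑ i, |q i| ≤ n * ‖q‖ := by
  have := Finset.sum_le_card_nsmul Finset.univ (fun i => |q i|) ‖q‖
    (fun i _ => by simpa using norm_le_pi_norm q i)
  simpa using this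

theorem integrable_arcsinSlope_dotProduct {n : ℕ} {ζ : Fin n → ℝ} (h : singularMoment ζ ≠ ⊤) :
    Integrable (fun c => arcsinSlope (ζ ⬝ᵥ c)) (arcsinePi n) := by
  have hm : Measurable fun c : Fin n → ℝ => arcsinSlope (ζ ⬝ᵥ c) :=
    measurable_arcsinSlope.comp (continuous_dotProduct_left ζ).measurable
  refine ⟨hm.aestronglyMeasurable, ?_⟩
  have h1 := lintegral_arcsinQuot_rpow_le ζ ζ
  simp only [arcsinQuot_self] at h1
  have h2 : ∫⁻ c, ‖arcsinSlope (ζ ⬝ᵥ c)‖ₑ ^ (3 / 2 : ℝ) ∂arcsinePi n < ⊤ :=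
    h1.trans_lt (lt_top_iff_ne_top.2 (ENNReal.mul_ne_top
      (ENNReal.rpow_ne_top_of_nonneg (by norm_num) ENNReal.ofReal_ne_top) h))
  calc ∫⁻ c, ‖arcsinSlope (ζ ⬝ᵥ c)‖ₑ ∂arcsinePi n
      ≤ ∫⁻ c, (1 + ‖arcsinSlope (ζ ⬝ᵥ c)‖ₑ ^ (3 / 2 : ℝ)) ∂arcsinePi n := by
        refine lintegral_mono fun c => ?_
        rcases le_total ‖arcsinSlope (ζ ⬝ᵥ c)‖ₑ 1 with h | h
        · exact h.trans le_self_add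
        · refine le_trans ?_ le_add_self
          calc ‖arcsinSlope (ζ ⬝ᵥ c)‖ₑ = ‖arcsinSlope (ζ ⬝ᵥ c)‖ₑ ^ (1 : ℝ) := by simp
            _ ≤ _ := ENNReal.rpow_le_rpow_of_exponent_le h (by norm_num)
    _ < ⊤ := by
        rw [lintegral_add_left measurable_const]
        simp [h2]

theorem integrable_arcsinQuot_mul {n : ℕ} (ζ ζ' : Fin n → ℝ) (j : Fin n) :
    Integrable (fun c => arcsinQuot (ζ ⬝ᵥ c) (ζ' ⬝ᵥ c) * ((ζ' - ζ) ⬝ᵥ c) * c j)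
      (arcsinePi n) := by
  have m1 := (continuous_dotProduct_left ζ).measurable
  have m2 := (continuous_dotProduct_left ζ').measurable
  have : ∀ c : Fin n → ℝ, arcsinQuot (ζ ⬝ᵥ c) (ζ' ⬝ᵥ c) * ((ζ' - ζ) ⬝ᵥ c) * c j =
      (Real.arcsin (ζ' ⬝ᵥ c) - Real.arcsin (ζ ⬝ᵥ c)) * c j := fun c => by
    rw [sub_dotProduct, arcsinQuot_mul]
  simp_rw [this]
  refine integrable_of_ae_abs_le (((Real.continuous_arcsin.measurable.comp m2).sub
    (Real.continuous_arcsin.measurable.comp m1)).mul (measurable_pi_apply j)) Real.pi fun c hc => ?_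
  rw [abs_mul]
  refine (mul_le_of_le_one_right (abs_nonneg _) (hc j)).trans ((abs_sub _ _).trans ?_)
  linarith [abs_arcsin_le (ζ ⬝ᵥ c), abs_arcsin_le (ζ' ⬝ᵥ c)]

theorem integrable_arcsinSlope_mul {n : ℕ} {ζ : Fin n → ℝ} (h : singularMoment ζ ≠ ⊤)
    {F : (Fin n → ℝ) → ℝ} (hF : Measurable F) (C : ℝ)
    (hb : ∀ c : Fin n → ℝ, (∀ i, |c i| ≤ 1) → |F c| ≤ C) :
    Integrable (fun c => arcsinSlope (ζ ⬝ᵥ c) * F c) (arcsinePi n) := by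
  refine (integrable_arcsinSlope_dotProduct h).mul_bdd (c := C) hF.aestronglyMeasurable ?_
  filter_upwards [ae_arcsinePi_abs_le n] with c hc
  rw [Real.norm_eq_abs]; exact hb c hc

/-- The derivative of `chartGrad`. -/
def chartHess {n : ℕ} (ζ : Fin n → ℝ) : (Fin n → ℝ) →L[ℝ] (Fin n → ℝ) :=
  ContinuousLinearMap.pi fun j =>
    dotCLM fun l => 2 / Real.pi * ∫ c, arcsinSlope (ζ ⬝ᵥ c) * (c l * c j) ∂arcsinePi n

theorem abs_mul_le_one {a b : ℝ} (ha : |a| ≤ 1) (hb : |b| ≤ 1) : |a * b| ≤ 1 := by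
  rw [abs_mul]; exact mul_le_one₀ ha (abs_nonneg _) hb

theorem chartHess_apply {n : ℕ} {ζ : Fin n → ℝ} (h : singularMoment ζ ≠ ⊤) (q : Fin n → ℝ)
    (j : Fin n) : chartHess ζ q j =
      2 / Real.pi * ∫ c, arcsinSlope (ζ ⬝ᵥ c) * ((q ⬝ᵥ c) * c j) ∂arcsinePi n := by
  have hs : ∀ c : Fin n → ℝ, arcsinSlope (ζ ⬝ᵥ c) * ((q ⬝ᵥ c) * c j) =
      ∑ l, q l * (arcsinSlope (ζ ⬝ᵥ c) * (c l * c j)) := fun c => by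
    simp only [dotProduct, Finset.sum_mul, Finset.mul_sum]
    exact Finset.sum_congr rfl fun l _ => by ring
  simp_rw [hs]
  rw [integral_finsetSum]
  · simp only [chartHess, ContinuousLinearMap.pi_apply, dotCLM_apply, dotProduct,
      integral_const_mul, Finset.mul_sum]
    exact Finset.sum_congr rfl fun l _ => by ring
  · intro l _
    exact (integrable_arcsinSlope_mul h (by fun_prop) 1
      fun c hc => abs_mul_le_one (hc l) (hc j)).const_mul _

theorem mul_dotProduct_eq_sum {n : ℕ} (x : ℝ) (q c : Fin n → ℝ) :
    x * (q ⬝ᵥ c) = ∑ i, q i * (x * c i) := by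
  simp only [dotProduct, Finset.mul_sum]
  exact Finset.sum_congr rfl fun i _ => by ring

/-- The error of the linearization is the mean of (difference quotient minus slope) times `(q · c)
c_j`. On the cube the last factor is at most `∑ |q i|`, so convergence of the quotients in mean
suffices. -/
theorem hasStrictFDerivAt_chartGrad {n : ℕ} {ζ₀ : Fin n → ℝ} {C : ℝ≥0∞} (hC : C ≠ ⊤)
    (h : ∀ᶠ ζ in 𝓝 ζ₀, singularMoment ζ ≤ C) :
    HasStrictFDerivAt chartGrad (chartHess ζ₀) ζ₀ := by
  have hpi := Real.pi_pos
  have h0 : singularMoment ζ₀ ≠ ⊤ := (h.self_of_nhds.trans_lt (lt_top_iff_ne_top.2 hC)).ne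
  rw [hasStrictFDerivAt_pi']
  intro j
  rw [hasStrictFDerivAt_iff_isLittleO, Asymptotics.isLittleO_iff]
  intro ε hε
  -- The factor `n` comes from `∑ |q i| ≤ n ‖q‖`; `n + 1` keeps the denominator nonzero when `n =
  -- 0`.
  set η : ℝ := ε / (2 / Real.pi * (n + 1)) with hη
  have hη0 : 0 < η := by positivity
  -- The pair is swapped because difference quotients list the base point first, increments list it
  -- second.
  have hT := (tendsto_lintegral_arcsinQuot_sub hC h).comp (continuous_swap.tendsto (ζ₀, ζ₀))
  have hE := (ENNReal.tendsto_nhds_zero.1 hT) (ENNReal.ofReal η) (by simpa using hη0)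
  filter_upwards [hE] with p hp
  simp only [Function.comp, Prod.swap] at hp
  obtain ⟨ζ', ζ⟩ := p
  simp only at hp ⊢
  set q := ζ' - ζ with hq
  have hqm := (continuous_dotProduct_left q).measurable
  have hi2 : Integrable (fun c => arcsinSlope (ζ₀ ⬝ᵥ c) * ((q ⬝ᵥ c) * c j)) (arcsinePi n) :=
    integrable_arcsinSlope_mul h0 (by fun_prop) (∑ i, |q i|) fun c hc => by
      rw [abs_mul]
      exact (mul_le_of_le_one_right (abs_nonneg _) (hc j)).trans (abs_dotProduct_le q hc)
  have e1 : chartGrad ζ' j - chartGrad ζ j -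
      ((ContinuousLinearMap.proj j).comp (chartHess ζ₀)) q = 2 / Real.pi *
      ∫ c, (arcsinQuot (ζ ⬝ᵥ c) (ζ' ⬝ᵥ c) - arcsinSlope (ζ₀ ⬝ᵥ c)) * ((q ⬝ᵥ c) * c j)
        ∂arcsinePi n := by
    rw [chartGrad_sub, ContinuousLinearMap.comp_apply, ContinuousLinearMap.proj_apply,
      chartHess_apply h0, ← mul_sub, ← integral_sub (integrable_arcsinQuot_mul ζ ζ' j) hi2]
    congr 2; ext c; ring
  have hs0 : 0 ≤ ∑ i, |q i| := Finset.sum_nonneg fun i _ => abs_nonneg _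
  have e2 : ‖∫ c, (arcsinQuot (ζ ⬝ᵥ c) (ζ' ⬝ᵥ c) - arcsinSlope (ζ₀ ⬝ᵥ c)) * ((q ⬝ᵥ c) * c j)
        ∂arcsinePi n‖ₑ ≤ ENNReal.ofReal (η * ∑ i, |q i|) := by
    refine (enorm_integral_le_lintegral_enorm _).trans ?_
    calc _ ≤ ∫⁻ c, ‖arcsinQuot (ζ ⬝ᵥ c) (ζ' ⬝ᵥ c) - arcsinSlope (ζ₀ ⬝ᵥ c)‖ₑ *
          ENNReal.ofReal (∑ i, |q i|) ∂arcsinePi n := by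
          refine lintegral_mono_ae ?_
          filter_upwards [ae_arcsinePi_abs_le n] with c hc
          rw [enorm_mul]
          gcongr
          rw [Real.enorm_eq_ofReal_abs, abs_mul]
          exact ENNReal.ofReal_le_ofReal
            ((mul_le_of_le_one_right (abs_nonneg _) (hc j)).trans (abs_dotProduct_le q hc))
      _ = _ := lintegral_mul_const' _ _ ENNReal.ofReal_ne_top
      _ ≤ ENNReal.ofReal η * ENNReal.ofReal (∑ i, |q i|) := by gcongr
      _ = _ := (ENNReal.ofReal_mul hη0.le).symm
  rw [Real.enorm_eq_ofReal_abs, ENNReal.ofReal_le_ofReal_iff (by positivity)] at e2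
  rw [e1, Real.norm_eq_abs, abs_mul, abs_of_pos (by positivity : 0 < 2 / Real.pi)]
  calc 2 / Real.pi * _ ≤ 2 / Real.pi * (η * (n * ‖q‖)) := by
        gcongr; exact e2.trans (by gcongr; exact sum_abs_le q)
    _ ≤ 2 / Real.pi * (η * ((n + 1) * ‖q‖)) := by gcongr; linarith
    _ = ε * ‖q‖ := by rw [hη]; field_simp

/-- The associated quadratic form is the mean of `slope * (q · c) ^ 2`. The slope is positive on the
neighbourhood `|ζ · c| < 1` of the origin, which has positive measure, while `q · c` vanishes only
on a null set. -/
theorem chartHess_injective {n : ℕ} {ζ : Fin n → ℝ} (h : singularMoment ζ ≠ ⊤) :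
    Function.Injective (chartHess ζ) := by
  refine (injective_iff_map_eq_zero _).2 fun q hq => ?_
  by_contra hne
  have hqm := (continuous_dotProduct_left q).measurable
  have hbd : ∀ c : Fin n → ℝ, (∀ i, |c i| ≤ 1) → |(q ⬝ᵥ c) ^ 2| ≤ (∑ i, |q i|) ^ 2 := by
    intro c hc
    rw [abs_pow]
    gcongr
    exact abs_dotProduct_le q hc
  have hint : Integrable (fun c => arcsinSlope (ζ ⬝ᵥ c) * (q ⬝ᵥ c) ^ 2) (arcsinePi n) :=
    integrable_arcsinSlope_mul h (by fun_prop) _ hbd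
  have h1 : ∫ c, arcsinSlope (ζ ⬝ᵥ c) * (q ⬝ᵥ c) ^ 2 ∂arcsinePi n = 0 := by
    have hs : ∀ c : Fin n → ℝ, arcsinSlope (ζ ⬝ᵥ c) * (q ⬝ᵥ c) ^ 2 =
        ∑ j, q j * (arcsinSlope (ζ ⬝ᵥ c) * ((q ⬝ᵥ c) * c j)) := fun c => by
      rw [sq, ← mul_assoc, mul_dotProduct_eq_sum]
      exact Finset.sum_congr rfl fun l _ => by ring
    simp_rw [hs]
    rw [integral_finsetSum]
    · refine Finset.sum_eq_zero fun j _ => ?_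
      rw [integral_const_mul]
      have := chartHess_apply h q j
      rw [hq, Pi.zero_apply, eq_comm, mul_eq_zero] at this
      rw [this.resolve_left (by have := Real.pi_pos; positivity), mul_zero]
    · intro j _
      refine (integrable_arcsinSlope_mul h (by fun_prop) (∑ i, |q i|) fun c hc => ?_).const_mul _
      rw [abs_mul]
      exact (mul_le_of_le_one_right (abs_nonneg _) (hc j)).trans (abs_dotProduct_le q hc)
  rw [integral_eq_zero_iff_of_nonneg (fun c => mul_nonneg (arcsinSlope_nonneg _) (sq_nonneg _))
    hint] at h1
  have ho : IsOpen {c : Fin n → ℝ | |ζ ⬝ᵥ c| < 1} :=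
    isOpen_lt (continuous_dotProduct_left ζ).abs continuous_const
  refine arcsinePi_pos_of_isOpen ho (c := 0) (by simp) (by simp) ?_
  rw [← nonpos_iff_eq_zero]
  have h2 : ∀ᵐ c ∂arcsinePi n, ¬ |ζ ⬝ᵥ c| < 1 := by
    filter_upwards [h1, ae_dotProduct_ne hne 0] with c h1 h2 h3
    have h4 : 0 < arcsinSlope (ζ ⬝ᵥ c) := by
      unfold arcsinSlope
      have := (sq_lt_one_iff_abs_lt_one _).2 h3
      have := Real.sqrt_pos.2 (by linarith : 0 < 1 - (ζ ⬝ᵥ c) ^ 2)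
      positivity
    simp only [Pi.zero_apply, mul_eq_zero] at h1
    rcases h1 with h1 | h1
    · exact h4.ne' h1
    · exact h2 (pow_eq_zero_iff two_ne_zero |>.1 h1)
  simpa [ae_iff] using h2

/-! ### Expansion of `chartGrad` at the signed unit vectors -/

/-- Averaging over the flip of `c l` removes the cross terms: with `u = q · c` and `v = q l * c l`,
one has `u² + (u - 2v)² = 2v² + 2(u - v)²`. -/
theorem sq_mul_integral_le {n : ℕ} {g : (Fin n → ℝ) → ℝ} (hg : Measurable g) {K : ℝ}
    (hg0 : ∀ c, 0 ≤ g c) (hgK : ∀ c, g c ≤ K) (l : Fin n)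
    (hsym : ∀ c, g (fun i => (if i = l then -1 else 1) * c i) = g c) (q : Fin n → ℝ) :
    q l ^ 2 * ∫ c, g c * c l ^ 2 ∂arcsinePi n ≤ ∫ c, g c * (q ⬝ᵥ c) ^ 2 ∂arcsinePi n := by
  set σ : Fin n → ℝ := fun i => if i = l then -1 else 1 with hσ
  have mp := measurePreserving_signs σ (fun i => by simp only [hσ]; split_ifs <;> simp)
  have hint : ∀ v : Fin n → ℝ, Integrable (fun c => g c * (v ⬝ᵥ c) ^ 2) (arcsinePi n) := by
    intro v
    have := (continuous_dotProduct_left v).measurable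
    refine integrable_of_ae_abs_le (by fun_prop) (K * (∑ i, |v i|) ^ 2) fun c hc => ?_
    rw [abs_mul, abs_of_nonneg (hg0 c), abs_pow]
    have := hgK c
    have := hg0 c
    gcongr
    · linarith
    · exact abs_dotProduct_le v hc
  have hl : ∀ c : Fin n → ℝ, g c * c l ^ 2 = g c * (Pi.single l 1 ⬝ᵥ c) ^ 2 := fun c => by simp
  have hflip : ∫ c, g c * ((fun i => σ i * q i) ⬝ᵥ c) ^ 2 ∂arcsinePi n =
      ∫ c, g c * (q ⬝ᵥ c) ^ 2 ∂arcsinePi n := by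
    conv_rhs => rw [← mp.map_eq]
    rw [integral_map mp.measurable.aemeasurable]
    · congr 1; ext c
      rw [hsym]
      congr 2
      simp only [dotProduct]
      exact Finset.sum_congr rfl fun i _ => by ring
    · rw [mp.map_eq]; exact (hint q).1
  have hsplit : ∀ c : Fin n → ℝ, (fun i => σ i * q i) ⬝ᵥ c = q ⬝ᵥ c - 2 * (q l * c l) := by
    intro c
    have : (fun i => σ i * q i) = q - Pi.single l (2 * q l) := by
      ext i
      by_cases hi : i = l
      · subst hi; simp [hσ]; ring
      · simp [hσ, hi]
    rw [this, sub_dotProduct, single_dotProduct]; ring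
  have h1 : 2 * (q l ^ 2 * ∫ c, g c * c l ^ 2 ∂arcsinePi n) ≤
      ∫ c, g c * (q ⬝ᵥ c) ^ 2 ∂arcsinePi n +
      ∫ c, g c * ((fun i => σ i * q i) ⬝ᵥ c) ^ 2 ∂arcsinePi n := by
    rw [← integral_add (hint _) (hint _), ← integral_const_mul, ← integral_const_mul]
    refine integral_mono ?_ ((hint _).add (hint _)) fun c => ?_
    · simp_rw [hl]
      exact ((hint _).const_mul _).const_mul _
    · simp only
      rw [hsplit]
      have := mul_nonneg (hg0 c) (sq_nonneg (q ⬝ᵥ c - q l * c l))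
      nlinarith
  linarith

theorem lintegral_arcsinSlope_eval_mul_sq {n : ℕ} (j l : Fin n) :
    ∫⁻ c, ENNReal.ofReal (arcsinSlope (c j) * c l ^ 2) ∂arcsinePi n = ⊤ := by
  have hm1 : Measurable fun c : Fin n → ℝ => arcsinSlope (c j) :=
    measurable_arcsinSlope.comp (measurable_pi_apply j)
  rw [lintegral_resample j (by fun_prop)]
  have h : ∀ᵐ c ∂arcsinePi n, ∫⁻ x, ENNReal.ofReal (arcsinSlope (Function.update c j x j) *
      Function.update c j x l ^ 2) ∂arcsineLaw = ⊤ := by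
    have hne : (Pi.single l (1 : ℝ) : Fin n → ℝ) ≠ 0 := by simp
    filter_upwards [ae_dotProduct_ne hne 0] with c hc
    by_cases hjl : l = j
    · subst hjl
      simpa using lintegral_arcsinSlope_mul_sq
    · simp only [Function.update_self, Function.update_of_ne hjl]
      simp only [single_dotProduct, one_mul] at hc
      have h1 : ∫⁻ x, ENNReal.ofReal (arcsinSlope x) ∂arcsineLaw = ⊤ := by
        rw [eq_top_iff, ← lintegral_arcsinSlope_mul_sq]
        refine lintegral_mono_ae ?_
        filter_upwards [ae_arcsineLaw_abs_le] with x hx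
        refine ENNReal.ofReal_le_ofReal (mul_le_of_le_one_right (arcsinSlope_nonneg _) ?_)
        exact (sq_le_one_iff_abs_le_one _).2 hx
      simp_rw [fun x => ENNReal.ofReal_mul (q := c l ^ 2) (arcsinSlope_nonneg x)]
      rw [lintegral_mul_const _ measurable_arcsinSlope.ennreal_ofReal, h1]
      exact ENNReal.top_mul (by simp only [ne_eq, ENNReal.ofReal_eq_zero, not_le]; positivity)
  rw [lintegral_congr_ae h]
  simp

/-- Monotone convergence towards the infinite integral, simultaneously for the finitely many `l`. -/
theorem exists_le_integral_min {n : ℕ} (j : Fin n) (M : ℝ) :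
    ∃ K : ℝ, 0 ≤ K ∧ ∀ l, M ≤ ∫ c, min (arcsinSlope (c j)) K * c l ^ 2 ∂arcsinePi n := by
  have hm1 : Measurable fun c : Fin n → ℝ => arcsinSlope (c j) :=
    measurable_arcsinSlope.comp (measurable_pi_apply j)
  have h : ∀ l : Fin n, ∀ᶠ k : ℕ in atTop,
      M ≤ ∫ c, min (arcsinSlope (c j)) k * c l ^ 2 ∂arcsinePi n := by
    intro l
    have ht := lintegral_tendsto_of_tendsto_of_monotone (μ := arcsinePi n)
      (f := fun (k : ℕ) (c : Fin n → ℝ) => ENNReal.ofReal (min (arcsinSlope (c j)) k * c l ^ 2))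
      (F := fun c => ENNReal.ofReal (arcsinSlope (c j) * c l ^ 2))
      (fun k => by fun_prop)
      (Eventually.of_forall fun c k k' hk => ENNReal.ofReal_le_ofReal (by
        have : (k : ℝ) ≤ k' := by exact_mod_cast hk
        gcongr))
      (Eventually.of_forall fun c => by
        refine ENNReal.tendsto_ofReal (Tendsto.mul ?_ tendsto_const_nhds)
        refine tendsto_const_nhds.congr' ?_
        filter_upwards [eventually_ge_atTop ⌈arcsinSlope (c j)⌉₊] with k hk
        exact (min_eq_left (Nat.ceil_le.1 hk)).symm)
    rw [lintegral_arcsinSlope_eval_mul_sq] at ht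
    have h1 := ht.eventually (lt_mem_nhds (ENNReal.ofReal_lt_top (r := M)))
    filter_upwards [h1] with k hk
    have hn : ∀ c : Fin n → ℝ, 0 ≤ min (arcsinSlope (c j)) (k : ℝ) :=
      fun c => le_min (arcsinSlope_nonneg _) (Nat.cast_nonneg k)
    have hi : Integrable (fun c : Fin n → ℝ => min (arcsinSlope (c j)) k * c l ^ 2)
        (arcsinePi n) := by
      refine integrable_of_ae_abs_le (by fun_prop) k fun c hc => ?_
      rw [abs_mul, abs_of_nonneg (hn c), abs_pow]
      exact (mul_le_of_le_one_right (hn c) (pow_le_one₀ (abs_nonneg _) (hc l))).trans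
        (min_le_right _ _)
    rw [← ofReal_integral_eq_lintegral_ofReal hi
      (Eventually.of_forall fun c => mul_nonneg (hn c) (sq_nonneg _))] at hk
    by_contra hlt
    push Not at hlt
    exact absurd (ENNReal.ofReal_le_ofReal hlt.le) (not_le.2 hk)
  obtain ⟨k, hk⟩ := (eventually_all.2 h).exists
  exact ⟨k, Nat.cast_nonneg k, hk⟩

theorem arcsinSlope_mul_of_abs_eq_one {a : ℝ} (ha : |a| = 1) (x : ℝ) :
    arcsinSlope (a * x) = arcsinSlope x := by
  have : a ^ 2 = 1 := by rw [← sq_abs, ha, one_pow]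
  unfold arcsinSlope
  rw [mul_pow, this, one_mul]

/-- At a signed unit vector `chartGrad` expands distances by an arbitrarily large factor. -/
theorem eventually_mul_norm_le_chartGrad_sub {n : ℕ} {a : ℝ} (ha : |a| = 1) (j : Fin n)
    (Λ : ℝ) :
    ∀ᶠ q : (Fin n → ℝ) × (Fin n → ℝ) in 𝓝 (Pi.single j a, Pi.single j a),
      Λ * ‖q.2 - q.1‖ ≤ ‖chartGrad q.2 - chartGrad q.1‖ := by
  have hpi := Real.pi_pos
  have hn : 0 < n := Fin.pos j
  have hn' : (0 : ℝ) < n := by exact_mod_cast hn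
  set ζ₀ : Fin n → ℝ := Pi.single j a with hζ₀
  -- The term `+ 1` pays for replacing the truncated slope by the true quotient; the factor `n` pays
  -- for passing from the pairing with `q` to the sup norm.
  obtain ⟨K, hK, hM⟩ := exists_le_integral_min j (Real.pi / 2 * (Λ * n) + 1)
  -- The tolerance `1 / n²` cancels the bound `(n ‖q‖)²` for `(q · c)²`.
  have htr := Metric.tendsto_nhds.1 (tendsto_integral_min_arcsinQuot ζ₀ hK) (1 / (n : ℝ) ^ 2)
    (by positivity)
  filter_upwards [htr] with p hp
  obtain ⟨ζ, ζ'⟩ := p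
  simp only at hp ⊢
  set q := ζ' - ζ with hq
  rw [Real.dist_eq, sub_zero, abs_of_nonneg (integral_nonneg fun _ => abs_nonneg _)] at hp
  have hqm := (continuous_dotProduct_left q).measurable
  have hDm := measurable_arcsinQuot ζ ζ'
  have hsl : ∀ c : Fin n → ℝ, arcsinSlope (ζ₀ ⬝ᵥ c) = arcsinSlope (c j) := fun c => by
    rw [hζ₀, single_dotProduct, arcsinSlope_mul_of_abs_eq_one ha]
  simp only [hsl] at hp
  have hm1 : Measurable fun c : Fin n → ℝ => arcsinSlope (c j) :=
    measurable_arcsinSlope.comp (measurable_pi_apply j)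
  set D : (Fin n → ℝ) → ℝ := fun c => arcsinQuot (ζ ⬝ᵥ c) (ζ' ⬝ᵥ c) with hD
  have hD0 : ∀ c, 0 ≤ D c := fun c => arcsinQuot_nonneg _ _
  set g : (Fin n → ℝ) → ℝ := fun c => min (arcsinSlope (c j)) K with hg
  have hg0 : ∀ c, 0 ≤ g c := fun c => le_min (arcsinSlope_nonneg _) hK
  have hgK : ∀ c, g c ≤ K := fun c => min_le_right _ _
  have hgm : Measurable g := by fun_prop
  set m : (Fin n → ℝ) → ℝ := fun c => min (D c) K with hm
  have hm0 : ∀ c, 0 ≤ m c := fun c => le_min (hD0 c) hK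
  have hmK : ∀ c, m c ≤ K := fun c => min_le_right _ _
  have hmm : Measurable m := hDm.min measurable_const
  have hq2 : ∀ c : Fin n → ℝ, (∀ i, |c i| ≤ 1) → (q ⬝ᵥ c) ^ 2 ≤ (n * ‖q‖) ^ 2 := fun c hc => by
    rw [← sq_abs]
    gcongr
    exact (abs_dotProduct_le q hc).trans (sum_abs_le q)
  have hbint : ∀ u : (Fin n → ℝ) → ℝ, Measurable u → (∀ c, 0 ≤ u c) → (∀ c, u c ≤ K) →
      Integrable (fun c => u c * (q ⬝ᵥ c) ^ 2) (arcsinePi n) := by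
    intro u hu hu0 huK
    refine integrable_of_ae_abs_le (by fun_prop) (K * (n * ‖q‖) ^ 2) fun c hc => ?_
    rw [abs_of_nonneg (mul_nonneg (hu0 c) (sq_nonneg _))]
    exact mul_le_mul (huK c) (hq2 c hc) (sq_nonneg _) hK
  have hgmint : Integrable (fun c => |m c - g c|) (arcsinePi n) := by
    refine integrable_of_ae_abs_le (hmm.sub hgm).abs K fun c _ => ?_
    rw [abs_abs, abs_le]
    constructor <;> linarith [hm0 c, hg0 c, hmK c, hgK c]
  -- Pairing the increment with `q` itself gives a nonnegative integrand, so truncation yields a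
  -- lower bound.
  have e1 : q ⬝ᵥ (chartGrad ζ' - chartGrad ζ) =
      2 / Real.pi * ∫ c, D c * (q ⬝ᵥ c) ^ 2 ∂arcsinePi n := by
    have hs : ∀ c : Fin n → ℝ, D c * (q ⬝ᵥ c) ^ 2 =
        ∑ i, q i * (D c * (q ⬝ᵥ c) * c i) := fun c => by
      rw [sq, ← mul_assoc, mul_dotProduct_eq_sum]
    simp_rw [hs]
    rw [integral_finsetSum _ fun i _ => (integrable_arcsinQuot_mul ζ ζ' i).const_mul _]
    change ∑ i, q i * (chartGrad ζ' i - chartGrad ζ i) = _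
    simp only [integral_const_mul, Finset.mul_sum]
    refine Finset.sum_congr rfl fun i _ => ?_
    rw [chartGrad_sub, mul_left_comm]
  have hDint : Integrable (fun c => D c * (q ⬝ᵥ c) ^ 2) (arcsinePi n) := by
    have : ∀ c : Fin n → ℝ, D c * (q ⬝ᵥ c) ^ 2 =
        (Real.arcsin (ζ' ⬝ᵥ c) - Real.arcsin (ζ ⬝ᵥ c)) * (q ⬝ᵥ c) := fun c => by
      rw [← arcsinQuot_mul, ← sub_dotProduct]; simp only [hD, hq]; ring
    simp_rw [this]
    have m1 := (continuous_dotProduct_left ζ).measurable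
    have m2 := (continuous_dotProduct_left ζ').measurable
    refine integrable_of_ae_abs_le (((Real.continuous_arcsin.measurable.comp m2).sub
      (Real.continuous_arcsin.measurable.comp m1)).mul hqm) (Real.pi * ∑ i, |q i|) fun c hc => ?_
    rw [abs_mul]
    gcongr
    · refine (abs_sub _ _).trans ?_
      linarith [abs_arcsin_le (ζ ⬝ᵥ c), abs_arcsin_le (ζ' ⬝ᵥ c)]
    · exact abs_dotProduct_le q hc
  obtain ⟨l, hl⟩ : ∃ l, ‖q‖ = |q l| := by
    have : Nonempty (Fin n) := ⟨j⟩
    obtain ⟨l, hl⟩ := Finite.exists_max fun i => ‖q i‖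
    exact ⟨l, le_antisymm ((pi_norm_le_iff_of_nonneg (norm_nonneg _)).2 hl) (norm_le_pi_norm q l)⟩
  have e2 : ‖q‖ ^ 2 * (Real.pi / 2 * (Λ * n) + 1) ≤ ∫ c, g c * (q ⬝ᵥ c) ^ 2 ∂arcsinePi n := by
    refine le_trans ?_ (sq_mul_integral_le hgm hg0 hgK l (fun c => ?_) q)
    · rw [hl, sq_abs]
      exact mul_le_mul_of_nonneg_left (hM l) (sq_nonneg _)
    · simp only [hg]
      rw [arcsinSlope_mul_of_abs_eq_one]
      split_ifs <;> simp
  have e3 : ∫ c, g c * (q ⬝ᵥ c) ^ 2 ∂arcsinePi n - ‖q‖ ^ 2 ≤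
      ∫ c, D c * (q ⬝ᵥ c) ^ 2 ∂arcsinePi n := by
    have a1 : ∫ c, g c * (q ⬝ᵥ c) ^ 2 ∂arcsinePi n - ∫ c, m c * (q ⬝ᵥ c) ^ 2 ∂arcsinePi n ≤
        ‖q‖ ^ 2 := by
      rw [← integral_sub (hbint g hgm hg0 hgK) (hbint m hmm hm0 hmK)]
      calc _ ≤ ∫ c, |m c - g c| * (n * ‖q‖) ^ 2 ∂arcsinePi n := by
            refine integral_mono_ae ((hbint g hgm hg0 hgK).sub (hbint m hmm hm0 hmK))
              (hgmint.mul_const _) ?_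
            filter_upwards [ae_arcsinePi_abs_le n] with c hc
            rw [← sub_mul]
            exact mul_le_mul ((le_abs_self _).trans (abs_sub_comm _ _).le) (hq2 c hc)
              (sq_nonneg _) (abs_nonneg _)
        _ = (∫ c, |m c - g c| ∂arcsinePi n) * (n * ‖q‖) ^ 2 := integral_mul_const _ _
        _ ≤ 1 / (n : ℝ) ^ 2 * (n * ‖q‖) ^ 2 := by gcongr
        _ = ‖q‖ ^ 2 := by field_simp
    have a2 : ∫ c, m c * (q ⬝ᵥ c) ^ 2 ∂arcsinePi n ≤ ∫ c, D c * (q ⬝ᵥ c) ^ 2 ∂arcsinePi n :=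
      integral_mono (hbint m hmm hm0 hmK) hDint fun c =>
        mul_le_mul_of_nonneg_right (min_le_left _ _) (sq_nonneg _)
    linarith
  have e4 : q ⬝ᵥ (chartGrad ζ' - chartGrad ζ) ≤ n * ‖q‖ * ‖chartGrad ζ' - chartGrad ζ‖ := by
    calc _ ≤ ∑ i, |q i| * ‖chartGrad ζ' - chartGrad ζ‖ := by
          refine Finset.sum_le_sum fun i _ => (le_abs_self _).trans ?_
          rw [abs_mul]
          gcongr
          exact norm_le_pi_norm (chartGrad ζ' - chartGrad ζ) i
      _ = (∑ i, |q i|) * ‖chartGrad ζ' - chartGrad ζ‖ := by rw [Finset.sum_mul]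
      _ ≤ _ := by gcongr; exact sum_abs_le q
  rcases eq_or_lt_of_le (norm_nonneg q) with h0 | h0
  · rw [← h0, mul_zero]; exact norm_nonneg _
  · have e5 : ‖q‖ ^ 2 * (Λ * n) ≤ n * ‖q‖ * ‖chartGrad ζ' - chartGrad ζ‖ := by
      refine le_trans ?_ e4
      rw [e1]
      calc ‖q‖ ^ 2 * (Λ * n) = 2 / Real.pi * (‖q‖ ^ 2 * (Real.pi / 2 * (Λ * n) + 1) - ‖q‖ ^ 2) := by
            field_simp; ring
        _ ≤ _ := by gcongr; linarith
    have e6 : (n * ‖q‖) * (Λ * ‖q‖) ≤ (n * ‖q‖) * ‖chartGrad ζ' - chartGrad ζ‖ := by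
      linarith
    exact le_of_mul_le_mul_left e6 (by positivity)

/-! ### Strict differentiability of the gradient of the dual norm -/

theorem unit_cube_cases {n : ℕ} {ζ : Fin n → ℝ} (h : ∀ j, |ζ j| ≤ 1) :
    (∑ i, |ζ i| < 1 ∨ ∃ j l, j ≠ l ∧ ζ j ≠ 0 ∧ ζ l ≠ 0) ∨
      ∃ j, |ζ j| = 1 ∧ ζ = Pi.single j (ζ j) := by
  by_contra hcon
  push Not at hcon
  obtain ⟨⟨h1, h2⟩, h3⟩ := hcon
  obtain ⟨j, -, hj⟩ : ∃ j ∈ Finset.univ, |ζ j| ≠ 0 :=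
    Finset.exists_ne_zero_of_sum_ne_zero (by linarith)
  have hj' : ζ j ≠ 0 := by simpa using hj
  have hs : ζ = Pi.single j (ζ j) := by
    ext l
    by_cases hl : l = j
    · subst hl; simp
    · rw [Pi.single_eq_of_ne hl]
      exact h2 j l (Ne.symm hl) hj'
  refine h3 j (le_antisymm (h j) ?_) hs
  have : ∑ i, |ζ i| = |ζ j| := by
    refine Finset.sum_eq_single j (fun l _ hl => ?_) (fun h => absurd (Finset.mem_univ j) h)
    rw [h2 j l (Ne.symm hl) hj', abs_zero]
  linarith

/-- `ζ` is a continuous local solution of `chartGrad ζ = u`. Away from the signed unit vectors the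
inverse function theorem differentiates it; at a signed unit vector the unbounded expansion forces
derivative zero. -/
theorem exists_hasStrictFDerivAt_of_chartGrad_comp {n : ℕ} {E : Type*} [NormedAddCommGroup E]
    [NormedSpace ℝ E] {ζ u : E → Fin n → ℝ} {w₀ : E} (hζ : ContinuousAt ζ w₀)
    {u' : E →L[ℝ] Fin n → ℝ} (hu : HasStrictFDerivAt u u' w₀)
    (heq : ∀ᶠ w in 𝓝 w₀, chartGrad (ζ w) = u w) (hle : ∀ j, |ζ w₀ j| ≤ 1) :
    ∃ L : E →L[ℝ] Fin n → ℝ, HasStrictFDerivAt ζ L w₀ := by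
  rcases unit_cube_cases hle with h | ⟨j, hj, hsingle⟩
  · obtain ⟨C, hC, hb⟩ := eventually_singularMoment_le h
    have h0 : singularMoment (ζ w₀) ≠ ⊤ :=
      (hb.self_of_nhds.trans_lt (lt_top_iff_ne_top.2 hC)).ne
    set e : (Fin n → ℝ) ≃L[ℝ] (Fin n → ℝ) := (LinearEquiv.ofInjectiveEndo
      (chartHess (ζ w₀) : (Fin n → ℝ) →ₗ[ℝ] (Fin n → ℝ))
      (chartHess_injective h0)).toContinuousLinearEquiv with he
    have hd : HasStrictFDerivAt chartGrad (e : (Fin n → ℝ) →L[ℝ] (Fin n → ℝ)) (ζ w₀) := by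
      have : (e : (Fin n → ℝ) →L[ℝ] (Fin n → ℝ)) = chartHess (ζ w₀) := by ext x; rfl
      rw [this]
      exact hasStrictFDerivAt_chartGrad hC hb
    have hinv := hd.to_localInverse
    rw [heq.self_of_nhds] at hinv
    refine ⟨_, (hinv.comp w₀ hu).congr_of_eventuallyEq ?_⟩
    filter_upwards [heq, hζ.eventually hd.eventually_left_inverse] with w h1 h2
    rw [← h1, h2]
  · refine ⟨0, ?_⟩
    rw [hasStrictFDerivAt_iff_isLittleO, Asymptotics.isLittleO_iff]
    intro ε hε
    obtain ⟨K, hK, hb⟩ := hu.isBigO_sub.exists_pos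
    -- Since `u` is Lipschitz with constant `K` near `w₀`, expansion by `K / ε` makes `ζ` Lipschitz
    -- with constant `ε`.
    have hex := eventually_mul_norm_le_chartGrad_sub hj j (K / ε)
    rw [← hsingle] at hex
    have hζ2 : Tendsto (fun p : E × E => (ζ p.2, ζ p.1)) (𝓝 (w₀, w₀)) (𝓝 (ζ w₀, ζ w₀)) :=
      (hζ.tendsto.comp (continuousAt_snd (p := (w₀, w₀)))).prodMk_nhds
        (hζ.tendsto.comp (continuousAt_fst (p := (w₀, w₀))))
    have heq1 : ∀ᶠ p : E × E in 𝓝 (w₀, w₀), chartGrad (ζ p.1) = u p.1 :=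
      heq.filter_mono (continuousAt_fst (p := (w₀, w₀)))
    have heq2 : ∀ᶠ p : E × E in 𝓝 (w₀, w₀), chartGrad (ζ p.2) = u p.2 :=
      heq.filter_mono (continuousAt_snd (p := (w₀, w₀)))
    filter_upwards [hb.bound, hζ2.eventually hex, heq1, heq2] with p h1 h2 h3 h4
    rw [h3, h4] at h2
    simp only [_root_.zero_apply, sub_zero]
    have h5 := h2.trans h1
    rw [div_mul_eq_mul_div, div_le_iff₀ hε] at h5
    have h6 : K * ‖ζ p.1 - ζ p.2‖ ≤ K * (ε * ‖p.1 - p.2‖) := by linarith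
    exact le_of_mul_le_mul_left h6 hK

theorem exists_hasStrictFDerivAt_dualGrad {n : ℕ} {w₀ : Fin n → ℝ} (hw₀ : w₀ ≠ 0) :
    ∃ L : (Fin n → ℝ) →L[ℝ] (Fin n → ℝ), HasStrictFDerivAt dualGrad L w₀ := by
  obtain _ | n := n
  · exact absurd (Subsingleton.elim w₀ 0) hw₀
  -- Normalizing the largest coordinate puts `ζ w₀` in the unit cube, where the case distinction is
  -- exhaustive.
  obtain ⟨i, hi⟩ := Finite.exists_max fun i => |dualGrad w₀ i|
  have hi0 : dualGrad w₀ i ≠ 0 := fun h0 => dualGrad_ne_zero hw₀ (by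
    ext k
    have := hi k
    rw [h0, abs_zero] at this
    exact abs_nonpos_iff.1 this)
  have hgc := continuousAt_dualGrad hw₀
  have hgi : ContinuousAt (fun w => dualGrad w i) w₀ := (continuous_apply i).continuousAt.comp hgc
  set ζ : (Fin (n + 1) → ℝ) → Fin n → ℝ :=
    fun w k => dualGrad w (i.succAbove k) / |dualGrad w i| with hζ
  set u : (Fin (n + 1) → ℝ) → Fin n → ℝ := fun w k => w (i.succAbove k) / dualNorm w with hu
  have hζc : ContinuousAt ζ w₀ := by
    rw [continuousAt_pi]
    intro k
    exact ((continuous_apply _).continuousAt.comp hgc).div hgi.abs (abs_ne_zero.2 hi0)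
  have hud : ∃ u' : (Fin (n + 1) → ℝ) →L[ℝ] (Fin n → ℝ), HasStrictFDerivAt u u' w₀ := by
    have hk : ∀ k, ∃ u'k : (Fin (n + 1) → ℝ) →L[ℝ] ℝ,
        HasStrictFDerivAt (fun w => w (i.succAbove k) / dualNorm w) u'k w₀ := fun k =>
      ⟨_, (hasStrictFDerivAt_apply (i.succAbove k) w₀).mul
        ((hasStrictDerivAt_inv (dualNorm_pos hw₀).ne').comp_hasStrictFDerivAt w₀
          (hasStrictFDerivAt_dualNorm hw₀))⟩
    choose u' hu' using hk
    exact ⟨ContinuousLinearMap.pi u', hasStrictFDerivAt_pi.2 hu'⟩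
  obtain ⟨u', hu'⟩ := hud
  have hne : ∀ᶠ w in 𝓝 w₀, w ≠ 0 := isOpen_ne.mem_nhds hw₀
  have hine : ∀ᶠ w in 𝓝 w₀, dualGrad w i ≠ 0 := hgi.eventually_ne hi0
  have heq : ∀ᶠ w in 𝓝 w₀, chartGrad (ζ w) = u w := by
    filter_upwards [hne, hine] with w h1 h2
    ext k
    rw [← meanSign_succAbove i h2 k]
    have := congrFun (dualNorm_smul_meanSign_dualGrad h1) (i.succAbove k)
    rw [Pi.smul_apply, smul_eq_mul] at this
    rw [hu]
    simp only
    rw [eq_div_iff (dualNorm_pos h1).ne', mul_comm, this]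
  have hle : ∀ k, |ζ w₀ k| ≤ 1 := fun k => by
    rw [hζ]
    simp only
    rw [abs_div, abs_abs, div_le_one (abs_pos.2 hi0)]
    exact hi _
  obtain ⟨L, hL⟩ := exists_hasStrictFDerivAt_of_chartGrad_comp hζc hu' heq hle
  set ε := dualGrad w₀ i / |dualGrad w₀ i| with hε
  set t : (Fin (n + 1) → ℝ) → Fin (n + 1) → ℝ := fun w => i.insertNth ε (ζ w) with ht
  have htd : ∃ t' : (Fin (n + 1) → ℝ) →L[ℝ] (Fin (n + 1) → ℝ), HasStrictFDerivAt t t' w₀ := by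
    have hk : ∀ k, ∃ t'k : (Fin (n + 1) → ℝ) →L[ℝ] ℝ,
        HasStrictFDerivAt (fun w => t w k) t'k w₀ := by
      refine (Fin.forall_iff_succAbove i).2 ⟨⟨0, ?_⟩, fun k => ?_⟩
      · simp only [ht, Fin.insertNth_apply_same]
        exact hasStrictFDerivAt_const _ _
      · simp only [ht, Fin.insertNth_apply_succAbove]
        exact ⟨_, hasStrictFDerivAt_pi'.1 hL k⟩
    choose t' ht' using hk
    exact ⟨ContinuousLinearMap.pi t', hasStrictFDerivAt_pi.2 ht'⟩
  obtain ⟨t', ht'⟩ := htd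
  have hsign : ∀ᶠ w in 𝓝 w₀, dualGrad w i = |dualGrad w i| * ε := by
    rcases lt_or_gt_of_ne hi0 with h | h
    · filter_upwards [hgi.eventually (Iio_mem_nhds h)] with w hw
      rw [hε, abs_of_neg h, abs_of_neg hw, div_neg, div_self hi0]; ring
    · filter_upwards [hgi.eventually (Ioi_mem_nhds h)] with w hw
      rw [hε, abs_of_pos h, abs_of_pos hw, div_self hi0]; ring
  have hgt : ∀ᶠ w in 𝓝 w₀, dualGrad w = |dualGrad w i| • t w := by
    filter_upwards [hsign, hine] with w h1 h2
    ext k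
    revert k
    refine (Fin.forall_iff_succAbove i).2 ⟨?_, fun k => ?_⟩
    · simp only [ht, Pi.smul_apply, Fin.insertNth_apply_same, smul_eq_mul]
      exact h1
    · simp only [ht, Pi.smul_apply, Fin.insertNth_apply_succAbove, smul_eq_mul, hζ]
      rw [mul_div_cancel₀ _ (abs_ne_zero.2 h2)]
  -- The scale lost in the chart is recovered from `meanAbs (dualGrad w) = 1`.
  have hfin : ∀ᶠ w in 𝓝 w₀, (meanAbs (t w))⁻¹ • t w = dualGrad w := by
    filter_upwards [hgt, hne, hine] with w h1 h2 h3
    have h4 := meanAbs_dualGrad h2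
    rw [h1, meanAbs_smul, abs_abs] at h4
    conv_rhs => rw [h1]
    rw [eq_inv_of_mul_eq_one_left h4]
  have ht0 : t w₀ ≠ 0 := fun h => by
    have := hgt.self_of_nhds
    rw [h, smul_zero] at this
    exact dualGrad_ne_zero hw₀ this
  have hinv := (hasStrictDerivAt_inv (meanAbs_pos ht0).ne').comp_hasStrictFDerivAt w₀
    ((hasStrictFDerivAt_meanAbs ht0).comp w₀ ht')
  exact ⟨_, (hinv.smul ht').congr_of_eventuallyEq hfin⟩

/-! ### Lifting functions of the amplitudes to phase space -/

/-- The weighted radii `(y_i ^ 2 + a_i x_i ^ 2) ^ (1 / 2)`. -/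
def radius {N : ℕ} (a : Fin N → ℝ) (x : Space N) : Fin N → ℝ :=
  fun i => √(x (1, i) ^ 2 + a i * x (0, i) ^ 2)

theorem amplitude_eq_radius {N : ℕ} (ω : Fin N → ℝ) :
    amplitude ω = radius fun i => (ω i ^ 2)⁻¹ := rfl

/-- The derivative of the `i`-th weighted radius where it does not vanish, and `0` elsewhere. -/
def radiusDeriv {N : ℕ} (a : Fin N → ℝ) (x : Space N) (i : Fin N) : Space N →L[ℝ] ℝ :=
  (x (1, i) / radius a x i) • EuclideanSpace.proj (1, i) +
    (a i * x (0, i) / radius a x i) • EuclideanSpace.proj (0, i)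

theorem map_eq_sum_smul_single {N : ℕ} {F : Type*} [NormedAddCommGroup F] [NormedSpace ℝ F]
    (L : (Fin N → ℝ) →L[ℝ] F) (w : Fin N → ℝ) : L w = ∑ j, w j • L (Pi.single j 1) := by
  conv_lhs => rw [pi_eq_sum_univ' w]
  rw [map_sum]
  refine Finset.sum_congr rfl fun j _ => ?_
  rw [map_smul]

section Radius

variable {N : ℕ} {a : Fin N → ℝ}

theorem radius_nonneg (x : Space N) (i : Fin N) : 0 ≤ radius a x i := Real.sqrt_nonneg _

theorem radius_sq (ha : ∀ i, 0 < a i) (x : Space N) (i : Fin N) :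
    radius a x i ^ 2 = x (1, i) ^ 2 + a i * x (0, i) ^ 2 :=
  Real.sq_sqrt (by have := ha i; positivity)

theorem radius_eq_zero_iff (ha : ∀ i, 0 < a i) (x : Space N) (i : Fin N) :
    radius a x i = 0 ↔ x (1, i) = 0 ∧ x (0, i) = 0 := by
  have h := radius_sq ha x i
  have hai := ha i
  constructor
  · intro h0
    rw [h0] at h
    have h1 : x (1, i) ^ 2 = 0 := by nlinarith [sq_nonneg (x (1, i)), mul_nonneg hai.le (sq_nonneg (x (0, i)))]
    have h2 : a i * x (0, i) ^ 2 = 0 := by linarith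
    exact ⟨pow_eq_zero_iff two_ne_zero |>.1 h1,
      pow_eq_zero_iff two_ne_zero |>.1 ((mul_eq_zero.1 h2).resolve_left hai.ne')⟩
  · rintro ⟨h1, h2⟩
    rw [h1, h2] at h
    exact pow_eq_zero_iff two_ne_zero |>.1 (by simpa using h)

theorem radius_ne_zero (ha : ∀ i, 0 < a i) {x : Space N} (hx : x ≠ 0) : radius a x ≠ 0 := fun h => by
  refine hx ?_
  ext ⟨k, i⟩
  have := (radius_eq_zero_iff ha x i).1 (congrFun h i)
  fin_cases k
  · exact this.2
  · exact this.1

theorem radius_smul {t : ℝ} (ht : 0 ≤ t) (x : Space N) : radius a (t • x) = t • radius a x := by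
  ext i
  simp only [radius, PiLp.smul_apply, Pi.smul_apply, smul_eq_mul]
  rw [show (t * x (1, i)) ^ 2 + a i * (t * x (0, i)) ^ 2 =
    t ^ 2 * (x (1, i) ^ 2 + a i * x (0, i) ^ 2) by ring, Real.sqrt_mul (sq_nonneg _),
    Real.sqrt_sq ht]

/-- The `i`-th coordinates of a phase vector as one complex number, of modulus `radius`. -/
def radiusComplex (a : Fin N → ℝ) (i : Fin N) : Space N →L[ℝ] ℂ :=
  (EuclideanSpace.proj (1, i) : Space N →L[ℝ] ℝ).smulRight (1 : ℂ) +
    (√(a i) • (EuclideanSpace.proj (0, i) : Space N →L[ℝ] ℝ)).smulRight Complex.I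

theorem norm_radiusComplex (ha : ∀ i, 0 < a i) (i : Fin N) (x : Space N) :
    ‖radiusComplex a i x‖ = radius a x i := by
  have : radiusComplex a i x = ⟨x (1, i), √(a i) * x (0, i)⟩ := by
    apply Complex.ext <;> simp [radiusComplex]
  rw [this, Complex.norm_eq_sqrt_sq_add_sq, radius, mul_pow, Real.sq_sqrt (ha i).le]

theorem exists_norm_radius_sub_le (ha : ∀ i, 0 < a i) :
    ∃ C : ℝ, 0 < C ∧ ∀ x y : Space N, ‖radius a x - radius a y‖ ≤ C * ‖x - y‖ := by
  refine ⟨∑ i, ‖radiusComplex a i‖ + 1, by positivity, fun x y => ?_⟩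
  refine (pi_norm_le_iff_of_nonneg (by positivity)).2 fun i => ?_
  rw [Pi.sub_apply, ← norm_radiusComplex ha, ← norm_radiusComplex ha, Real.norm_eq_abs]
  refine (abs_norm_sub_norm_le _ _).trans ?_
  rw [← map_sub]
  refine ((radiusComplex a i).le_opNorm _).trans ?_
  gcongr
  have := Finset.single_le_sum (f := fun i => ‖radiusComplex a i‖) (fun i _ => norm_nonneg _)
    (Finset.mem_univ i)
  linarith

theorem exists_abs_coord_le_radius (ha : ∀ i, 0 < a i) (i : Fin N) :
    ∃ C : ℝ, 0 < C ∧ ∀ (k : Fin 2) (x : Space N), |x (k, i)| ≤ C * radius a x i := by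
  have hai := ha i
  have hs := Real.sqrt_pos.2 hai
  refine ⟨1 + (√(a i))⁻¹, by positivity, fun k x => ?_⟩
  have hr := radius_nonneg (a := a) x i
  have h1 : |x (1, i)| ≤ radius a x i := Real.abs_le_sqrt (by
    have := mul_nonneg hai.le (sq_nonneg (x (0, i))); linarith)
  have h0 : |x (0, i)| ≤ (√(a i))⁻¹ * radius a x i := by
    rw [inv_mul_eq_div, le_div_iff₀ hs]
    have : |√(a i) * x (0, i)| ≤ radius a x i := Real.abs_le_sqrt (by
      rw [mul_pow, Real.sq_sqrt hai.le]
      have := sq_nonneg (x (1, i)); linarith)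
    rwa [abs_mul, abs_of_pos hs, mul_comm] at this
  have h2 : 0 ≤ (√(a i))⁻¹ * radius a x i := by positivity
  fin_cases k
  · exact h0.trans (by rw [add_mul]; linarith)
  · exact h1.trans (by rw [add_mul]; linarith)

theorem continuous_radius : Continuous (radius a) := by
  unfold radius; fun_prop

theorem hasStrictFDerivAt_coord (k : Fin 2 × Fin N) (x : Space N) :
    HasStrictFDerivAt (fun x : Space N => x k) (EuclideanSpace.proj k : Space N →L[ℝ] ℝ) x :=
  (EuclideanSpace.proj k : Space N →L[ℝ] ℝ).hasStrictFDerivAt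

theorem hasStrictFDerivAt_radius (ha : ∀ i, 0 < a i) {x : Space N} {i : Fin N}
    (h : radius a x i ≠ 0) :
    HasStrictFDerivAt (fun x => radius a x i) (radiusDeriv a x i) x := by
  have h0 : x (1, i) ^ 2 + a i * x (0, i) ^ 2 ≠ 0 := by
    rw [← radius_sq ha]; exact pow_ne_zero 2 h
  have h1 := HasStrictFDerivAt.sqrt (((hasStrictFDerivAt_coord (1, i) x).pow 2).add
      (((hasStrictFDerivAt_coord (0, i) x).pow 2).const_mul (a i))) h0
  refine HasStrictFDerivAt.congr_fderiv h1 ?_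
  refine ContinuousLinearMap.ext fun v => ?_
  simp only [radiusDeriv, radius, _root_.add_apply, _root_.smul_apply, smul_eq_mul,
    nsmul_eq_mul]
  field_simp
  simp
  ring

theorem radiusDeriv_of_radius_eq_zero {x : Space N} {i : Fin N} (h : radius a x i = 0) :
    radiusDeriv a x i = 0 := by
  simp [radiusDeriv, h]

/-- Composition with the radii preserves strict differentiability as soon as the partial
derivatives in the vanishing radii are zero. -/
theorem hasStrictFDerivAt_comp_radius (ha : ∀ i, 0 < a i) {F : Type*} [NormedAddCommGroup F]
    [NormedSpace ℝ F] {f : (Fin N → ℝ) → F} {f' : (Fin N → ℝ) →L[ℝ] F} {x : Space N}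
    (hf : HasStrictFDerivAt f f' (radius a x))
    (h0 : ∀ j, radius a x j = 0 → f' (Pi.single j 1) = 0) :
    HasStrictFDerivAt (fun x => f (radius a x))
      (f' ∘L ContinuousLinearMap.pi (radiusDeriv a x)) x := by
  -- The radii that vanish at `x` are not differentiable there, so they are frozen at `0`. The
  -- derivative `f'` does not see the change, and the nonlinear remainder of `f` needs only that the
  -- radii are Lipschitz.
  set R : Space N → Fin N → ℝ := fun y j => if radius a x j = 0 then 0 else radius a y j with hR
  have hRd : HasStrictFDerivAt R (ContinuousLinearMap.pi (radiusDeriv a x)) x := by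
    refine hasStrictFDerivAt_pi.2 fun j => ?_
    by_cases hj : radius a x j = 0
    · simp only [hj, if_true, radiusDeriv_of_radius_eq_zero hj]
      exact hasStrictFDerivAt_const _ _
    · simp only [hj, if_false]
      exact hasStrictFDerivAt_radius ha hj
  have hR' : ∀ y, f' (radius a y) = f' (R y) := fun y => by
    rw [← sub_eq_zero, ← map_sub, map_eq_sum_smul_single]
    refine Finset.sum_eq_zero fun j _ => ?_
    by_cases hj : radius a x j = 0
    · rw [h0 j hj, smul_zero]
    · have : (radius a y - R y) j = 0 := by simp [hR, hj]
      rw [this, zero_smul]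
  have h1 : HasStrictFDerivAt (fun y => f (radius a y) - f' (radius a y))
      (0 : Space N →L[ℝ] F) x := by
    rw [hasStrictFDerivAt_iff_isLittleO]
    obtain ⟨C, hC, hb⟩ := exists_norm_radius_sub_le ha
    have hO : (fun p : Space N × Space N => radius a p.1 - radius a p.2) =O[𝓝 (x, x)]
        fun p => p.1 - p.2 :=
      Asymptotics.IsBigO.of_bound C (Eventually.of_forall fun p => hb p.1 p.2)
    have ht : Tendsto (fun p : Space N × Space N => (radius a p.1, radius a p.2)) (𝓝 (x, x))
        (𝓝 (radius a x, radius a x)) :=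
      ((continuous_radius.comp continuous_fst).prodMk
        (continuous_radius.comp continuous_snd)).tendsto (x, x)
    have := ((hasStrictFDerivAt_iff_isLittleO.1 hf).comp_tendsto ht).trans_isBigO hO
    refine this.congr_left fun p => ?_
    simp only [Function.comp, map_sub, _root_.zero_apply]
    abel
  have h2 := h1.add (f'.hasStrictFDerivAt.comp x hRd)
  rw [zero_add] at h2
  refine h2.congr_of_eventuallyEq (Eventually.of_forall fun y => ?_)
  simp [hR']

/-- The difference splits as `(A - B) (X / r) + B (X / r - Y / s)`. The factor `1 / s` in the
variation of the quotient is absorbed by `|B| ≤ ε s`, provided that `s` is the smaller radius. -/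
theorem abs_mul_div_sub_le {A B X Y r s ε C δ : ℝ} (hC : 0 ≤ C) (hs : 0 ≤ s) (hsr : s ≤ r)
    (hX : |X| ≤ C * r) (hY : |Y| ≤ C * s) (hAB : |A - B| ≤ δ) (hB : |B| ≤ ε * s) (hε : 0 ≤ ε) :
    |A * (X / r) - B * (Y / s)| ≤ C * δ + ε * (|X - Y| + C * |r - s|) := by
  have hr : 0 ≤ r := hs.trans hsr
  have hδ : 0 ≤ δ := (abs_nonneg _).trans hAB
  have hXr : |X / r| ≤ C := by
    rcases eq_or_lt_of_le hr with h | h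
    · rw [← h]; simpa using hC
    · rw [abs_div, abs_of_pos h, div_le_iff₀ h]; exact hX
  have h1 : |B * (X / r - Y / s)| ≤ ε * (|X - Y| + C * |r - s|) := by
    rcases eq_or_lt_of_le hs with h | h
    · rw [← h, mul_zero] at hB
      rw [abs_nonpos_iff.1 hB, zero_mul, abs_zero]; positivity
    have hr' : 0 < r := h.trans_le hsr
    have h2 : s * |X / r - Y / s| ≤ |X - Y| + C * |r - s| := by
      have e : s * |X / r - Y / s| = |(X - Y) * (s / r) + (Y / r) * (s - r)| := by
        rw [← abs_of_pos h, ← abs_mul, abs_of_pos h]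
        congr 1
        field_simp
        ring
      rw [e]
      refine (abs_add_le _ _).trans ?_
      rw [abs_mul, abs_mul, abs_sub_comm s r]
      gcongr
      · refine mul_le_of_le_one_right (abs_nonneg _) ?_
        rw [abs_of_nonneg (by positivity)]
        exact (div_le_one hr').2 hsr
      · rw [abs_div, abs_of_pos hr', div_le_iff₀ hr']
        exact hY.trans (by gcongr)
    rw [abs_mul]
    calc |B| * |X / r - Y / s| ≤ ε * s * |X / r - Y / s| := by gcongr
      _ = ε * (s * |X / r - Y / s|) := by ring
      _ ≤ _ := by gcongr
  calc |A * (X / r) - B * (Y / s)| = |(A - B) * (X / r) + B * (X / r - Y / s)| := by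
        congr 1; ring
    _ ≤ |A - B| * |X / r| + |B * (X / r - Y / s)| := by
        rw [← abs_mul]; exact abs_add_le _ _
    _ ≤ δ * C + ε * (|X - Y| + C * |r - s|) := by gcongr
    _ = _ := by ring

/-- If `g` is strictly differentiable and odd in the `i`-th variable, then `g (radius) x_{k,i} / radius_i`
is strictly differentiable where the `i`-th radius vanishes. -/
theorem hasStrictFDerivAt_mul_coord_div_radius (ha : ∀ i, 0 < a i) {g : (Fin N → ℝ) → ℝ}
    {L : (Fin N → ℝ) →L[ℝ] ℝ} {x : Space N} {i : Fin N} (hg : HasStrictFDerivAt g L (radius a x))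
    (hi : radius a x i = 0) (hL : ∀ j, j ≠ i → L (Pi.single j 1) = 0)
    (hg0 : ∀ w : Fin N → ℝ, w i = 0 → g w = 0) (k : Fin 2) :
    HasStrictFDerivAt (fun y => g (radius a y) * (y (k, i) / radius a y i))
      (L (Pi.single i 1) • (EuclideanSpace.proj (k, i) : Space N →L[ℝ] ℝ)) x := by
  set l := L (Pi.single i 1) with hl
  obtain ⟨C₁, hC₁, hC₁b⟩ := exists_norm_radius_sub_le ha
  obtain ⟨C, hC, hCb⟩ := exists_abs_coord_le_radius ha i
  have hLw : ∀ w, L w = l * w i := fun w => by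
    rw [map_eq_sum_smul_single, Finset.sum_eq_single i]
    · rw [smul_eq_mul, mul_comm]
    · intro j _ hj
      rw [hL j hj, smul_zero]
    · exact fun h => absurd (Finset.mem_univ i) h
  set u : (Fin N → ℝ) → ℝ := fun w => g w - L w with hu
  have hud : HasStrictFDerivAt u (0 : (Fin N → ℝ) →L[ℝ] ℝ) (radius a x) := by
    have := hg.sub L.hasStrictFDerivAt
    rwa [sub_self] at this
  have hu0 : ∀ w : Fin N → ℝ, w i = 0 → u w = 0 := fun w hw => by
    simp only [hu]; rw [hg0 w hw, hLw, hw]; simp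
  have key : HasStrictFDerivAt (fun y => u (radius a y) * (y (k, i) / radius a y i))
      (0 : Space N →L[ℝ] ℝ) x := by
    rw [hasStrictFDerivAt_iff_isLittleO, Asymptotics.isLittleO_iff]
    intro ε hε
    set η := ε / (C * C₁ + (1 + C * C₁)) with hη
    have hη0 : 0 < η := by positivity
    have h1 := (hasStrictFDerivAt_iff_isLittleO.1 hud).def hη0
    simp only [_root_.zero_apply, sub_zero] at h1
    have hupd : Tendsto (fun w : Fin N → ℝ => (w, Function.update w i 0)) (𝓝 (radius a x))
        (𝓝 (radius a x, radius a x)) := by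
      have : Continuous fun w : Fin N → ℝ => (w, Function.update w i (0 : ℝ)) := by fun_prop
      have ht := this.tendsto (radius a x)
      have e : Function.update (radius a x) i 0 = radius a x := by
        rw [← hi]; exact Function.update_eq_self i _
      rwa [e] at ht
    have h2 : ∀ᶠ w in 𝓝 (radius a x), |u w| ≤ η * |w i| := by
      filter_upwards [hupd.eventually h1] with w hw
      rw [hu0 (Function.update w i 0) (by simp), sub_zero] at hw
      have e : w - Function.update w i 0 = Pi.single i (w i) := by
        ext j
        by_cases hj : j = i
        · subst hj; simp
        · simp [hj]
      rwa [e, Pi.norm_single] at hw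
    have ht : Tendsto (fun p : Space N × Space N => (radius a p.1, radius a p.2)) (𝓝 (x, x))
        (𝓝 (radius a x, radius a x)) :=
      ((continuous_radius.comp continuous_fst).prodMk
        (continuous_radius.comp continuous_snd)).tendsto (x, x)
    have h2' : ∀ᶠ y in 𝓝 x, |u (radius a y)| ≤ η * |radius a y i| :=
      continuous_radius.continuousAt.eventually h2
    have h21 : ∀ᶠ p : Space N × Space N in 𝓝 (x, x), |u (radius a p.1)| ≤ η * |radius a p.1 i| :=
      h2'.filter_mono (continuousAt_fst (p := (x, x)))
    have h22 : ∀ᶠ p : Space N × Space N in 𝓝 (x, x), |u (radius a p.2)| ≤ η * |radius a p.2 i| :=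
      h2'.filter_mono (continuousAt_snd (p := (x, x)))
    have ord : ∀ p q : Space N, ‖u (radius a p) - u (radius a q)‖ ≤ η * ‖radius a p - radius a q‖ →
        |u (radius a q)| ≤ η * |radius a q i| → radius a q i ≤ radius a p i →
        |u (radius a p) * (p (k, i) / radius a p i) - u (radius a q) * (q (k, i) / radius a q i)| ≤
          ε * ‖p - q‖ := by
      intro p q e1 e2 e3
      have hpq := hC₁b p q
      rw [abs_of_nonneg (radius_nonneg _ _)] at e2
      refine (abs_mul_div_sub_le hC.le (radius_nonneg _ _) e3 (hCb k p) (hCb k q) e1 e2 hη0.le).trans ?_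
      have e4 : |p (k, i) - q (k, i)| ≤ ‖p - q‖ := by
        have := PiLp.norm_apply_le (p - q) (k, i)
        rwa [PiLp.sub_apply, Real.norm_eq_abs] at this
      have e5 : |radius a p i - radius a q i| ≤ C₁ * ‖p - q‖ :=
        (norm_le_pi_norm (radius a p - radius a q) i).trans hpq
      calc _ ≤ C * (η * (C₁ * ‖p - q‖)) + η * (‖p - q‖ + C * (C₁ * ‖p - q‖)) := by gcongr
        _ = η * (C * C₁ + (1 + C * C₁)) * ‖p - q‖ := by ring
        _ = ε * ‖p - q‖ := by rw [hη, div_mul_cancel₀]; positivity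
    filter_upwards [ht.eventually h1, h21, h22] with p e1 e2 e3
    simp only [_root_.zero_apply, sub_zero]
    rw [Real.norm_eq_abs]
    rcases le_total (radius a p.2 i) (radius a p.1 i) with h | h
    · exact ord p.1 p.2 e1 e3 h
    · rw [abs_sub_comm, norm_sub_rev p.1]
      exact ord p.2 p.1 (by rwa [norm_sub_rev, norm_sub_rev (radius a p.2)]) e2 h
  have h3 := key.add ((hasStrictFDerivAt_coord (k, i) x).const_mul l)
  rw [zero_add] at h3
  refine h3.congr_of_eventuallyEq (Eventually.of_forall fun y => ?_)
  change (g (radius a y) - L (radius a y)) * (y (k, i) / radius a y i) + l * y (k, i) = _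
  rw [hLw]
  by_cases hy : radius a y i = 0
  · have := (radius_eq_zero_iff ha y i).1 hy
    have hyk : y (k, i) = 0 := by
      fin_cases k
      · exact this.2
      · exact this.1
    simp [hyk]
  · field_simp
    ring

end Radius

/-! ### The sign symmetries of the gradients -/

section Signs

variable {n : ℕ}

/-- The sign vector that flips the `j`-th coordinate. -/
def flipSign (j : Fin n) (i : Fin n) : ℝ := if i = j then -1 else 1

theorem abs_flipSign (j i : Fin n) : |flipSign j i| = 1 := by
  unfold flipSign; split_ifs <;> simp

theorem flipSign_mul_of_eq_zero {j : Fin n} {w : Fin n → ℝ} (hw : w j = 0) :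
    (fun i => flipSign j i * w i) = w := by
  ext i
  unfold flipSign
  split_ifs with h
  · rw [h, hw, mul_zero]
  · rw [one_mul]

theorem meanSign_eq_zero {j : Fin n} {w : Fin n → ℝ} (hw : w j = 0) : meanSign w j = 0 := by
  have mp := measurePreserving_signs (flipSign j) (abs_flipSign j)
  have hdot : ∀ c : Fin n → ℝ, w ⬝ᵥ (fun i => flipSign j i * c i) = w ⬝ᵥ c := fun c => by
    conv_rhs => rw [← flipSign_mul_of_eq_zero hw]
    exact Finset.sum_congr rfl fun i _ => by ring
  have h : meanSign w j = -meanSign w j := by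
    conv_lhs => rw [meanSign, ← mp.map_eq]
    rw [integral_map mp.measurable.aemeasurable]
    · rw [meanSign, ← integral_neg]
      refine integral_congr_ae (Eventually.of_forall fun c => ?_)
      simp only [hdot]
      simp [flipSign]
    · exact ((measurable_sign_dotProduct w).mul (measurable_pi_apply j)).aestronglyMeasurable
  linarith

theorem dualGrad_eq_zero {j : Fin n} {w : Fin n → ℝ} (hw : w j = 0) : dualGrad w j = 0 := by
  have h := congrFun (dualGrad_signs (flipSign j) (abs_flipSign j) w) j
  rw [flipSign_mul_of_eq_zero hw] at h
  simp only [flipSign, if_true] at h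
  linarith

/-- If `w k = 0`, then `w` is fixed by the flip of coordinate `k`, so the derivative at `w` commutes
with the flip and its entries between opposite parities vanish. -/
theorem hasStrictFDerivAt_dualGrad_apply_single {w : Fin n → ℝ} {L : (Fin n → ℝ) →L[ℝ] (Fin n → ℝ)}
    (hL : HasStrictFDerivAt dualGrad L w) {i j : Fin n} (hij : i ≠ j) (h : w i = 0 ∨ w j = 0) :
    L (Pi.single j 1) i = 0 := by
  obtain ⟨k, hk, hkij⟩ : ∃ k, w k = 0 ∧ flipSign k i * flipSign k j = -1 := by
    rcases h with h | h
    · exact ⟨i, h, by simp [flipSign, hij.symm]⟩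
    · exact ⟨j, h, by simp [flipSign, hij]⟩
  set S : (Fin n → ℝ) →L[ℝ] (Fin n → ℝ) :=
    ContinuousLinearMap.pi fun i => flipSign k i • ContinuousLinearMap.proj i with hS
  have hSa : ∀ v, S v = fun i => flipSign k i * v i := fun v => by ext; simp [hS]
  have hSw : S w = w := by rw [hSa, flipSign_mul_of_eq_zero hk]
  have hf : dualGrad ∘ S = S ∘ dualGrad := by
    ext1 v
    simp only [Function.comp, hSa]
    exact dualGrad_signs _ (abs_flipSign k) v
  have h1 : HasFDerivAt (dualGrad ∘ S) (L ∘L S) w := by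
    refine HasFDerivAt.comp w ?_ S.hasFDerivAt
    rw [hSw]; exact hL.hasFDerivAt
  have h2 : HasFDerivAt (dualGrad ∘ S) (S ∘L L) w := by
    rw [hf]; exact S.hasFDerivAt.comp w hL.hasFDerivAt
  have h3 := congrFun (DFunLike.congr_fun (h1.unique h2) (Pi.single j 1)) i
  simp only [ContinuousLinearMap.comp_apply] at h3
  have h4 : S (Pi.single j 1) = flipSign k j • (Pi.single j 1 : Fin n → ℝ) := by
    ext l
    rw [hSa]
    by_cases hl : l = j
    · subst hl; simp
    · simp [hl]
  rw [h4, map_smul, hSa, Pi.smul_apply, smul_eq_mul] at h3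
  have h5 := abs_flipSign k j
  have h6 : flipSign k j * flipSign k j = 1 := by rw [← abs_mul_abs_self, h5, one_mul]
  have h7 : L (Pi.single j 1) i = (flipSign k i * flipSign k j) * L (Pi.single j 1) i := by
    calc L (Pi.single j 1) i = flipSign k j * (flipSign k j * L (Pi.single j 1) i) := by
          rw [← mul_assoc, h6, one_mul]
      _ = _ := by rw [h3]; ring
  rw [hkij] at h7
  linarith

end Signs

/-! ### The gradients of the support function and of the gauge -/

section Gradients

variable {N : ℕ} {a : Fin N → ℝ}

/-- The vector with radial components `g` in the directions of the pairs of coordinates of `x`. -/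
def polarLift (a : Fin N → ℝ) (g : Fin N → ℝ) (x : Space N) : Space N :=
  WithLp.toLp 2 fun k => g k.2 * ((if k.1 = 1 then x (1, k.2) else a k.2 * x (0, k.2)) /
    radius a x k.2)

theorem polarLift_one (g : Fin N → ℝ) (x : Space N) (i : Fin N) :
    polarLift a g x (1, i) = g i * (x (1, i) / radius a x i) := by
  simp [polarLift]

theorem polarLift_zero (g : Fin N → ℝ) (x : Space N) (i : Fin N) :
    polarLift a g x (0, i) = g i * (a i * x (0, i) / radius a x i) := by
  simp [polarLift]

theorem inner_eq_sum (p x : Space N) :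
    inner ℝ p x = ∑ i, (p (0, i) * x (0, i) + p (1, i) * x (1, i)) := by
  rw [PiLp.inner_apply, Fintype.sum_prod_type_right]
  simp [Fin.sum_univ_two, mul_comm]

theorem inner_polarLift (g : Fin N → ℝ) (x v : Space N) :
    inner ℝ (polarLift a g x) v = g ⬝ᵥ fun i => radiusDeriv a x i v := by
  rw [inner_eq_sum, dotProduct]
  refine Finset.sum_congr rfl fun i _ => ?_
  rw [polarLift_one, polarLift_zero]
  simp [radiusDeriv]
  ring

theorem radiusDeriv_self (ha : ∀ i, 0 < a i) (x : Space N) (i : Fin N) :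
    radiusDeriv a x i x = radius a x i := by
  by_cases h : radius a x i = 0
  · rw [radiusDeriv_of_radius_eq_zero h, h]; rfl
  · have := radius_sq ha x i
    simp only [radiusDeriv, _root_.add_apply, _root_.smul_apply, smul_eq_mul,
      PiLp.proj_apply]
    field_simp
    linarith

theorem inner_polarLift_self (ha : ∀ i, 0 < a i) (g : Fin N → ℝ) (x : Space N) :
    inner ℝ (polarLift a g x) x = g ⬝ᵥ radius a x := by
  rw [inner_polarLift]
  simp_rw [radiusDeriv_self ha]

theorem radius_inv_polarLift (ha : ∀ i, 0 < a i) {g : Fin N → ℝ} {x : Space N}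
    (hg : ∀ i, radius a x i = 0 → g i = 0) :
    radius (fun i => (a i)⁻¹) (polarLift a g x) = fun i => |g i| := by
  ext i
  rw [radius, polarLift_one, polarLift_zero, ← Real.sqrt_sq_eq_abs]
  by_cases h : radius a x i = 0
  · simp [hg i h]
  · congr 1
    have := radius_sq ha x i
    have hai := (ha i).ne'
    field_simp
    rw [this]

theorem hasGradientAt_comp_radius (ha : ∀ i, 0 < a i) {f : (Fin N → ℝ) → ℝ} {g : Fin N → ℝ}
    {x : Space N} (hf : HasStrictFDerivAt f (dotCLM g) (radius a x))
    (hg : ∀ i, radius a x i = 0 → g i = 0) :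
    HasStrictFDerivAt (fun x => f (radius a x))
      (InnerProductSpace.toDual ℝ (Space N) (polarLift a g x)) x := by
  refine (hasStrictFDerivAt_comp_radius ha hf fun j hj => ?_).congr_fderiv ?_
  · rw [dotCLM_apply, dotProduct_single_one, hg j hj]
  · refine ContinuousLinearMap.ext fun v => ?_
    rw [InnerProductSpace.toDual_apply_apply, inner_polarLift, ContinuousLinearMap.comp_apply,
      dotCLM_apply]
    rfl

/-- Cauchy–Schwarz in each plane, with weights `(a i)⁻¹` on momenta and `a i` on phases; the defect
is given by Lagrange's identity. -/
theorem inner_le_radius (ha : ∀ i, 0 < a i) (p x : Space N) :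
    inner ℝ p x ≤ radius (fun i => (a i)⁻¹) p ⬝ᵥ radius a x := by
  rw [inner_eq_sum, dotProduct]
  refine Finset.sum_le_sum fun i _ => ?_
  have hai := ha i
  refine abs_le_of_sq_le_sq' ?_ (mul_nonneg (radius_nonneg _ _) (radius_nonneg _ _)) |>.2
  rw [mul_pow, radius_sq ha, radius_sq (fun i => inv_pos.2 (ha i))]
  have : (p (1, i) ^ 2 + (a i)⁻¹ * p (0, i) ^ 2) * (x (1, i) ^ 2 + a i * x (0, i) ^ 2) -
      (p (0, i) * x (0, i) + p (1, i) * x (1, i)) ^ 2 =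
      (a i)⁻¹ * (a i * p (1, i) * x (0, i) - p (0, i) * x (1, i)) ^ 2 := by
    field_simp
    ring
  have h2 : 0 ≤ (a i)⁻¹ * (a i * p (1, i) * x (0, i) - p (0, i) * x (1, i)) ^ 2 := by positivity
  linarith

theorem exists_inner_eq_radius (ha : ∀ i, 0 < a i) {z : Fin N → ℝ} (hz : ∀ i, 0 ≤ z i)
    (x : Space N) : ∃ p : Space N, radius (fun i => (a i)⁻¹) p = z ∧
      inner ℝ p x = z ⬝ᵥ radius a x := by
  refine ⟨WithLp.toLp 2 fun k => if radius a x k.2 = 0 then (if k.1 = 1 then z k.2 else 0) else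
    polarLift a z x k, ?_, ?_⟩
  · ext i
    by_cases h : radius a x i = 0
    · simp [radius, show √(x (1, i) ^ 2 + a i * x (0, i) ^ 2) = 0 from h, Real.sqrt_sq (hz i)]
    · have hs := radius_sq ha x i
      have hai := (ha i).ne'
      rw [radius]
      simp only [h, if_false]
      rw [polarLift_one, polarLift_zero]
      conv_rhs => rw [← Real.sqrt_sq (hz i)]
      congr 1
      field_simp
      rw [hs]
  · rw [← inner_polarLift_self ha, inner_eq_sum, inner_eq_sum]
    refine Finset.sum_congr rfl fun i _ => ?_
    by_cases h : radius a x i = 0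
    · have := (radius_eq_zero_iff ha x i).1 h
      simp [this]
    · simp [h]

end Gradients

section Oscillators

variable {N : ℕ} {ω : Fin N → ℝ}

theorem supportFn_eq (p : Space N) :
    supportFn ω p = meanAbs (radius (fun i => (ω i ^ 2)⁻¹) p) := rfl

/-- For given amplitudes the best momentum is aligned with `x` in each plane. This reduces the body
in phase space to the polar of `meanAbs`. -/
theorem mem_limitBody_iff (hω : ∀ i, 0 < ω i) (x : Space N) :
    x ∈ limitBody ω ↔ radius (fun i => ω i ^ 2) x ∈ polarBody N := by
  have ha : ∀ i, 0 < ω i ^ 2 := fun i => pow_pos (hω i) 2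
  constructor
  · intro h z
    obtain ⟨p, hp, hpx⟩ := exists_inner_eq_radius ha (fun i => abs_nonneg (z i)) x
    have h1 := h p
    rw [hpx, supportFn_eq, hp, meanAbs_abs] at h1
    refine le_trans ?_ h1
    exact Finset.sum_le_sum fun i _ =>
      mul_le_mul_of_nonneg_right (le_abs_self _) (radius_nonneg _ _)
  · intro h p
    exact (inner_le_radius ha p x).trans (h _)

theorem rho_eq (hω : ∀ i, 0 < ω i) (x : Space N) :
    rho ω x = dualNorm (radius (fun i => ω i ^ 2) x) := by
  rw [rho, dualNorm, gauge_def', gauge_def']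
  congr 1
  ext r
  refine and_congr_right fun hr => ?_
  rw [mem_limitBody_iff hω, radius_smul (inv_pos.2 hr).le]

theorem inner_le_rho_mul (hω : ∀ i, 0 < ω i) (p x : Space N) :
    inner ℝ p x ≤ rho ω x * supportFn ω p := by
  rw [rho_eq hω]
  exact (inner_le_radius (fun i => pow_pos (hω i) 2) p x).trans (dotProduct_le_dualNorm _ _)

theorem hasStrictFDerivAt_supportFn (hω : ∀ i, 0 < ω i) {p : Space N} (hp : p ≠ 0) :
    HasStrictFDerivAt (supportFn ω) (InnerProductSpace.toDual ℝ (Space N)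
      (polarLift (fun i => (ω i ^ 2)⁻¹) (meanSign (amplitude ω p)) p)) p := by
  have ha : ∀ i, 0 < (ω i ^ 2)⁻¹ := fun i => inv_pos.2 (pow_pos (hω i) 2)
  exact hasGradientAt_comp_radius ha (hasStrictFDerivAt_meanAbs (radius_ne_zero ha hp))
    fun i hi => meanSign_eq_zero hi

theorem hasStrictFDerivAt_rho (hω : ∀ i, 0 < ω i) {x : Space N} (hx : x ≠ 0) :
    HasStrictFDerivAt (rho ω) (InnerProductSpace.toDual ℝ (Space N)
      (polarLift (fun i => ω i ^ 2) (dualGrad (radius (fun i => ω i ^ 2) x)) x)) x := by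
  have ha : ∀ i, 0 < ω i ^ 2 := fun i => pow_pos (hω i) 2
  rw [show rho ω = fun x => dualNorm (radius (fun i => ω i ^ 2) x) from funext (rho_eq hω)]
  exact hasGradientAt_comp_radius ha (hasStrictFDerivAt_dualNorm (radius_ne_zero ha hx))
    fun i hi => dualGrad_eq_zero hi

theorem gradient_supportFn (hω : ∀ i, 0 < ω i) {p : Space N} (hp : p ≠ 0) :
    gradient (supportFn ω) p =
      polarLift (fun i => (ω i ^ 2)⁻¹) (meanSign (amplitude ω p)) p :=
  HasGradientAt.gradient (hasGradientAt_iff_hasFDerivAt.2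
    (hasStrictFDerivAt_supportFn hω hp).hasFDerivAt)

theorem gradient_rho (hω : ∀ i, 0 < ω i) {x : Space N} (hx : x ≠ 0) :
    gradient (rho ω) x =
      polarLift (fun i => ω i ^ 2) (dualGrad (radius (fun i => ω i ^ 2) x)) x :=
  HasGradientAt.gradient (hasGradientAt_iff_hasFDerivAt.2
    (hasStrictFDerivAt_rho hω hx).hasFDerivAt)

theorem supportFn_gradient_rho (hω : ∀ i, 0 < ω i) {x : Space N} (hx : x ≠ 0) :
    supportFn ω (gradient (rho ω) x) = 1 := by
  have ha : ∀ i, 0 < ω i ^ 2 := fun i => pow_pos (hω i) 2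
  rw [gradient_rho hω hx, supportFn_eq,
    radius_inv_polarLift ha fun i hi => dualGrad_eq_zero hi, meanAbs_abs,
    meanAbs_dualGrad (radius_ne_zero ha hx)]

theorem inner_gradient_rho_self (hω : ∀ i, 0 < ω i) {x : Space N} (hx : x ≠ 0) :
    inner ℝ (gradient (rho ω) x) x = rho ω x := by
  have ha : ∀ i, 0 < ω i ^ 2 := fun i => pow_pos (hω i) 2
  rw [gradient_rho hω hx, inner_polarLift_self ha, rho_eq hω,
    dualNorm_eq (radius_ne_zero ha hx)]

theorem inner_gradient_rho_le (hω : ∀ i, 0 < ω i) {x : Space N} (hx : x ≠ 0) (y : Space N) :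
    inner ℝ (gradient (rho ω) x) y ≤ rho ω y := by
  have := inner_le_rho_mul hω (gradient (rho ω) x) y
  rwa [supportFn_gradient_rho hω hx, mul_one] at this

theorem rho_pos (hω : ∀ i, 0 < ω i) {x : Space N} (hx : x ≠ 0) : 0 < rho ω x := by
  rw [rho_eq hω]
  exact dualNorm_pos (radius_ne_zero (fun i => pow_pos (hω i) 2) hx)

/-- Fermat's rule once more: `∂ρ/∂x (x)` minimizes `ρ(x) H(q) - (q, x)`. Thus `bodyPoint` inverts
the gradient map on the boundary of the body. -/
theorem rho_smul_gradient_supportFn (hω : ∀ i, 0 < ω i) {x : Space N} (hx : x ≠ 0) :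
    rho ω x • gradient (supportFn ω) (gradient (rho ω) x) = x := by
  set p := gradient (rho ω) x with hp
  have hp0 : p ≠ 0 := fun h => by
    have := inner_gradient_rho_self hω hx
    rw [← hp, h, inner_zero_left] at this
    exact (rho_pos hω hx).ne this
  have hd := (hasStrictFDerivAt_supportFn hω hp0).hasFDerivAt
  rw [← gradient_supportFn hω hp0] at hd
  have h1 := (hd.const_mul (rho ω x)).sub (innerSL ℝ x).hasFDerivAt
  have hmin : IsLocalMin (fun q => rho ω x * supportFn ω q - innerSL ℝ x q) p := by
    refine Eventually.of_forall fun q => ?_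
    have e1 := inner_le_rho_mul hω q x
    have e2 : rho ω x * supportFn ω p - innerSL ℝ x p = 0 := by
      rw [innerSL_apply_apply, real_inner_comm, hp, inner_gradient_rho_self hω hx,
        supportFn_gradient_rho hω hx, mul_one, sub_self]
    simp only [e2]
    rw [innerSL_apply_apply, real_inner_comm]
    linarith
  have h2 := hmin.hasFDerivAt_eq_zero h1
  refine ext_inner_right ℝ fun v => ?_
  have h3 := DFunLike.congr_fun h2 v
  simp only [_root_.sub_apply, _root_.smul_apply, InnerProductSpace.toDual_apply_apply,
    innerSL_apply_apply, smul_eq_mul, _root_.zero_apply] at h3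
  rw [real_inner_smul_left]
  linarith

theorem bodyPoint_ne_zero (hω : ∀ i, 0 < ω i) {p : Space N} (hp : supportFn ω p = 1) :
    p ≠ 0 ∧ bodyPoint ω p ≠ 0 := by
  have ha : ∀ i, 0 < (ω i ^ 2)⁻¹ := fun i => inv_pos.2 (pow_pos (hω i) 2)
  have hp0 : p ≠ 0 := by
    rintro rfl
    rw [supportFn_eq, show radius (fun i => (ω i ^ 2)⁻¹) (0 : Space N) = 0 from
      funext fun i => by simp [radius], meanAbs_zero] at hp
    norm_num at hp
  refine ⟨hp0, fun h => ?_⟩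
  have := inner_polarLift_self ha (meanSign (amplitude ω p)) p
  rw [← gradient_supportFn hω hp0, show gradient (supportFn ω) p = 0 from h, inner_zero_left,
    ← amplitude_eq_radius, meanSign_dotProduct_self] at this
  have h1 : meanAbs (amplitude ω p) = 1 := hp
  linarith

/-- Where a radius vanishes, its component of `dualGrad` vanishes too and compensates the singular
direction `x / radius`. Elsewhere only the other vanishing radii matter, and their partial
derivatives are zero by sign symmetry. -/
theorem exists_hasStrictFDerivAt_gradient_rho (hω : ∀ i, 0 < ω i) {x : Space N} (hx : x ≠ 0) :
    ∃ D : Space N →L[ℝ] Space N, HasStrictFDerivAt (gradient (rho ω)) D x := by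
  set a : Fin N → ℝ := fun i => ω i ^ 2 with ha_def
  have ha : ∀ i, 0 < a i := fun i => pow_pos (hω i) 2
  obtain ⟨L, hL⟩ := exists_hasStrictFDerivAt_dualGrad (radius_ne_zero ha hx)
  have hcomp : ∀ (k : Fin 2) (i : Fin N), ∃ l : Space N →L[ℝ] ℝ, HasStrictFDerivAt
      (fun y => dualGrad (radius a y) i * (y (k, i) / radius a y i)) l x := fun k i => by
    have hLi := hasStrictFDerivAt_pi'.1 hL i
    by_cases hi : radius a x i = 0
    · exact ⟨_, hasStrictFDerivAt_mul_coord_div_radius ha hLi hi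
        (fun j hj => hasStrictFDerivAt_dualGrad_apply_single hL hj.symm (Or.inl hi))
        (fun w hw => dualGrad_eq_zero hw) k⟩
    · have h1 := hasStrictFDerivAt_comp_radius ha hLi fun j hj =>
        hasStrictFDerivAt_dualGrad_apply_single hL (fun h => hi (h ▸ hj)) (Or.inr hj)
      exact ⟨_, h1.mul ((hasStrictFDerivAt_coord (k, i) x).mul
        ((hasStrictDerivAt_inv hi).comp_hasStrictFDerivAt x (hasStrictFDerivAt_radius ha hi)))⟩
  choose l hl using hcomp
  have hk : ∀ k : Fin 2 × Fin N, ∃ m : Space N →L[ℝ] ℝ, HasStrictFDerivAt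
      (fun y => polarLift a (dualGrad (radius a y)) y k) m x := by
    rintro ⟨k, i⟩
    fin_cases k
    · refine ⟨_, ((hl 0 i).const_mul (a i)).congr_of_eventuallyEq
        (Eventually.of_forall fun y => ?_)⟩
      change _ = polarLift a (dualGrad (radius a y)) y (0, i)
      rw [polarLift_zero]; ring
    · refine ⟨_, (hl 1 i).congr_of_eventuallyEq (Eventually.of_forall fun y => ?_)⟩
      exact (polarLift_one _ _ _).symm
  choose m hm using hk
  set e := (EuclideanSpace.equiv (Fin 2 × Fin N) ℝ).symm
  refine ⟨(e : (Fin 2 × Fin N → ℝ) →L[ℝ] Space N) ∘L ContinuousLinearMap.pi m, ?_⟩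
  have h1 : HasStrictFDerivAt (fun y => polarLift a (dualGrad (radius a y)) y)
      ((e : (Fin 2 × Fin N → ℝ) →L[ℝ] Space N) ∘L ContinuousLinearMap.pi m) x :=
    hasStrictFDerivAt_euclidean.2 fun k => by
      refine (hm k).congr_fderiv ?_
      refine ContinuousLinearMap.ext fun v => rfl
  refine h1.congr_of_eventuallyEq ?_
  filter_upwards [isOpen_ne.mem_nhds hx] with y hy
  exact (gradient_rho hω hy).symm

/-- Strictness makes `f - f'` Lipschitz with small constant near `x`, and this constant bounds
`fderiv f y - f'` at nearby points. -/
theorem continuousAt_fderiv_of_hasStrictFDerivAt {E F : Type*} [NormedAddCommGroup E]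
    [NormedSpace ℝ E] [NormedAddCommGroup F] [NormedSpace ℝ F] {f : E → F} {f' : E →L[ℝ] F}
    {x : E} (hf : HasStrictFDerivAt f f' x) (hd : ∀ᶠ y in 𝓝 x, DifferentiableAt ℝ f y) :
    ContinuousAt (fderiv ℝ f) x := by
  rw [ContinuousAt, hf.hasFDerivAt.fderiv, Metric.tendsto_nhds]
  intro ε hε
  obtain ⟨s, hs, h⟩ := hf.approximates_deriv_on_nhds (c := ⟨ε / 2, (half_pos hε).le⟩)
    (Or.inr (half_pos hε))
  filter_upwards [hd, eventually_mem_nhds_iff.2 hs] with y hy hys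
  have h1 := hy.hasFDerivAt.sub f'.hasFDerivAt
  rw [dist_eq_norm]
  refine lt_of_le_of_lt (h1.le_of_lip' (half_pos hε).le ?_) (half_lt_self hε)
  filter_upwards [hys] with z hz
  have := h z hz y (mem_of_mem_nhds hys)
  rw [map_sub] at this
  refine le_trans (le_of_eq ?_) this
  congr 1
  simp only [Pi.sub_apply]
  abel

end Oscillators

/-! ### The vector field on the singular sphere -/

section Oscillators

variable {N : ℕ} {ω : Fin N → ℝ}

theorem toEuclideanLin_oscMatrix_zero (x : Space N) (i : Fin N) :
    (oscMatrix ω).toEuclideanLin x (0, i) = x (1, i) := by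
  simp [Matrix.toLpLin_apply, oscMatrix, Matrix.mulVec, dotProduct, Fintype.sum_prod_type_right,
    Matrix.blockDiagonal_apply]

theorem toEuclideanLin_oscMatrix_one (x : Space N) (i : Fin N) :
    (oscMatrix ω).toEuclideanLin x (1, i) = -(ω i ^ 2 * x (0, i)) := by
  simp [Matrix.toLpLin_apply, oscMatrix, Matrix.mulVec, dotProduct, Fintype.sum_prod_type_right,
    Matrix.blockDiagonal_apply]

theorem toEuclideanLin_transpose_zero (x : Space N) (i : Fin N) :
    (oscMatrix ω).transpose.toEuclideanLin x (0, i) = -(ω i ^ 2 * x (1, i)) := by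
  simp [Matrix.toLpLin_apply, oscMatrix, Matrix.mulVec, dotProduct, Fintype.sum_prod_type_right,
    Matrix.blockDiagonal_apply]

theorem toEuclideanLin_transpose_one (x : Space N) (i : Fin N) :
    (oscMatrix ω).transpose.toEuclideanLin x (1, i) = x (0, i) := by
  simp [Matrix.toLpLin_apply, oscMatrix, Matrix.mulVec, dotProduct, Fintype.sum_prod_type_right,
    Matrix.blockDiagonal_apply]

theorem inner_toEuclideanLin_transpose (p x : Space N) :
    inner ℝ ((oscMatrix ω).transpose.toEuclideanLin p) x =
      inner ℝ p ((oscMatrix ω).toEuclideanLin x) := by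
  rw [inner_eq_sum, inner_eq_sum]
  refine Finset.sum_congr rfl fun i _ => ?_
  rw [toEuclideanLin_oscMatrix_zero, toEuclideanLin_oscMatrix_one, toEuclideanLin_transpose_zero,
    toEuclideanLin_transpose_one]
  ring

theorem inner_inputVec (p : Space N) : inner ℝ p (inputVec N) = ∑ i, p (1, i) := by
  rw [inner_eq_sum]
  simp [inputVec]

theorem hasStrictFDerivAt_gradient_rho (hω : ∀ i, 0 < ω i) {x : Space N} (hx : x ≠ 0) :
    HasStrictFDerivAt (gradient (rho ω)) (fderiv ℝ (gradient (rho ω)) x) x := by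
  obtain ⟨D, hD⟩ := exists_hasStrictFDerivAt_gradient_rho hω hx
  rwa [hD.hasFDerivAt.fderiv]

theorem continuousAt_bodyPoint (hω : ∀ i, 0 < ω i) {p : Space N} (hp : p ≠ 0) :
    ContinuousAt (bodyPoint ω) p :=
  (InnerProductSpace.toDual ℝ (Space N)).symm.continuous.continuousAt.comp
    (continuousAt_fderiv_of_hasStrictFDerivAt (hasStrictFDerivAt_supportFn hω hp) (by
      filter_upwards [isOpen_ne.mem_nhds hp] with q hq
      exact (hasStrictFDerivAt_supportFn hω hq).hasFDerivAt.differentiableAt))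

theorem continuousAt_bTilde (hω : ∀ i, 0 < ω i) {p : Space N} (hp : supportFn ω p = 1) :
    ContinuousAt (bTilde ω) p := by
  obtain ⟨hp0, hx⟩ := bodyPoint_ne_zero hω hp
  have h1 : ContinuousAt (fderiv ℝ (gradient (rho ω))) (bodyPoint ω p) :=
    continuousAt_fderiv_of_hasStrictFDerivAt (hasStrictFDerivAt_gradient_rho hω hx) (by
      filter_upwards [isOpen_ne.mem_nhds hx] with y hy
      exact (hasStrictFDerivAt_gradient_rho hω hy).hasFDerivAt.differentiableAt)
  exact (h1.comp (continuousAt_bodyPoint hω hp0)).clm_apply continuousAt_const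

theorem fderiv_gradient_rho_symm (hω : ∀ i, 0 < ω i) {x : Space N} (hx : x ≠ 0) (v w : Space N) :
    inner ℝ (fderiv ℝ (gradient (rho ω)) x v) w = inner ℝ (fderiv ℝ (gradient (rho ω)) x w) v := by
  set I := (isBoundedBilinearMap_inner (𝕜 := ℝ) (E := Space N)).toContinuousLinearMap
  have h1 : ∀ᶠ y in 𝓝 x, HasFDerivAt (rho ω) (I (gradient (rho ω) y)) y := by
    filter_upwards [isOpen_ne.mem_nhds hx] with y hy
    rw [gradient_rho hω hy]
    exact (hasStrictFDerivAt_rho hω hy).hasFDerivAt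
  exact second_derivative_symmetric_of_eventually h1
    (I.hasFDerivAt.comp x (hasStrictFDerivAt_gradient_rho hω hx).hasFDerivAt) v w

theorem inner_gradient_rho_sub_nonneg (hω : ∀ i, 0 < ω i) {x y : Space N} (hx : x ≠ 0)
    (hy : y ≠ 0) : 0 ≤ inner ℝ (gradient (rho ω) y - gradient (rho ω) x) (y - x) := by
  have h1 := inner_gradient_rho_le hω hx y
  have h2 := inner_gradient_rho_le hω hy x
  rw [inner_sub_left, inner_sub_right, inner_sub_right, inner_gradient_rho_self hω hx,
    inner_gradient_rho_self hω hy]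
  linarith

theorem inner_fderiv_gradient_rho_nonneg (hω : ∀ i, 0 < ω i) {x : Space N} (hx : x ≠ 0)
    (v : Space N) : 0 ≤ inner ℝ (fderiv ℝ (gradient (rho ω)) x v) v := by
  have hline : HasDerivAt (fun t : ℝ => x + t • v) v 0 := by
    simpa using ((hasDerivAt_id (0 : ℝ)).smul_const v).const_add x
  have h1 : HasDerivAt (fun t : ℝ => gradient (rho ω) (x + t • v))
      (fderiv ℝ (gradient (rho ω)) x v) 0 := by
    have h0 : HasFDerivAt (gradient (rho ω)) (fderiv ℝ (gradient (rho ω)) x) (x + (0 : ℝ) • v) := by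
      rw [zero_smul, add_zero]
      exact (hasStrictFDerivAt_gradient_rho hω hx).hasFDerivAt
    exact h0.comp_hasDerivAt 0 hline
  have h2 : Tendsto (fun t : ℝ => inner ℝ (slope (fun t : ℝ => gradient (rho ω) (x + t • v)) 0 t) v)
      (𝓝[>] 0) (𝓝 (inner ℝ (fderiv ℝ (gradient (rho ω)) x v) v)) :=
    ((hasDerivAt_iff_tendsto_slope.1 h1).mono_left
      (nhdsWithin_mono _ fun t ht => ne_of_gt ht)).inner tendsto_const_nhds
  refine ge_of_tendsto h2 ?_
  have hne : ∀ᶠ t in 𝓝[>] (0 : ℝ), x + t • v ≠ 0 :=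
    (hline.continuousAt.eventually_ne (by simpa using hx)).filter_mono nhdsWithin_le_nhds
  filter_upwards [hne, self_mem_nhdsWithin] with t ht ht0
  have ht0 : 0 < t := ht0
  have h3 := inner_gradient_rho_sub_nonneg hω hx ht
  rw [add_sub_cancel_left, real_inner_smul_right] at h3
  rw [slope_def_module, sub_zero, zero_smul, add_zero, real_inner_smul_left]
  exact mul_nonneg (inv_nonneg.2 ht0.le) (nonneg_of_mul_nonneg_right h3 ht0)

theorem inner_bTilde_nonneg (hω : ∀ i, 0 < ω i) {p : Space N} (hp : supportFn ω p = 1) :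
    0 ≤ inner ℝ (bTilde ω p) (inputVec N) :=
  inner_fderiv_gradient_rho_nonneg hω (bodyPoint_ne_zero hω hp).2 _

/-- A null vector of a nonnegative symmetric form lies in its kernel, as one sees by perturbing it
to `B + t u` with `u = B̃`. -/
theorem bTilde_eq_zero (hω : ∀ i, 0 < ω i) {p : Space N} (hp : supportFn ω p = 1)
    (h : inner ℝ (bTilde ω p) (inputVec N) = 0) : bTilde ω p = 0 := by
  have hx := (bodyPoint_ne_zero hω hp).2
  set D := fderiv ℝ (gradient (rho ω)) (bodyPoint ω p) with hD
  have hu : bTilde ω p = D (inputVec N) := rfl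
  set u := bTilde ω p
  set c := inner ℝ (D u) u with hc
  have hc0 : 0 ≤ c := inner_fderiv_gradient_rho_nonneg hω hx u
  have key : ∀ t : ℝ, 0 ≤ 2 * t * inner ℝ u u + t ^ 2 * c := fun t => by
    have h1 := inner_fderiv_gradient_rho_nonneg hω hx (inputVec N + t • u)
    have h2 := fderiv_gradient_rho_symm hω hx u (inputVec N)
    rw [← hD] at h1 h2
    rw [map_add, map_smul, ← hu, inner_add_left, inner_add_right, inner_add_right, h,
      real_inner_smul_left, real_inner_smul_left, real_inner_smul_right, real_inner_smul_right, h2,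
      ← hu] at h1
    linarith
  -- Nearly the minimizer of the quadratic in `t`; `c + 1` avoids a separate case `c = 0`.
  have h1 := key (-inner ℝ u u / (c + 1))
  have hs : (0 : ℝ) ≤ inner ℝ u u := real_inner_self_nonneg
  have h2 : 2 * (-inner ℝ u u / (c + 1)) * inner ℝ u u + (-inner ℝ u u / (c + 1)) ^ 2 * c =
      -(inner ℝ u u ^ 2 * (c + 2) / (c + 1) ^ 2) := by
    field_simp
    ring
  rw [h2] at h1
  have h3 : inner ℝ u u ^ 2 * (c + 2) / (c + 1) ^ 2 ≤ 0 := by linarith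
  rw [div_le_iff₀ (by positivity), zero_mul] at h3
  have h4 : inner ℝ u u ^ 2 = 0 := by nlinarith [sq_nonneg (inner ℝ u u)]
  exact inner_self_eq_zero.1 (pow_eq_zero_iff two_ne_zero |>.1 h4)

/-! ### Bounded controls -/

theorem supportFn_smul {t : ℝ} (ht : 0 ≤ t) (p : Space N) :
    supportFn ω (t • p) = t * supportFn ω p := by
  rw [supportFn_eq, supportFn_eq, radius_smul ht, meanAbs_smul, abs_of_nonneg ht]

theorem supportFn_pos (hω : ∀ i, 0 < ω i) {p : Space N} (hp : p ≠ 0) : 0 < supportFn ω p :=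
  meanAbs_pos (radius_ne_zero (fun i => inv_pos.2 (pow_pos (hω i) 2)) hp)

theorem isCompact_supportFn_eq_one (hω : ∀ i, 0 < ω i) :
    IsCompact {p : Space N | supportFn ω p = 1} := by
  have hne : ∀ p ∈ Metric.sphere (0 : Space N) 1, p ≠ 0 := fun p hp h => by
    rw [h] at hp; simp at hp
  have hc : ContinuousOn (fun p : Space N => (supportFn ω p)⁻¹ • p) (Metric.sphere 0 1) :=
    fun p hp => (((hasStrictFDerivAt_supportFn hω (hne p hp)).continuousAt.inv₀
      (supportFn_pos hω (hne p hp)).ne').smul continuousAt_id).continuousWithinAt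
  convert (isCompact_sphere (0 : Space N) 1).image_of_continuousOn hc using 1
  ext p
  simp only [mem_ofPred_eq, mem_image, mem_sphere_zero_iff_norm]
  constructor
  · intro hp
    have h0 := (bodyPoint_ne_zero hω hp).1
    have hn : 0 < ‖p‖ := norm_pos_iff.2 h0
    refine ⟨‖p‖⁻¹ • p, by rw [norm_smul, norm_inv, norm_norm, inv_mul_cancel₀ hn.ne'], ?_⟩
    rw [supportFn_smul (by positivity), hp, smul_smul]
    field_simp
    rw [one_smul]
  · rintro ⟨w, hw, rfl⟩
    have h0 := supportFn_pos hω (hne w (by simpa using hw))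
    rw [supportFn_smul (by positivity), inv_mul_cancel₀ h0.ne']

/-- The part of the singular sphere where the control is bounded by `M`; a point with
`(B̃, B) = 0` belongs to it only if `(p, AB) = 0`. -/
def controlBound (ω : Fin N → ℝ) (M : ℝ) : Set (Space N) :=
  {p ∈ singularSphere ω | |inner ℝ p ((oscMatrix ω).toEuclideanLin (inputVec N))| ≤
    M * inner ℝ (bTilde ω p) (inputVec N)}

theorem isCompact_controlBound (hω : ∀ i, 0 < ω i) (M : ℝ) : IsCompact (controlBound ω M) := by
  have hS := isCompact_supportFn_eq_one hω
  have h1 : ContinuousOn (fun p : Space N =>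
      |inner ℝ p ((oscMatrix ω).toEuclideanLin (inputVec N))| -
        M * inner ℝ (bTilde ω p) (inputVec N)) {p | supportFn ω p = 1} := fun p hp => by
    have := continuousAt_bTilde hω hp
    exact ContinuousAt.continuousWithinAt (by fun_prop)
  have h2 := h1.preimage_isClosed_of_isClosed hS.isClosed (isClosed_Iic (a := 0))
  have h3 : IsClosed {p : Space N | inner ℝ p (inputVec N) = 0} :=
    isClosed_eq (by fun_prop) continuous_const
  refine hS.of_isClosed_subset (?_ : IsClosed (controlBound ω M)) fun p hp => hp.1.1
  convert h2.inter h3 using 1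
  ext p
  simp only [controlBound, singularSphere, mem_ofPred_eq, mem_inter_iff, mem_preimage, mem_Iic,
    sub_nonpos]
  tauto

theorem abs_singularControl_le (hω : ∀ i, 0 < ω i) {M : ℝ} (hM : 0 ≤ M) {p : Space N}
    (hp : p ∈ controlBound ω M) : |singularControl ω p| ≤ M := by
  have h0 := inner_bTilde_nonneg hω hp.1.1
  rcases eq_or_lt_of_le h0 with h | h
  · rw [singularControl, ← h, div_zero, abs_zero]; exact hM
  · rw [singularControl, abs_div, abs_of_pos h, div_le_iff₀ h]; exact hp.2

/-- The right-hand side of the equation of motion. -/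
def singularField (ω : Fin N → ℝ) (p : Space N) : Space N :=
  -((oscMatrix ω).transpose.toEuclideanLin p) + singularControl ω p • bTilde ω p

/-- At the exceptional points `f` may jump, but it stays bounded by `M` while `B̃` tends to `0`. -/
theorem continuousOn_singularField (hω : ∀ i, 0 < ω i) {M : ℝ} (hM : 0 ≤ M) :
    ContinuousOn (singularField ω) (controlBound ω M) := by
  intro p hp
  have hB := continuousAt_bTilde hω hp.1.1
  have hA : Continuous fun p : Space N => -((oscMatrix ω).transpose.toEuclideanLin p) :=
    (LinearMap.continuous_of_finiteDimensional _).neg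
  refine hA.continuousWithinAt.add ?_
  by_cases h : inner ℝ (bTilde ω p) (inputVec N) = 0
  · have hB0 := bTilde_eq_zero hω hp.1.1 h
    rw [ContinuousWithinAt, hB0, smul_zero]
    refine squeeze_zero_norm' (a := fun q => M * ‖bTilde ω q‖) ?_ ?_
    · filter_upwards [self_mem_nhdsWithin] with q hq
      rw [norm_smul]
      gcongr
      exact abs_singularControl_le hω hM hq
    · have := (hB.norm.const_mul M).continuousWithinAt (s := controlBound ω M)
      rw [ContinuousWithinAt, hB0, norm_zero, mul_zero] at this
      exact this
  · have hc : ContinuousAt (singularControl ω) p :=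
      ContinuousAt.div (by fun_prop) (by fun_prop) h
    exact (hc.smul hB).continuousWithinAt

/-- Where `(B̃, B) = 0` the motion is momentarily free, so differentiating the constraint `(p, B) =
0` gives `(p, AB) = 0`, as the definition of the set requires. -/
theorem IsTrajectory.mem_controlBound (hω : ∀ i, 0 < ω i) {p : ℝ → Space N}
    (hp : IsTrajectory ω p) {t M : ℝ} (h : |singularControl ω (p t)| ≤ M) :
    p t ∈ controlBound ω M := by
  have hs := hp.mem_sphere t
  refine ⟨hs, ?_⟩
  rcases eq_or_lt_of_le (inner_bTilde_nonneg hω hs.1) with h0 | h0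
  · have hd := hp.hasDerivAt t
    rw [bTilde_eq_zero hω hs.1 h0.symm, smul_zero, add_zero] at hd
    have h1 := hd.inner ℝ (hasDerivAt_const t (inputVec N))
    have h2 : (fun t => inner ℝ (p t) (inputVec N)) = fun _ => (0 : ℝ) :=
      funext fun t => (hp.mem_sphere t).2
    rw [h2] at h1
    have h3 := h1.unique (hasDerivAt_const t 0)
    rw [inner_zero_right, zero_add, inner_neg_left, inner_toEuclideanLin_transpose, neg_eq_zero] at h3
    rw [h3, ← h0, abs_zero, mul_zero]
  · rw [singularControl, abs_div, abs_of_pos h0, div_le_iff₀ h0] at h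
    exact h

/-! ### Limits of trajectories -/

/-- An ultrafilter limit at each time replaces the extraction of a subsequence. The derivative
passes to the limit because the linearization estimate is uniform in `n`: the curves are
equi-Lipschitz and `F` is uniformly continuous on `K`. -/
theorem exists_limit_solution {E : Type*} [NormedAddCommGroup E] [NormedSpace ℝ E] {K : Set E}
    (hK : IsCompact K) {F : E → E} (hF : ContinuousOn F K) {u : ℕ → ℝ → E}
    (huK : ∀ n t, u n t ∈ K) (hu : ∀ n t, HasDerivAt (u n) (F (u n t)) t) :
    ∃ q : ℝ → E, (∀ t, Tendsto (fun n => u n t) (hyperfilter ℕ) (𝓝 (q t))) ∧ (∀ t, q t ∈ K) ∧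
      ∀ t, HasDerivAt q (F (q t)) t := by
  have hlim : ∀ t, ∃ x ∈ K, Tendsto (fun n => u n t) (hyperfilter ℕ) (𝓝 x) := fun t =>
    hK.ultrafilter_le_nhds ((hyperfilter ℕ).map fun n => u n t)
      (le_principal_iff.2 (mem_map.2 (Eventually.of_forall fun n => huK n t)))
  choose q hqK hq using hlim
  refine ⟨q, hq, hqK, fun s => ?_⟩
  obtain ⟨C, hC⟩ := hK.exists_bound_of_continuousOn hF
  have hC0 : 0 ≤ C := (norm_nonneg _).trans (hC _ (hqK 0))
  have hlip : ∀ n t s, ‖u n t - u n s‖ ≤ C * ‖t - s‖ := fun n t s =>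
    convex_univ.norm_image_sub_le_of_norm_hasDerivWithin_le
      (fun x _ => (hu n x).hasDerivWithinAt) (fun x _ => hC _ (huK n x)) (mem_univ s) (mem_univ t)
  have hunif := Metric.uniformContinuousOn_iff.1 (hK.uniformContinuousOn_of_continuous hF)
  rw [hasDerivAt_iff_isLittleO, Asymptotics.isLittleO_iff]
  intro ε hε
  obtain ⟨δ, hδ, hδF⟩ := hunif ε hε
  have hδC : 0 < δ / (C + 1) := by positivity
  filter_upwards [Metric.ball_mem_nhds s hδC] with t ht
  have hn : ∀ n, ‖u n t - u n s - (t - s) • F (u n s)‖ ≤ ε * ‖t - s‖ := fun n => by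
    have h1 := (convex_ball s (δ / (C + 1))).norm_image_sub_le_of_norm_hasDerivWithin_le (C := ε)
      (f := fun t => u n t - t • F (u n s)) (f' := fun t => F (u n t) - F (u n s))
      (fun x _ => ((hu n x).sub (by
        simpa using (hasDerivAt_id x).smul_const (F (u n s)))).hasDerivWithinAt)
      (fun x hx => by
        rw [← dist_eq_norm]
        refine (hδF _ (huK n x) _ (huK n s) ?_).le
        rw [dist_eq_norm]
        refine (hlip n x s).trans_lt ?_
        have hx : ‖x - s‖ < δ / (C + 1) := by rwa [← dist_eq_norm]
        rw [lt_div_iff₀ (by positivity)] at hx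
        nlinarith [norm_nonneg (x - s)])
      (Metric.mem_ball_self hδC) ht
    refine le_trans (le_of_eq ?_) h1
    congr 1
    rw [sub_smul]
    abel
  have hFs : Tendsto (fun n => F (u n s)) (hyperfilter ℕ) (𝓝 (F (q s))) :=
    (hF (q s) (hqK s)).tendsto.comp
      (tendsto_nhdsWithin_iff.2 ⟨hq s, Eventually.of_forall fun n => huK n s⟩)
  exact le_of_tendsto (((hq t).sub (hq s)).sub (hFs.const_smul (t - s))).norm
    (Eventually.of_forall hn)

end Oscillators

/-! ### The equilibrium and the minimizing trajectory -/

section Oscillators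

variable {N : ℕ} {ω : Fin N → ℝ}

theorem hasDerivAt_of_coord {X : ℝ → Space N} {v : Space N} {t : ℝ}
    (h : ∀ k, HasDerivAt (fun t => X t k) (v k) t) : HasDerivAt X v t :=
  (EuclideanSpace.equiv (Fin 2 × Fin N) ℝ).symm.hasFDerivAt.comp_hasDerivAt t (hasDerivAt_pi.2 h)

theorem hasDerivAt_coord {X : ℝ → Space N} {v : Space N} {t : ℝ} (h : HasDerivAt X v t)
    (k : Fin 2 × Fin N) : HasDerivAt (fun t => X t k) (v k) t :=
  (EuclideanSpace.proj k : Space N →L[ℝ] ℝ).hasFDerivAt.comp_hasDerivAt t h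

/-- The free oscillation through the vector `c • (ω_i ^ (-2), 0)`. -/
def freeOrbit (ω : Fin N → ℝ) (c t : ℝ) : Space N :=
  WithLp.toLp 2 fun k => if k.1 = 1 then -(c * (ω k.2)⁻¹ * Real.sin (ω k.2 * t)) else
    c * (ω k.2 ^ 2)⁻¹ * Real.cos (ω k.2 * t)

theorem freeOrbit_one (c t : ℝ) (i : Fin N) :
    freeOrbit ω c t (1, i) = -(c * (ω i)⁻¹ * Real.sin (ω i * t)) := by simp [freeOrbit]

theorem freeOrbit_zero (c t : ℝ) (i : Fin N) :
    freeOrbit ω c t (0, i) = c * (ω i ^ 2)⁻¹ * Real.cos (ω i * t) := by simp [freeOrbit]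

theorem radius_freeOrbit (hω : ∀ i, 0 < ω i) {c : ℝ} (hc : 0 < c) (t : ℝ) :
    radius (fun i => ω i ^ 2) (freeOrbit ω c t) = fun i => c * (ω i)⁻¹ := by
  ext i
  have hi := hω i
  rw [radius, freeOrbit_one, freeOrbit_zero]
  conv_rhs => rw [← Real.sqrt_sq (show 0 ≤ c * (ω i)⁻¹ by positivity)]
  congr 1
  have := Real.sin_sq_add_cos_sq (ω i * t)
  field_simp
  rw [this]

theorem hasDerivAt_freeOrbit (hω : ∀ i, 0 < ω i) (c : ℝ) :
    HasDerivAt (freeOrbit ω c) (-(c • inputVec N)) 0 := by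
  refine hasDerivAt_of_coord fun ⟨k, i⟩ => ?_
  have hi := (hω i).ne'
  have hlin : HasDerivAt (fun t : ℝ => ω i * t) (ω i) 0 := by
    simpa using (hasDerivAt_id (0 : ℝ)).const_mul (ω i)
  fin_cases k
  · have h := (hlin.cos).const_mul (c * (ω i ^ 2)⁻¹)
    simp only [mul_zero, Real.sin_zero, neg_zero, zero_mul] at h
    simpa [freeOrbit, inputVec] using h
  · have h := ((hlin.sin).const_mul (c * (ω i)⁻¹)).fun_neg
    simp only [mul_zero, Real.cos_zero, one_mul] at h
    rw [show -(c * (ω i)⁻¹ * ω i) = -c by field_simp] at h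
    simpa [freeOrbit, inputVec] using h

/-- Along a free orbit the radii are constant, so `∂ρ/∂x` itself moves freely, by `-A^*`. On the
orbit chosen here the velocity at time `0` is `-c B`, so the chain rule gives `-c B̃ = -A^* p`: the
control `f = c` holds `p` at rest. -/
theorem exists_equilibrium (hN : 1 ≤ N) (hω : ∀ i, 0 < ω i) :
    ∃ p : Space N, IsTrajectory ω fun _ => p := by
  have ha : ∀ i, 0 < ω i ^ 2 := fun i => pow_pos (hω i) 2
  have hne : ∀ c : ℝ, 0 < c → ∀ t, freeOrbit ω c t ≠ 0 := fun c hc t h => by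
    have h1 := congrFun (radius_freeOrbit hω hc t) ⟨0, hN⟩
    have h2 := hω ⟨0, hN⟩
    have h3 : 0 < c * (ω ⟨0, hN⟩)⁻¹ := by positivity
    rw [h] at h1
    simp only [radius, PiLp.zero_apply] at h1
    norm_num at h1
    exact h1.elim hc.ne' h2.ne'
  have hr := rho_pos hω (hne 1 one_pos 0)
  -- This scaling puts the orbit's starting point on the boundary of the body, where it equals
  -- `bodyPoint ω p`.
  set c := (rho ω (freeOrbit ω 1 0))⁻¹ with hc_def
  have hc : 0 < c := inv_pos.2 hr
  have hX0 : freeOrbit ω c 0 = c • freeOrbit ω 1 0 := by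
    ext ⟨k, i⟩
    simp [freeOrbit]
  set X := freeOrbit ω c with hX
  have hrX : rho ω (X 0) = 1 := by
    rw [hX0, rho, gauge_smul_of_nonneg hc.le, ← rho, smul_eq_mul, hc_def, inv_mul_cancel₀ hr.ne']
  set γ := dualGrad fun i => c * (ω i)⁻¹ with hγ
  have hg1 : ∀ t i, gradient (rho ω) (X t) (1, i) = -(γ i * Real.sin (ω i * t)) := fun t i => by
    have hi := (hω i).ne'
    rw [gradient_rho hω (hne c hc t), polarLift_one, radius_freeOrbit hω hc, freeOrbit_one, ← hγ]
    field_simp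
  have hg0 : ∀ t i, gradient (rho ω) (X t) (0, i) = γ i * ω i * Real.cos (ω i * t) := fun t i => by
    have hi := (hω i).ne'
    rw [gradient_rho hω (hne c hc t), polarLift_zero, radius_freeOrbit hω hc, freeOrbit_zero, ← hγ]
    field_simp
  set p := gradient (rho ω) (X 0) with hp
  have hp1 : ∀ i, p (1, i) = 0 := fun i => by rw [hp, hg1]; simp
  have hp0 : ∀ i, p (0, i) = γ i * ω i := fun i => by rw [hp, hg0]; simp
  have hHp : supportFn ω p = 1 := supportFn_gradient_rho hω (hne c hc 0)
  have hpB : inner ℝ p (inputVec N) = 0 := by rw [inner_inputVec]; simp [hp1]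
  have hbody : bodyPoint ω p = X 0 := by
    have := rho_smul_gradient_supportFn hω (hne c hc 0)
    rwa [hrX, one_smul] at this
  have hd1 : HasDerivAt (fun t => gradient (rho ω) (X t))
      (fderiv ℝ (gradient (rho ω)) (X 0) (-(c • inputVec N))) 0 :=
    (hasStrictFDerivAt_gradient_rho hω (hne c hc 0)).hasFDerivAt.comp_hasDerivAt 0
      (hasDerivAt_freeOrbit hω c)
  have hd2 : HasDerivAt (fun t => gradient (rho ω) (X t))
      (-((oscMatrix ω).transpose.toEuclideanLin p)) 0 := by
    refine hasDerivAt_of_coord fun ⟨k, i⟩ => ?_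
    have hlin : HasDerivAt (fun t : ℝ => ω i * t) (ω i) 0 := by
      simpa using (hasDerivAt_id (0 : ℝ)).const_mul (ω i)
    fin_cases k
    · have h := (hlin.cos).const_mul (γ i * ω i)
      simp only [mul_zero, Real.sin_zero, neg_zero, zero_mul] at h
      change HasDerivAt (fun t => gradient (rho ω) (X t) (0, i))
        (-((oscMatrix ω).transpose.toEuclideanLin p (0, i))) 0
      simp only [hg0]
      rw [toEuclideanLin_transpose_zero, hp1]
      simpa using h
    · have h := ((hlin.sin).const_mul (γ i)).fun_neg
      simp only [mul_zero, Real.cos_zero, one_mul] at h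
      change HasDerivAt (fun t => gradient (rho ω) (X t) (1, i))
        (-((oscMatrix ω).transpose.toEuclideanLin p (1, i))) 0
      simp only [hg1]
      rw [toEuclideanLin_transpose_one, hp0]
      exact h
  have hB : c • bTilde ω p = (oscMatrix ω).transpose.toEuclideanLin p := by
    have := hd1.unique hd2
    rw [map_neg, map_smul, neg_inj] at this
    rw [bTilde, hbody, this]
  have hBB : c * inner ℝ (bTilde ω p) (inputVec N) =
      inner ℝ p ((oscMatrix ω).toEuclideanLin (inputVec N)) := by
    rw [← inner_toEuclideanLin_transpose, ← hB, real_inner_smul_left]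
  have hBne : inner ℝ (bTilde ω p) (inputVec N) ≠ 0 := fun h => by
    have h1 := bTilde_eq_zero hω hHp h
    rw [h1, smul_zero] at hB
    refine (bodyPoint_ne_zero hω hHp).1 ?_
    ext ⟨k, i⟩
    fin_cases k
    · have := toEuclideanLin_transpose_one (ω := ω) p i
      rw [← hB] at this
      exact this.symm
    · exact hp1 i
  have hf : singularControl ω p = c := by
    rw [singularControl, ← hBB, mul_div_cancel_right₀ _ hBne]
  refine ⟨p, fun _ => ⟨hHp, hpB⟩, fun t => ?_⟩
  rw [hf, hB, neg_add_cancel]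
  exact hasDerivAt_const t p

theorem maxControl_le_iff {p : ℝ → Space N} {M : ℝ} (hM : 0 ≤ M) :
    maxControl ω p ≤ ENNReal.ofReal M ↔ ∀ t, |singularControl ω (p t)| ≤ M := by
  rw [maxControl, iSup_le_iff]
  exact forall_congr' fun t => ENNReal.ofReal_le_ofReal_iff hM

/-- The infimum of the maximal controls over all trajectories is attained if it is finite. -/
theorem exists_maxControl_le (hω : ∀ i, 0 < ω i) {m : ℝ} (hm : 0 ≤ m)
    (h : ∀ ε > 0, ∃ p, IsTrajectory ω p ∧ maxControl ω p ≤ ENNReal.ofReal (m + ε)) :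
    ∃ p, IsTrajectory ω p ∧ maxControl ω p ≤ ENNReal.ofReal m := by
  have hε : ∀ n : ℕ, (0 : ℝ) < 1 / (n + 1) := fun n => by positivity
  choose u hu hum using fun n : ℕ => h (1 / (n + 1)) (hε n)
  have hfu : ∀ n t, |singularControl ω (u n t)| ≤ m + 1 / (n + 1) := fun n =>
    (maxControl_le_iff (by have := hε n; positivity)).1 (hum n)
  have hmem : ∀ (n : ℕ) (t M : ℝ), m + 1 / ((n : ℝ) + 1) ≤ M → u n t ∈ controlBound ω M := fun n t M hM =>
    (hu n).mem_controlBound hω ((hfu n t).trans hM)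
  have hm1 : 0 ≤ m + 1 := by positivity
  -- The fixed bound `m + 1` puts all the approximating trajectories in one compact set.
  obtain ⟨q, hq, hqK, hqd⟩ := exists_limit_solution (isCompact_controlBound hω (m + 1))
    (continuousOn_singularField hω hm1) (u := u)
    (fun (n : ℕ) t => hmem n t _ (by
      gcongr
      rw [div_le_one (by positivity)]
      exact le_add_of_nonneg_left n.cast_nonneg))
    (fun (n : ℕ) t => (hu n).hasDerivAt t)
  refine ⟨q, ⟨fun t => (hqK t).1, hqd⟩, (maxControl_le_iff hm).2 fun t => ?_⟩
  refine le_of_forall_pos_le_add fun ε hε0 => ?_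
  -- The control need not be continuous, so its bound is passed to the limit through the closed sets
  -- `controlBound ω (m + ε)`.
  refine abs_singularControl_le hω (by positivity)
    ((isCompact_controlBound hω (m + ε)).isClosed.mem_of_tendsto (hq t) ?_)
  refine Filter.Eventually.filter_mono (Nat.hyperfilter_le_atTop) ?_
  filter_upwards [(tendsto_one_div_add_atTop_nhds_zero_nat (𝕜 := ℝ)).eventually_lt_const hε0]
    with n hn
  exact hmem n t _ (by gcongr)

/-- Free motion sends the `η` relation to the `ξ` relation with the same weights, and the `ξ`
relation to the `η` relation with one more factor `ω_i ^ 2`. -/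
theorem sum_pow_mul_eq_zero_of_control_eq_zero {p : ℝ → Space N} (hp : IsTrajectory ω p)
    (h : ∀ t, singularControl ω (p t) = 0) (k : ℕ) :
    (∀ t, ∑ i, (ω i ^ 2) ^ k * p t (1, i) = 0) ∧ ∀ t, ∑ i, (ω i ^ 2) ^ k * p t (0, i) = 0 := by
  have hd : ∀ t, HasDerivAt p (-((oscMatrix ω).transpose.toEuclideanLin (p t))) t := fun t => by
    have := hp.hasDerivAt t
    rwa [h t, zero_smul, add_zero] at this
  have hd1 : ∀ t i, HasDerivAt (fun t => p t (1, i)) (-(p t (0, i))) t := fun t i => by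
    rw [← toEuclideanLin_transpose_one (ω := ω)]; exact hasDerivAt_coord (hd t) (1, i)
  have hd0 : ∀ t i, HasDerivAt (fun t => p t (0, i)) (ω i ^ 2 * p t (1, i)) t := fun t i => by
    rw [← neg_neg (ω i ^ 2 * _), ← toEuclideanLin_transpose_zero]
    exact hasDerivAt_coord (hd t) (0, i)
  have hstep : ∀ k, (∀ t, ∑ i, (ω i ^ 2) ^ k * p t (1, i) = 0) →
      ∀ t, ∑ i, (ω i ^ 2) ^ k * p t (0, i) = 0 := fun k hk t => by
    have h1 := HasDerivAt.fun_sum (u := Finset.univ) fun i _ =>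
      (hd1 t i).const_mul ((ω i ^ 2) ^ k)
    rw [show (fun t => ∑ i, (ω i ^ 2) ^ k * p t (1, i)) = fun _ => (0 : ℝ) from funext hk] at h1
    have h2 := h1.unique (hasDerivAt_const t 0)
    simpa using h2
  induction k with
  | zero =>
    have h0 : ∀ t, ∑ i, (ω i ^ 2) ^ 0 * p t (1, i) = 0 := fun t => by
      have := (hp.mem_sphere t).2
      rw [inner_inputVec] at this
      simpa using this
    exact ⟨h0, hstep 0 h0⟩
  | succ k ih =>
    have h0 : ∀ t, ∑ i, (ω i ^ 2) ^ (k + 1) * p t (1, i) = 0 := fun t => by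
      have h1 := HasDerivAt.fun_sum (u := Finset.univ) fun i _ =>
        (hd0 t i).const_mul ((ω i ^ 2) ^ k)
      rw [show (fun t => ∑ i, (ω i ^ 2) ^ k * p t (0, i)) = fun _ => (0 : ℝ) from
        funext ih.2] at h1
      have h2 := h1.unique (hasDerivAt_const t 0)
      rw [← h2]
      exact Finset.sum_congr rfl fun i _ => by ring
    exact ⟨h0, hstep (k + 1) h0⟩

theorem exists_singularControl_ne_zero (hω : ∀ i, 0 < ω i) (hinj : Function.Injective ω)
    {p : ℝ → Space N} (hp : IsTrajectory ω p) : ∃ t, singularControl ω (p t) ≠ 0 := by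
  by_contra! h
  have hinj2 : Function.Injective fun i => ω i ^ 2 := fun i j hij =>
    hinj ((pow_left_inj₀ (hω i).le (hω j).le two_ne_zero).1 hij)
  have hs := sum_pow_mul_eq_zero_of_control_eq_zero hp h
  have hT : ∀ v : Fin N → ℝ, (∀ k : ℕ, ∑ i, (ω i ^ 2) ^ k * v i = 0) → v = 0 := fun v hv =>
    Matrix.eq_zero_of_forall_pow_sum_mul_pow_eq_zero hinj2 fun k => by
      rw [← hv k]; exact Finset.sum_congr rfl fun i _ => mul_comm _ _
  have h1 := hT (fun i => p 0 (1, i)) fun k => (hs k).1 0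
  have h0 := hT (fun i => p 0 (0, i)) fun k => (hs k).2 0
  refine (bodyPoint_ne_zero hω (hp.mem_sphere 0).1).1 ?_
  ext ⟨k, i⟩
  fin_cases k
  · exact congrFun h0 i
  · exact congrFun h1 i

end Oscillators

end OscillatorDamping

end

/-! ### Attainment, finiteness and positivity of the minimum -/

theorem mainTheorem7 (N : ℕ) (hN : 1 ≤ N) (ω : Fin N → ℝ) (hpos : ∀ i, 0 < ω i)
    (hinj : Function.Injective ω) :
    ∃ μ : ℝ, 0 < μ ∧
      IsLeast {m : ℝ≥0∞ | ∃ p : ℝ → OscillatorDamping.Space N,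
        OscillatorDamping.IsTrajectory ω p ∧ m = OscillatorDamping.maxControl ω p}
        (ENNReal.ofReal μ) := by
  open OscillatorDamping in
  set S : Set ℝ≥0∞ := {m | ∃ p : ℝ → Space N, IsTrajectory ω p ∧ m = maxControl ω p} with hS
  obtain ⟨p₀, hp₀⟩ := exists_equilibrium hN hpos
  have hfin : sInf S ≠ ⊤ := by
    have h1 : sInf S ≤ maxControl ω fun _ => p₀ := sInf_le ⟨_, hp₀, rfl⟩
    refine ne_top_of_le_ne_top ?_ h1
    rw [maxControl, ciSup_const]
    exact ENNReal.ofReal_ne_top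
  obtain ⟨q, hq, hqm⟩ := exists_maxControl_le hpos (m := (sInf S).toReal) ENNReal.toReal_nonneg
    fun ε hε => by
      have hlt : sInf S < ENNReal.ofReal ((sInf S).toReal + ε) := by
        rw [ENNReal.ofReal_add ENNReal.toReal_nonneg hε.le, ENNReal.ofReal_toReal hfin]
        exact ENNReal.lt_add_right hfin (ENNReal.ofReal_pos.2 hε).ne'
      obtain ⟨_, ⟨p, hp, rfl⟩, hlt⟩ := sInf_lt_iff.1 hlt
      exact ⟨p, hp, hlt.le⟩
  have hlow : IsLeast S (ENNReal.ofReal (sInf S).toReal) := by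
    rw [ENNReal.ofReal_toReal hfin] at hqm ⊢
    exact ⟨⟨q, hq, le_antisymm (sInf_le ⟨q, hq, rfl⟩) hqm⟩, fun m hm => sInf_le hm⟩
  refine ⟨(sInf S).toReal, lt_of_le_of_ne ENNReal.toReal_nonneg fun h => ?_, hlow⟩
  obtain ⟨t, ht⟩ := exists_singularControl_ne_zero hpos hinj hq
  have := (maxControl_le_iff ENNReal.toReal_nonneg).1 hqm t
  rw [← h, abs_nonpos_iff] at this
  exact ht this
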